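/- Vector supersymmetry of BF theory. Let $n\ge 0$ and consider $\mathbb R^{n+2}$ with a flat metric $g_{\mu\nu}=\mathrm{diag}(\pm1,\dots,\pm1)$ (in particular Euclidean or Minkowskian). Let $T_1,\dots,T_r$ be matrices with $[T_a,T_b]=if_{abc}T_c$ and $\mathrm{Tr}\,T_aT_b=\delta_{ab}$. All fields are Lie algebra valued forms $\varphi=\varphi^aT_a$; $\varphi^g_p$ denotes a field of ghost number $g$ and form degree $p$. The fields are $A=A^0_1$, $c=c^1_0$, $B^g_{n-g}$ ($0\le g\le n$), $\bar c^{-1}_0$, $\pi^0_0$, and, for $1\le k\le n$, $0\le g\le n-k$, $\bar C^{\gamma(k)}_{n-g-k}$ and $\Pi^{\gamma(k)+1}_{n-g-k}$, with $\gamma(k)=g$ for $k$ even and $\gamma(k)=-g-1$ for $k$ odd, together with the external sources $\gamma^{-1}_{n+1}$, $\tau^{-2}_{n+2}$, $b^{-g-1}_{g+2}$ ($0\le g\le n$). Fields outside these ranges are zero. All fields other than the sources are called quantum fields. Conventions. Forms are written $\omega=\sum_I\omega_I\,dx^I$ in the free graded-commutative algebra generated by the field components, all their derivatives and the $dx^\mu$,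 the grading being ghost number plus form degree. Local functionals $\int\omega$ are such forms modulo $d$-exact ones. $[\cdot,\cdot]$ is the graded commutator (the anticommutator for two odd objects). $\delta\Sigma/\delta\varphi$ is the left functional derivative, $\delta\Sigma=\int\mathrm{Tr}\,\delta\varphi\,\frac{\delta\Sigma}{\delta\varphi}$. An operator $\int\mathrm{Tr}\sum_\varphi Q_\varphi\frac{\delta}{\delta\varphi}$ is the graded derivation that maps each component $\varphi_I$ to $(Q_\varphi)_I$, commutes with $\partial_\mu$ and annihilates $dx^\mu$. For a constant vector $\xi^\mu$ with commuting components, $i_\xi$ is the (odd) inner derivative, $\mathcal L_\xi=[i_\xi,d]=\xi^\mu\partial_\mu$, and $g(\xi)=g_{\mu\nu}\xi^\mu dx^\nu$ acts by left multiplication. For a $p$-form $\omega$, $$(*\omega)_{\beta_1\cdots\beta_{n+2-p}}=\tfrac1{p!}\,\varepsilon_{\beta_1\cdots\beta_{n+2-p}\,\alpha_p\cdots\alpha_1}\,\omega^{\alpha_1\cdots\alpha_p}.$$ Classical action. Put $\hat\gamma=\gamma-*d\bar c$, $\hat b^{-g-1}_{g+2}=b^{-g-1}_{g+2}+(-1)^{g+1}*d\bar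 C^{-g-1}_{n-g-1}$ for $0\le g\le n-1$ (with $\bar C$ from the line $k=1$), $\hat b^{-n-1}_{n+2}=b^{-n-1}_{n+2}$, and form the ladders, indexed by the form degree $p=0,\dots,n+2$, $\phi^1=\{c,A,\hat b^{-1}_2,\dots,\hat b^{-n-1}_{n+2}\}$, $\phi^2=\{B^n_0,\dots,B^0_n,\hat\gamma,\tau\}$. For numbers $x_{k,g,n}$ let $\Sigma=\hat\Sigma+\Sigma_\Pi$, $$\hat\Sigma=\int\mathrm{Tr}\Big(\sum_{p=0}^{n+1}\phi^1_p\,d\phi^2_{n+1-p}+\tfrac12\sum_{p=0}^{n+2}\sum_{q=0}^{n+2-p}[\phi^1_p,\phi^1_q]\,\phi^2_{n+2-p-q}\Big),$$ $$\Sigma_\Pi=\int\mathrm{Tr}\Big\{-d\pi*A-\sum_{g=0}^{n-1}d\Pi^{-g}_{n-g-1}*B^g_{n-g}+\sum_{k=2}^n\sum_{g=0}^{n-k}\big[-d\Pi^{\gamma(k)+1}_{n-g-k}*\bar C^{\gamma(k-1)}_{n-g-k+1}+(-1)^{n+1}d\bar C^{\gamma(k)}_{n-g-k}*\Pi^{\gamma(k-1)+1}_{n-g-k+1}\big]+\sum_{1\le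 k\le n,\ k\text{ odd}}\ \sum_{g=1}^{n-k}x_{k,g,n}\,\Pi^{-g}_{n-g-k}*\Pi^g_{n-g-k}\Big\},$$ where in the last sum $\Pi^{-g}_{n-g-k}$ is in the line $k$ and $\Pi^{g}_{n-g-k}$ in the line $k+1$, at position $g-1$. Operators. The linearized Slavnov operator is $$\mathcal S_\Sigma=\int\mathrm{Tr}\Big\{\sum_{g=0}^n\Big(\frac{\delta\Sigma}{\delta b^{-g-1}_{g+2}}\frac{\delta}{\delta B^g_{n-g}}+\frac{\delta\Sigma}{\delta B^g_{n-g}}\frac{\delta}{\delta b^{-g-1}_{g+2}}\Big)+\frac{\delta\Sigma}{\delta\gamma}\frac{\delta}{\delta A}+\frac{\delta\Sigma}{\delta A}\frac{\delta}{\delta\gamma}+\frac{\delta\Sigma}{\delta\tau}\frac{\delta}{\delta c}+\frac{\delta\Sigma}{\delta c}\frac{\delta}{\delta\tau}+\pi\frac{\delta}{\delta\bar c}+\sum_{k=1}^n\sum_{g=0}^{n-k}\Pi^{\gamma(k)+1}_{n-g-k}\frac{\delta}{\delta\bar C^{\gamma(k)}_{n-g-k}}\Big\}.$$ $\mathcal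 W^T_{(\xi)}=\int\mathrm{Tr}\sum_\varphi\mathcal L_\xi\varphi\,\frac{\delta}{\delta\varphi}$ and $\mathcal W^S_{(\xi)}=\int\mathrm{Tr}\sum_\varphi\delta^S_{(\xi)}\varphi\,\frac{\delta}{\delta\varphi}$ (sums over all fields and sources), where $\delta^S_{(\xi)}$, on the antighosts, the multipliers and the ladders, is $$\delta^S_{(\xi)}\phi^A_p=-i_\xi\phi^A_{p+1}\ (0\le p\le n+1),\qquad\delta^S_{(\xi)}\phi^A_{n+2}=0\qquad(A=1,2),\qquad\delta^S_{(\xi)}\bar c=0,\qquad\delta^S_{(\xi)}\pi=\mathcal L_\xi\bar c,$$ and, for $1\le k\le n$, $0\le g\le n-k$, $$\delta^S_{(\xi)}\bar C^{\gamma(k)}_{n-g-k}=\begin{cases}(-1)^{n+(k+1)/2}g(\xi)\,\bar C^{-g-2}_{n-g-k-1}&(k\text{ odd}),\\(-1)^{k/2+1}\,i_\xi\bar C^{g-1}_{n-g-k+1}&(k\text{ even}),\end{cases}$$ $$\delta^S_{(\xi)}\Pi^{\gamma(k)+1}_{n-g-k}=\mathcal L_\xi\bar C^{\gamma(k)}_{n-g-k}+\begin{cases}(-1)^{n+(k+1)/2}g(\xi)\,\Pi^{-g-1}_{n-g-k-1}&(k\text{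 odd}),\\(-1)^{k/2+1}\,i_\xi\Pi^{g}_{n-g-k+1}&(k\text{ even}),\end{cases}$$ the fields with coefficient $g(\xi)$ or $i_\xi$ on the right being those of the same line $k$ at position $g+1$, respectively $g-1$ (and zero if there is no such position, i.e. for $g=n-k$, respectively $g=0$). Claim. (1) The derivation $\mathcal W^S_{(\xi)}$ reproduces these transformations, and for all values of the $x_{k,g,n}$ and all $\xi,\xi'$ the following hold off shell: $$[\mathcal S_\Sigma,\mathcal W^S_{(\xi)}]=\mathcal W^T_{(\xi)},\qquad\mathcal S_\Sigma^{\,2}=0,\qquad[\mathcal W^S_{(\xi)},\mathcal W^S_{(\xi')}]=0$$ (anticommutators, all three operators $\mathcal S_\Sigma,\mathcal W^S_{(\xi)},\mathcal W^S_{(\xi')}$ being odd). (2) If $x_{k,g,n}=(-1)^{n+g+(k+1)/2}$, then $\mathcal W^S_{(\xi)}\Sigma=\Delta^S_{(\xi)}$ with $$\Delta^S_{(\xi)}=\int\mathrm{Tr}\Big\{-\sum_{g=0}^nb^{-g-1}_{g+2}\,\mathcal L_\xi B^g_{n-g}+(-1)^n\gamma\,\mathcal L_\xi A+(-1)^n\tau\,\mathcal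 L_\xi c+(d*i_\xi b^{-1}_2)\,\pi+(d*i_\xi\gamma)\,\Pi^0_{n-1}\Big\}$$ (in the last term $\Pi^0_{n-1}$ is the multiplier with $k=1$, $g=0$, absent for $n=0$), and this breaking is linear in the quantum fields. -/

import Mathlib

open scoped TensorProduct

noncomputable section

namespace BF

/-! ## Gauge algebra and field content

Space-time is `ℝ^(n+2)` with flat metric `diag η`, `η μ = ± 1`. -/

/-- The gauge algebra: matrices `T a` with `[T_a, T_b] = i f_abc T_c` and `Tr T_a T_b = δ_ab`. -/
structure GaugeAlgebra (r N : ℕ) where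
  T : Fin r → Matrix (Fin N) (Fin N) ℂ
  f : Fin r → Fin r → Fin r → ℂ
  comm : ∀ a b, T a * T b - T b * T a = ∑ c, (Complex.I * f a b c) • T c
  trace_mul : ∀ a b, (T a * T b).trace = if a = b then 1 else 0

/-- The positions `(k, g)`, `1 ≤ k ≤ n`, `0 ≤ g ≤ n - k`, of the pyramids of antighosts and of
multipliers of the reducible symmetry. -/
abbrev Slot (n : ℕ) : Type := {s : ℕ × ℕ // 1 ≤ s.1 ∧ s.1 + s.2 ≤ n}

/-- All fields: `A`, `c`, `B^g_{n-g}`, `c̄`, `π`, `C̄^{γ(k)}_{n-g-k}`, `Π^{γ(k)+1}_{n-g-k}`, and the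
external sources `γ^{-1}_{n+1}`, `τ^{-2}_{n+2}`, `b^{-g-1}_{g+2}`. -/
inductive Field (n : ℕ) : Type
  | A : Field n
  | c : Field n
  | B (g : Fin (n + 1)) : Field n
  | cbar : Field n
  | pi : Field n
  | Cbar (s : Slot n) : Field n
  | Pi (s : Slot n) : Field n
  | gamma : Field n
  | tau : Field n
  | b (g : Fin (n + 1)) : Field n

/-- `γ(k) = g` for `k` even and `γ(k) = - g - 1` for `k` odd. -/
def gammaIdx (k g : ℕ) : ℤ := if Even k then (g : ℤ) else -(g : ℤ) - 1

/-- Form degree. -/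
def Field.deg {n : ℕ} : Field n → ℕ
  | .A => 1
  | .c => 0
  | .B g => n - (g : ℕ)
  | .cbar => 0
  | .pi => 0
  | .Cbar s => n - s.1.2 - s.1.1
  | .Pi s => n - s.1.2 - s.1.1
  | .gamma => n + 1
  | .tau => n + 2
  | .b g => (g : ℕ) + 2

/-- Ghost number. -/
def Field.gh {n : ℕ} : Field n → ℤ
  | .A => 0
  | .c => 1
  | .B g => (g : ℕ)
  | .cbar => -1
  | .pi => 0
  | .Cbar s => gammaIdx s.1.1 s.1.2
  | .Pi s => gammaIdx s.1.1 s.1.2 + 1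
  | .gamma => -1
  | .tau => -2
  | .b g => -((g : ℕ) : ℤ) - 1

/-- The external sources; all the other fields are quantum fields. -/
def Field.IsSource {n : ℕ} : Field n → Prop
  | .gamma => True
  | .tau => True
  | .b _ => True
  | _ => False

/-! ## The graded-commutative algebra of local forms

Local forms are polynomials in the components of the fields, their derivatives, and the `dx^μ`.
The grading is the ghost number plus the form degree, so that `dx^μ` anticommutes with the
components of odd ghost number. -/

/-- Generators: the derivative `∂_α φ^a_I` of the component `φ^a_I` (`I` an increasing
multi-index of length `deg φ`) of a field `φ`, and the differentials `dx^μ`. -/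
inductive Gen (n r : ℕ) : Type
  | jet (F : Field n) (I : {I : Finset (Fin (n + 2)) // I.card = F.deg}) (a : Fin r)
      (α : Fin (n + 2) → ℕ) : Gen n r
  | dx (μ : Fin (n + 2)) : Gen n r

/-- Generators of odd grading. -/
def Gen.IsOdd {n r : ℕ} : Gen n r → Prop
  | .jet F _ _ _ => Odd F.gh
  | .dx _ => True

abbrev EvenGen (n r : ℕ) : Type := {x : Gen n r // ¬ x.IsOdd}

abbrev OddGen (n r : ℕ) : Type := {x : Gen n r // x.IsOdd}

/-- The free graded-commutative algebra on the generators: polynomials in the even ones times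
exterior algebra on the odd ones. -/
abbrev Alg (n r : ℕ) : Type :=
  MvPolynomial (EvenGen n r) ℂ ⊗[ℂ] ExteriorAlgebra ℂ (OddGen n r →₀ ℂ)

variable {n r N : ℕ}

open Classical in
/-- A generator as an element of the algebra. -/
def gen (x : Gen n r) : Alg n r :=
  if h : x.IsOdd then 1 ⊗ₜ[ℂ] ExteriorAlgebra.ι ℂ (Finsupp.single ⟨x, h⟩ 1)
  else MvPolynomial.X ⟨x, h⟩ ⊗ₜ[ℂ] 1

open Classical in
/-- Left partial derivative `∂/∂x` with respect to a generator (an antiderivation if `x` is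
odd). -/
def pd (x : Gen n r) : Module.End ℂ (Alg n r) :=
  if h : x.IsOdd then
    LinearMap.lTensor _ (CliffordAlgebra.contractLeft (Q := 0) (Finsupp.lapply ⟨x, h⟩))
  else LinearMap.rTensor _ (MvPolynomial.pderiv (R := ℂ) (⟨x, h⟩ : EvenGen n r)).toLinearMap

theorem contractLeft_support_finite (e : ExteriorAlgebra ℂ (OddGen n r →₀ ℂ)) :
    {x : OddGen n r |
      CliffordAlgebra.contractLeft (Q := 0) (Finsupp.lapply x : Module.Dual ℂ (OddGen n r →₀ ℂ)) e
        ≠ 0}.Finite := by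
  induction e using CliffordAlgebra.left_induction with
  | algebraMap c => simp [CliffordAlgebra.contractLeft_algebraMap]
  | add x y hx hy =>
    refine (hx.union hy).subset fun z hz => ?_
    by_contra h
    simp only [Set.mem_union, Set.mem_ofPred_eq, not_or, not_not] at h
    exact hz (by rw [map_add, h.1, h.2, add_zero])
  | ι_mul x m hx =>
    refine (hx.union m.support.finite_toSet).subset fun z hz => ?_
    by_contra h
    simp only [Set.mem_union, Set.mem_ofPred_eq, not_or, not_not, Finset.mem_coe,
      Finsupp.notMem_support_iff] at h
    exact hz (by rw [CliffordAlgebra.contractLeft_ι_mul, h.1]; simp [h.2])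

/-- Only finitely many generators occur in an element. -/
theorem pd_support_finite (u : Alg n r) : {x : Gen n r | pd x u ≠ 0}.Finite := by
  classical
  induction u using TensorProduct.induction_on with
  | zero => simp
  | add u v hu hv =>
    refine (hu.union hv).subset fun z hz => ?_
    by_contra h
    simp only [Set.mem_union, Set.mem_ofPred_eq, not_or, not_not] at h
    exact hz (by rw [map_add, h.1, h.2, add_zero])
  | tmul p e =>
    refine ((p.vars.finite_toSet.image Subtype.val).union
      ((contractLeft_support_finite e).image Subtype.val)).subset fun z hz => ?_
    by_contra h
    simp only [Set.mem_union, not_or, Set.mem_image, not_exists, not_and] at h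
    refine hz ?_
    by_cases hz' : z.IsOdd
    · have := h.2 ⟨z, hz'⟩
      simp only [Set.mem_ofPred_eq, not_true_eq_false, imp_false, not_not] at this
      simp [pd, hz', this]
    · have := h.1 ⟨z, hz'⟩
      simp only [not_true_eq_false, imp_false, Finset.mem_coe] at this
      simp [pd, hz', MvPolynomial.pderiv_eq_zero_of_notMem_vars this]

/-- The operator `∑_x v_x ∂/∂x`. -/
def vf (v : Gen n r → Alg n r) : Module.End ℂ (Alg n r) where
  toFun u := ∑ᶠ x, v x * pd x u
  map_add' u w := by
    rw [← finsum_add_distrib]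
    · exact finsum_congr fun x => by rw [map_add, mul_add]
    · exact (pd_support_finite u).subset fun x hx h => hx (by simp [h])
    · exact (pd_support_finite w).subset fun x hx h => hx (by simp [h])
  map_smul' c u := by
    rw [RingHom.id_apply, smul_finsum]
    exact finsum_congr fun x => by rw [map_smul, mul_smul_comm]

/-! ## Calculus of local forms -/

/-- Total derivative `∂_μ`. -/
def del (μ : Fin (n + 2)) : Module.End ℂ (Alg n r) :=
  vf fun x => match x with
    | .jet F I a α => gen (.jet F I a (α + Pi.single μ 1))
    | .dx _ => 0

/-- Iterated total derivative `∂_α`. -/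
def delIter (α : Fin (n + 2) → ℕ) : Module.End ℂ (Alg n r) :=
  (List.ofFn fun μ => (del μ : Module.End ℂ (Alg n r)) ^ α μ).prod

/-- Exterior derivative `d = dx^μ ∂_μ`. -/
def extd : Module.End ℂ (Alg n r) :=
  ∑ μ, LinearMap.mulLeft ℂ (gen (.dx μ)) * del μ

/-- Inner derivative `i_ξ = ξ^μ ∂/∂(dx^μ)`. -/
def inner (ξ : Fin (n + 2) → ℂ) : Module.End ℂ (Alg n r) := ∑ μ, ξ μ • pd (.dx μ)

/-- Lie derivative `L_ξ = [i_ξ, d]` (both operators are odd). -/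
def lie (ξ : Fin (n + 2) → ℂ) : Module.End ℂ (Alg n r) := inner ξ * extd + extd * inner ξ

/-- Left multiplication by `g(ξ) = g_{μν} ξ^μ dx^ν`. -/
def gMul (η : Fin (n + 2) → ℤˣ) (ξ : Fin (n + 2) → ℂ) : Module.End ℂ (Alg n r) :=
  LinearMap.mulLeft ℂ (∑ μ, (((η μ : ℤ) : ℂ) * ξ μ) • gen (.dx μ))

/-- `dx^I = dx^{i_1} ⋯ dx^{i_p}` for `I = {i_1 < ⋯ < i_p}`. -/
def dxI (I : Finset (Fin (n + 2))) : Alg n r := ((I.sort (· ≤ ·)).map fun μ => gen (.dx μ)).prod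

/-- `∂/∂(dx^{i_p}) ⋯ ∂/∂(dx^{i_1})` for `I = {i_1 < ⋯ < i_p}`, with `∂/∂(dx^{i_1})` acting first. -/
def contr (I : Finset (Fin (n + 2))) : Module.End ℂ (Alg n r) :=
  ((I.sort (· ≤ ·)).reverse.map fun μ => (pd (.dx μ) : Module.End ℂ (Alg n r))).prod

/-- The parity automorphism of the grading. -/
def parity : Alg n r →ₐ[ℂ] Alg n r :=
  Algebra.TensorProduct.map (AlgHom.id ℂ _) (CliffordAlgebra.involute (Q := 0))

open Classical in
/-- The algebra homomorphism setting all the `dx^μ` to zero. -/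
def dxZero : Alg n r →ₐ[ℂ] Alg n r :=
  Algebra.TensorProduct.map (AlgHom.id ℂ _) (ExteriorAlgebra.map
    (Finsupp.linearCombination ℂ fun x : OddGen n r =>
      match x.1 with
      | .jet _ _ _ _ => Finsupp.single x 1
      | .dx _ => 0))

/-- The component `ω_I` of `ω = ∑_I ω_I dx^I`. -/
def coef (I : Finset (Fin (n + 2))) : Module.End ℂ (Alg n r) :=
  dxZero.toLinearMap * parity.toLinearMap ^ I.card * contr I

/-- `ε_{K I}` for increasing multi-indices `K`, `I` that are complementary to each other. -/
def eps (K I : Finset (Fin (n + 2))) : ℂ := (-1) ^ ((K ×ˢ I).filter fun q => q.2 < q.1).card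

/-- Hodge duality: `(*ω)_{β_1 ⋯ β_{d-p}} = (1/p!) ε_{β_1 ⋯ β_{d-p} α_p ⋯ α_1} ω^{α_1 ⋯ α_p}` for a
`p`-form `ω`, indices being raised with the metric. The sign `(-1)^{p(p-1)/2}` is the one of the
reversal of `α_1 ⋯ α_p`. -/
def hodge (η : Fin (n + 2) → ℤˣ) : Module.End ℂ (Alg n r) :=
  ∑ I : Finset (Fin (n + 2)),
    ((-1) ^ (I.card * (I.card - 1) / 2) * eps Iᶜ I * ∏ μ ∈ I, ((η μ : ℤ) : ℂ)) •
      (LinearMap.mulRight ℂ (dxI Iᶜ) * coef I)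

/-! ## Lie algebra valued forms, local functionals, functional derivatives -/

/-- Lie algebra valued forms `X = X^a T_a`, given by the `X^a`. -/
abbrev LForm (n r : ℕ) : Type := Fin r → Alg n r

/-- An operator on forms acts on Lie algebra valued forms. -/
def app (D : Module.End ℂ (Alg n r)) (X : LForm n r) : LForm n r := fun a => D (X a)

/-- `Tr X Y`. -/
def Tr (G : GaugeAlgebra r N) (X Y : LForm n r) : Alg n r :=
  ∑ a, ∑ b, (G.T a * G.T b).trace • (X a * Y b)

/-- The graded commutator: on forms of definite grading
`X Y - (-1)^{|X||Y|} Y X = X^a Y^b [T_a, T_b]`. -/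
def bracket (G : GaugeAlgebra r N) (X Y : LForm n r) : LForm n r :=
  fun c => ∑ a, ∑ b, (Complex.I * G.f a b c) • (X a * Y b)

/-- Local functionals: local forms modulo total derivatives. -/
abbrev LocalFunctional (n r : ℕ) : Type :=
  Alg n r ⧸ LinearMap.range (extd : Module.End ℂ (Alg n r))

/-- `∫_{ℝ^{n+2}}`. -/
def integral : Alg n r →ₗ[ℂ] LocalFunctional n r := Submodule.mkQ _

/-- The field `φ` as the Lie algebra valued form `∑_I φ_I dx^I`. -/
def fld (F : Field n) : LForm n r := fun a => ∑ I, gen (.jet F I a 0) * dxI I.1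

/-- Euler operator: variational left derivative of `∫ L` with respect to `φ^a_I`. -/
def euler (F : Field n) (I : {I : Finset (Fin (n + 2)) // I.card = F.deg}) (a : Fin r)
    (L : Alg n r) : Alg n r :=
  ∑ᶠ α : Fin (n + 2) → ℕ, (-1 : ℂ) ^ (∑ μ, α μ) • delIter α (pd (.jet F I a α) L)

/-- The functional derivative `δΣ/δφ` of `Σ = ∫ L`: the form of degree `n + 2 - deg φ` such that
`δΣ = ∫ Tr δφ (δΣ/δφ)` under a variation of `φ`. -/
def fder (L : Alg n r) (F : Field n) : LForm n r := fun a => ∑ I, contr I.1 (euler F I a L)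

/-- The functional operator `∫ Tr ∑_φ Q_φ δ/δφ`. -/
def ward (Q : Field n → LForm n r) : Module.End ℂ (Alg n r) :=
  vf fun x => match x with
    | .jet F I a α => delIter α (coef I.1 (Q F a))
    | .dx _ => 0

/-! ## The classical action -/

/-- `C̄^{γ(k)}_{n-g-k}`, zero outside the pyramid. -/
def CbarF (k g : ℕ) : LForm n r :=
  if h : 1 ≤ k ∧ k + g ≤ n then fld (.Cbar ⟨(k, g), h⟩) else 0

/-- `Π^{γ(k)+1}_{n-g-k}`, zero outside the pyramid. -/
def PiF (k g : ℕ) : LForm n r :=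
  if h : 1 ≤ k ∧ k + g ≤ n then fld (.Pi ⟨(k, g), h⟩) else 0

/-- `γ̂ = γ - * d c̄`. -/
def gammaHat (η : Fin (n + 2) → ℤˣ) : LForm n r :=
  fld .gamma - app (hodge η) (app extd (fld .cbar))

/-- `b̂^{-g-1}_{g+2} = b^{-g-1}_{g+2} + (-1)^{g+1} * d C̄^{-g-1}_{n-g-1}` for `g ≤ n - 1`, and
`b̂^{-n-1}_{n+2} = b^{-n-1}_{n+2}`. -/
def bHat (η : Fin (n + 2) → ℤˣ) (g : Fin (n + 1)) : LForm n r :=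
  fld (.b g) + (-1 : ℂ) ^ ((g : ℕ) + 1) • app (hodge η) (app extd (CbarF 1 g))

/-- First ladder: `c, A, b̂^{-1}_2, …, b̂^{-n-1}_{n+2}` (indexed by the form degree). -/
def phi1 (η : Fin (n + 2) → ℤˣ) : ℕ → LForm n r
  | 0 => fld .c
  | 1 => fld .A
  | p + 2 => if h : p < n + 1 then bHat η ⟨p, h⟩ else 0

/-- Second ladder: `B^n_0, …, B^0_n, γ̂, τ` (indexed by the form degree). -/
def phi2 (η : Fin (n + 2) → ℤˣ) (p : ℕ) : LForm n r :=
  if p ≤ n then fld (.B ⟨n - p, by omega⟩)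
  else if p = n + 1 then gammaHat η
  else if p = n + 2 then fld .tau
  else 0

/-- Density of the truncated action. -/
def sigmaHat (G : GaugeAlgebra r N) (η : Fin (n + 2) → ℤˣ) : Alg n r :=
  (∑ p ∈ Finset.range (n + 2), Tr G (phi1 η p) (app extd (phi2 η (n + 1 - p)))) +
  (1 / 2 : ℂ) • ∑ p ∈ Finset.range (n + 3), ∑ q ∈ Finset.range (n + 3 - p),
    Tr G (bracket G (phi1 η p) (phi1 η q)) (phi2 η (n + 2 - p - q))

/-- Density of the gauge fixing part with gauge parameters `x_{k,g,n}`. Note that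
`Π^g_{n-g-k}` is at the position `(k + 1, g - 1)` for `k` odd and `g ≥ 1`. -/
def sigmaPi (G : GaugeAlgebra r N) (η : Fin (n + 2) → ℤˣ) (x : ℕ → ℕ → ℂ) : Alg n r :=
  - Tr G (app extd (fld .pi)) (app (hodge η) (fld .A))
  - (∑ g : Fin n, Tr G (app extd (PiF 1 g)) (app (hodge η) (fld (.B g.castSucc))))
  + (∑ k ∈ Finset.Icc 2 n, ∑ g ∈ Finset.range (n - k + 1),
      (- Tr G (app extd (PiF k g)) (app (hodge η) (CbarF (k - 1) g))
       + (-1 : ℂ) ^ (n + 1) • Tr G (app extd (CbarF k g)) (app (hodge η) (PiF (k - 1) g))))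
  + ∑ k ∈ (Finset.Icc 1 n).filter Odd, ∑ g ∈ Finset.Icc 1 (n - k),
      x k g • Tr G (PiF k g) (app (hodge η) (PiF (k + 1) (g - 1)))

/-- Density of the total classical action. -/
def sigma (G : GaugeAlgebra r N) (η : Fin (n + 2) → ℤˣ) (x : ℕ → ℕ → ℂ) : Alg n r :=
  sigmaHat G η + sigmaPi G η x

/-- The gauge parameters `x_{k,g,n} = (-1)^{n+g+(k+1)/2}` (`k` odd). -/
def xSusy (n : ℕ) (k g : ℕ) : ℂ := (-1) ^ (n + g + (k + 1) / 2)

/-! ## Functional operators -/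

/-- The linearized Slavnov operator of `Σ = ∫ L`. -/
def slavnov (L : Alg n r) : Module.End ℂ (Alg n r) :=
  ward fun F => match F with
    | .A => fder L .gamma
    | .gamma => fder L .A
    | .c => fder L .tau
    | .tau => fder L .c
    | .B g => fder L (.b g)
    | .b g => fder L (.B g)
    | .cbar => fld .pi
    | .pi => 0
    | .Cbar s => fld (.Pi s)
    | .Pi _ => 0

/-- Supersymmetry transformation of `C̄^{γ(k)}_{n-g-k}`. For `k` even the transforms stay within
the line `k` of the pyramid, so that the one of its first member, `g = 0`, is zero. -/
def susyCbar (η : Fin (n + 2) → ℤˣ) (ξ : Fin (n + 2) → ℂ) (k g : ℕ) : LForm n r :=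
  if Odd k then (-1 : ℂ) ^ (n + (k + 1) / 2) • app (gMul η ξ) (CbarF k (g + 1))
  else if g = 0 then 0
  else (-1 : ℂ) ^ (k / 2 + 1) • app (inner ξ) (CbarF k (g - 1))

/-- Supersymmetry transformation of `Π^{γ(k)+1}_{n-g-k}`. -/
def susyPi (η : Fin (n + 2) → ℤˣ) (ξ : Fin (n + 2) → ℂ) (k g : ℕ) : LForm n r :=
  (if Odd k then (-1 : ℂ) ^ (n + (k + 1) / 2) • app (gMul η ξ) (PiF k (g + 1))
   else if g = 0 then 0
   else (-1 : ℂ) ^ (k / 2 + 1) • app (inner ξ) (PiF k (g - 1)))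
  + app (lie ξ) (CbarF k g)

/-- The Ward operator of supersymmetry, on the original variables: the transformations of `γ` and
of `b^{-g-1}_{g+2}` are those for which the ladders transform as `δ φ_p = - i_ξ φ_{p+1}`. -/
def wardS (η : Fin (n + 2) → ℤˣ) (ξ : Fin (n + 2) → ℂ) : Module.End ℂ (Alg n r) :=
  ward fun F => match F with
    | .c => - app (inner ξ) (phi1 η 1)
    | .A => - app (inner ξ) (phi1 η 2)
    | .B g => - app (inner ξ) (phi2 η (n - (g : ℕ) + 1))
    | .gamma => - app (inner ξ) (phi2 η (n + 2))
    | .tau => 0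
    | .b g => - app (inner ξ) (phi1 η ((g : ℕ) + 3))
        + (-1 : ℂ) ^ ((g : ℕ) + 1) • app (hodge η) (app extd (susyCbar η ξ 1 g))
    | .cbar => 0
    | .pi => app (lie ξ) (fld .cbar)
    | .Cbar s => susyCbar η ξ s.1.1 s.1.2
    | .Pi s => susyPi η ξ s.1.1 s.1.2

/-- The Ward operator of translations. -/
def wardT (ξ : Fin (n + 2) → ℂ) : Module.End ℂ (Alg n r) := ward fun F => app (lie ξ) (fld F)

/-- Density of the classical breaking of supersymmetry. -/
def breaking (G : GaugeAlgebra r N) (η : Fin (n + 2) → ℤˣ) (ξ : Fin (n + 2) → ℂ) : Alg n r :=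
  - (∑ g : Fin (n + 1), Tr G (fld (.b g)) (app (lie ξ) (fld (.B g))))
  + (-1 : ℂ) ^ n • Tr G (fld .gamma) (app (lie ξ) (fld .A))
  + (-1 : ℂ) ^ n • Tr G (fld .tau) (app (lie ξ) (fld .c))
  + Tr G (app extd (app (hodge η) (app (inner ξ) (fld (.b 0))))) (fld .pi)
  + Tr G (app extd (app (hodge η) (app (inner ξ) (fld .gamma)))) (PiF 1 0)

open Classical in
/-- The operator counting the quantum fields: it multiplies by `m` every monomial that contains
exactly `m` quantum fields, differentiated or not. -/
def quantumCount : Module.End ℂ (Alg n r) :=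
  vf fun x => match x with
    | .jet F I a α => if F.IsSource then 0 else gen (.jet F I a α)
    | .dx _ => 0

end BF

end

noncomputable section

namespace BF

variable {n r N : ℕ}

/-! ## Generators, parity and graded commutativity -/

/-! Add up each ladder to one inhomogeneous form, `Phi1` of odd parity and `Phi2` of parity n. The
truncated action is the top component of Tr(Φ₁ dΦ₂ + ½[Φ₁,Φ₁]Φ₂) (`sigmaHat_eq`), that is, a BF
action whose connection is Φ₁. Its functional derivatives are the components of the curvature F₁ =
dΦ₁ + ½[Φ₁,Φ₁] and of the covariant derivative F₂ = dΦ₂ + [Φ₁,Φ₂]. The gauge-fixing terms add only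
*dπ and *dΠ, and the shifts by *dc̄ and *dC̄ that define the hatted sources absorb exactly these.
Hence SΦ₁ = F₁ and SΦ₂ = F₂ whatever the gauge parameters are (`slavnov_Phi1`, `slavnov_Phi2`),
while WΦ = -i_ξ Φ on both ladders (`wardS_Phi1`, `wardS_Phi2`).

All operators of part (1) are graded derivations that annihilate the dx^μ and commute with ∂_μ. Such
a derivation is determined by its values on Φ₁, Φ₂, the antighosts and the multipliers
(`IsEvol.ext_ladders`), so the algebra is checked there. On the ladders S² = 0 is the Bianchi
identity. In [S, W] the brackets cancel because i_ξ is an antiderivation, leaving i_ξ d + d i_ξ. On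
the pyramids (C̄, Π) is a trivial doublet, and W² = 0 since the i_ξ anticommute with each other, as
do the g(ξ).

For the Ward identity, W acts on the inhomogeneous density as -i_ξ does, except on the explicit d,
where L_ξ appears (`wardS_polyAction`). The i_ξ-exact part has no top component, so only -Tr Φ₁ L_ξ
Φ₂ survives. Undoing the hats gives the source terms of the breaking and two remainders containing
c̄ and C̄, which the gauge-fixing terms of π and of the first line cancel (`integral_wardS_pi`,
`integral_wardS_B`).

The remaining gauge-fixing terms rest on g(ξ)* = (-1)^{n+1} * i_ξ (`gMul_hodge`), which makes g(ξ)
and i_ξ adjoint up to sign under ∫ Tr X * Y. Terms that join neighbouring lines then telescope when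
the upper index k is odd. When k is even they combine to L_ξ terms, which the ΠΠ terms with the
prescribed gauge parameters cancel (`integral_wardS_gaugeParameters`). -/

theorem alg_neg_smul (c : ℂ) (u : Alg n r) : (-c) • u = -(c • u) := neg_smul c u

theorem alg_sub_smul (c c' : ℂ) (u : Alg n r) : (c - c') • u = c • u - c' • u := sub_smul c c' u

theorem alg_mul_neg (u v : Alg n r) : u * -v = -(u * v) := mul_neg u v

theorem alg_neg_mul (u v : Alg n r) : -u * v = -(u * v) := neg_mul u v

theorem alg_mul_sub (u v w : Alg n r) : u * (v - w) = u * v - u * w := mul_sub u v w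

theorem alg_sub_mul (u v w : Alg n r) : (u - v) * w = u * w - v * w := sub_mul u v w

open Classical in
/-- The degree modulo two of a generator. -/
def gpar (x : Gen n r) : ℕ := if x.IsOdd then 1 else 0

theorem gen_of_odd {x : Gen n r} (h : x.IsOdd) :
    gen x = 1 ⊗ₜ[ℂ] ExteriorAlgebra.ι ℂ (Finsupp.single ⟨x, h⟩ 1) := by
  simp [gen, h]

theorem gen_of_not_odd {x : Gen n r} (h : ¬ x.IsOdd) :
    gen x = MvPolynomial.X ⟨x, h⟩ ⊗ₜ[ℂ] 1 := by
  simp [gen, h]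

/-- Left multiplications by generators reach the whole algebra from 1: polynomial variables are
peeled off first, then exterior generators. Identities between operators that obey a Leibniz rule
thereby reduce to generators. -/
theorem gen_induction {C : Alg n r → Prop} (one : C 1) (add : ∀ u v, C u → C v → C (u + v))
    (smul : ∀ (c : ℂ) u, C u → C (c • u)) (gen_mul : ∀ x u, C u → C (gen x * u)) (u : Alg n r) :
    C u := by
  induction u using TensorProduct.induction_on with
  | zero => simpa using smul 0 1 one
  | add u v hu hv => exact add u v hu hv
  | tmul p e =>
    induction p using MvPolynomial.induction_on with
    | add p q hp hq => rw [TensorProduct.add_tmul]; exact add _ _ hp hq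
    | mul_X p y ih =>
      have : (p * MvPolynomial.X y) ⊗ₜ[ℂ] e = gen y.1 * (p ⊗ₜ[ℂ] e) := by
        rw [gen_of_not_odd y.2, Algebra.TensorProduct.tmul_mul_tmul, one_mul, mul_comm]
      rw [this]
      exact gen_mul _ _ ih
    | C c =>
      have : (MvPolynomial.C c : MvPolynomial (EvenGen n r) ℂ) ⊗ₜ[ℂ] e
          = c • ((1 : MvPolynomial (EvenGen n r) ℂ) ⊗ₜ[ℂ] e) := by
        rw [← MvPolynomial.algebraMap_eq, Algebra.algebraMap_eq_smul_one, TensorProduct.smul_tmul']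
      rw [this]
      refine smul _ _ ?_
      induction e using CliffordAlgebra.left_induction with
      | algebraMap c =>
        rw [Algebra.algebraMap_eq_smul_one, TensorProduct.tmul_smul]
        exact smul c _ one
      | add x y hx hy =>
        rw [TensorProduct.tmul_add]
        -- The equation `this` depends on `e`, so it becomes a premise of the induction hypotheses
        -- and has to be proved anew for each of them.
        exact add _ _ (hx (by rw [← MvPolynomial.algebraMap_eq, Algebra.algebraMap_eq_smul_one,
          TensorProduct.smul_tmul'])) (hy (by rw [← MvPolynomial.algebraMap_eq,
          Algebra.algebraMap_eq_smul_one, TensorProduct.smul_tmul']))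
      | ι_mul x m hx =>
        have hx := hx (by rw [← MvPolynomial.algebraMap_eq,
          Algebra.algebraMap_eq_smul_one, TensorProduct.smul_tmul'])
        clear this
        induction m using Finsupp.induction_linear with
        | zero => simpa using smul 0 1 one
        | add f g hf hg =>
          rw [map_add, add_mul, TensorProduct.tmul_add]; exact add _ _ hf hg
        | single y c =>
          have : (1 : MvPolynomial (EvenGen n r) ℂ) ⊗ₜ[ℂ]
              (CliffordAlgebra.ι (0 : QuadraticForm ℂ (OddGen n r →₀ ℂ))
                (Finsupp.single y c) * x) = c • (gen y.1 * (1 ⊗ₜ[ℂ] x)) := by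
            rw [gen_of_odd y.2, Algebra.TensorProduct.tmul_mul_tmul, one_mul,
              ← TensorProduct.tmul_smul, ← smul_mul_assoc, ← map_smul, Finsupp.smul_single,
              smul_eq_mul, mul_one]
          rw [this]
          exact smul _ _ (gen_mul _ _ hx)

theorem parity_gen (x : Gen n r) : parity (gen x) = (-1 : ℂ) ^ gpar x • gen x := by
  by_cases h : x.IsOdd
  · simp [gen_of_odd h, gpar, h, parity, ExteriorAlgebra.ι, TensorProduct.tmul_neg, alg_neg_smul]
  · simp [gen_of_not_odd h, gpar, h, parity]

theorem ι_mul_ι_comm (a b : OddGen n r →₀ ℂ) :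
    ExteriorAlgebra.ι ℂ a * ExteriorAlgebra.ι ℂ b =
      - (ExteriorAlgebra.ι ℂ b * ExteriorAlgebra.ι ℂ a) :=
  eq_neg_of_add_eq_zero_left (ExteriorAlgebra.ι_add_mul_swap a b)

theorem gen_mul_gen_comm (x y : Gen n r) :
    gen x * gen y = (-1 : ℂ) ^ (gpar x * gpar y) • (gen y * gen x) := by
  by_cases hx : x.IsOdd <;> by_cases hy : y.IsOdd
  · rw [gen_of_odd hx, gen_of_odd hy]
    simp only [Algebra.TensorProduct.tmul_mul_tmul, gpar, hx, hy, if_true, mul_one, pow_one,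
      alg_neg_smul, one_smul]
    rw [ι_mul_ι_comm, TensorProduct.tmul_neg]
  · rw [gen_of_odd hx, gen_of_not_odd hy]
    simp [gpar, hx, hy]
  · rw [gen_of_not_odd hx, gen_of_odd hy]
    simp [gpar, hx, hy]
  · rw [gen_of_not_odd hx, gen_of_not_odd hy]
    simp [gpar, hx, hy, mul_comm]

theorem gen_mul_self {x : Gen n r} (h : x.IsOdd) : gen x * gen x = 0 := by
  rw [gen_of_odd h, Algebra.TensorProduct.tmul_mul_tmul, ExteriorAlgebra.ι_sq_zero,
    TensorProduct.tmul_zero]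

theorem parity_parity (u : Alg n r) : parity (parity u) = u := by
  have : (parity : Alg n r →ₐ[ℂ] Alg n r).comp parity = AlgHom.id ℂ _ := by
    rw [parity, ← Algebra.TensorProduct.map_comp, CliffordAlgebra.involute_comp_involute]
    simp
  exact DFunLike.congr_fun this u

theorem pd_of_odd {x : Gen n r} (h : x.IsOdd) : pd x =
    LinearMap.lTensor _ (CliffordAlgebra.contractLeft (Q := 0) (Finsupp.lapply ⟨x, h⟩)) := by
  simp [pd, h]

theorem pd_of_not_odd {x : Gen n r} (h : ¬ x.IsOdd) : pd x =
    LinearMap.rTensor _ (MvPolynomial.pderiv (R := ℂ) (⟨x, h⟩ : EvenGen n r)).toLinearMap := by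
  simp [pd, h]

theorem pd_one (x : Gen n r) : pd x (1 : Alg n r) = 0 := by
  by_cases hx : x.IsOdd
  · rw [pd_of_odd hx, Algebra.TensorProduct.one_def, LinearMap.lTensor_tmul]
    simp
  · rw [pd_of_not_odd hx, Algebra.TensorProduct.one_def, LinearMap.rTensor_tmul]
    simp

open Classical in
theorem pd_gen_mul (x y : Gen n r) (u : Alg n r) :
    pd x (gen y * u) =
      (if x = y then u else 0) + (-1 : ℂ) ^ (gpar x * gpar y) • (gen y * pd x u) := by
  induction u using TensorProduct.induction_on with
  | zero => simp
  | add u v hu hv =>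
    rw [mul_add, map_add, hu, hv, map_add, mul_add, smul_add]
    split_ifs <;> abel
  | tmul p e =>
    by_cases hx : x.IsOdd <;> by_cases hy : y.IsOdd
    · rw [gen_of_odd hy, pd_of_odd hx]
      simp only [Algebra.TensorProduct.tmul_mul_tmul, LinearMap.lTensor_tmul, one_mul, gpar, hx, hy,
        if_true, mul_one, pow_one, alg_neg_smul, one_smul]
      have := CliffordAlgebra.contractLeft_ι_mul (Q := (0 : QuadraticForm ℂ (OddGen n r →₀ ℂ)))
        (d := Finsupp.lapply ⟨x, hx⟩) (Finsupp.single ⟨y, hy⟩ 1) e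
      rw [ExteriorAlgebra.ι, this, TensorProduct.tmul_sub, sub_eq_add_neg]
      congr 1
      by_cases hxy : x = y
      · subst hxy
        simp
      · rw [if_neg hxy, Finsupp.lapply_apply, Finsupp.single_apply, if_neg (by
          intro h; exact hxy (congrArg Subtype.val h).symm), zero_smul, TensorProduct.tmul_zero]
    · have hxy : x ≠ y := fun h => hy (h ▸ hx)
      rw [gen_of_not_odd hy, pd_of_odd hx, if_neg hxy]
      simp [gpar, hx, hy]
    · have hxy : x ≠ y := fun h => hx (h ▸ hy)
      rw [gen_of_odd hy, pd_of_not_odd hx, if_neg hxy]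
      simp [gpar, hx, hy]
    · rw [gen_of_not_odd hy, pd_of_not_odd hx]
      simp only [Algebra.TensorProduct.tmul_mul_tmul, LinearMap.rTensor_tmul, one_mul, gpar, hx, hy,
        if_false, mul_zero, pow_zero, one_smul, Derivation.coeFn_coe, Derivation.leibniz,
        smul_eq_mul, TensorProduct.add_tmul, MvPolynomial.pderiv_X]
      rw [add_comm]
      congr 1
      by_cases hxy : x = y
      · subst hxy
        simp
      · rw [if_neg hxy, Pi.single_apply, if_neg (by
          intro h; exact hxy (congrArg Subtype.val h).symm)]
        simp

theorem dxZero_dx (μ : Fin (n + 2)) : dxZero (gen (.dx μ) : Alg n r) = 0 := by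
  have h : (Gen.dx μ : Gen n r).IsOdd := trivial
  rw [gen_of_odd h]
  simp [dxZero, ExteriorAlgebra.map_apply_ι]

theorem dxZero_jet (F : Field n) (I) (a : Fin r) (α) :
    dxZero (gen (.jet F I a α)) = gen (.jet F I a α) := by
  by_cases h : (Gen.jet F I a α).IsOdd
  · rw [gen_of_odd h]
    simp [dxZero, ExteriorAlgebra.map_apply_ι]
  · rw [gen_of_not_odd h]
    simp [dxZero]

/-- Two algebra homomorphisms out of the algebra of local forms agree if they agree on the
generators. -/
theorem algHom_ext {f g : Alg n r →ₐ[ℂ] Alg n r} (h : ∀ x, f (gen x) = g (gen x)) : f = g := by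
  refine AlgHom.ext fun u => ?_
  induction u using gen_induction with
  | one => simp
  | add u v hu hv => simp [hu, hv]
  | smul c u hu => simp [hu]
  | gen_mul x u hu => simp [hu, h]

theorem dxZero_dxZero (u : Alg n r) : dxZero (dxZero u) = dxZero u := by
  have : (dxZero : Alg n r →ₐ[ℂ] Alg n r).comp dxZero = dxZero := by
    refine algHom_ext fun x => ?_
    cases x with
    | jet => simp [dxZero_jet]
    | dx => simp [dxZero_dx]
  exact DFunLike.congr_fun this u

theorem parity_dxZero (u : Alg n r) : parity (dxZero u) = dxZero (parity u) := by
  have : (parity : Alg n r →ₐ[ℂ] Alg n r).comp dxZero = dxZero.comp parity := by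
    refine algHom_ext fun x => ?_
    cases x with
    | jet => simp [dxZero_jet, parity_gen]
    | dx => simp [dxZero_dx, parity_gen]
  exact DFunLike.congr_fun this u

/-- Homogeneity of parity `k` modulo two. -/
def HasPar (k : ℕ) (u : Alg n r) : Prop := parity u = (-1 : ℂ) ^ k • u

theorem neg_one_pow_congr {k l : ℕ} (h : k % 2 = l % 2) : (-1 : ℂ) ^ k = (-1) ^ l := by
  rw [neg_one_pow_eq_pow_mod_two, h, ← neg_one_pow_eq_pow_mod_two]

theorem neg_one_pow_add_self (k : ℕ) : (-1 : ℂ) ^ k * (-1) ^ k = 1 := by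
  rw [← pow_add, ← two_mul]; simp

theorem HasPar.congr {k l : ℕ} {u : Alg n r} (hu : HasPar k u) (h : k % 2 = l % 2) :
    HasPar l u := by
  rw [HasPar, ← neg_one_pow_congr h]; exact hu

theorem HasPar.zero (k : ℕ) : HasPar k (0 : Alg n r) := by simp [HasPar]

theorem HasPar.one : HasPar 0 (1 : Alg n r) := by simp [HasPar]

theorem HasPar.add {k : ℕ} {u v : Alg n r} (hu : HasPar k u) (hv : HasPar k v) :
    HasPar k (u + v) := by
  rw [HasPar, map_add, hu, hv, smul_add]

theorem HasPar.smul {k : ℕ} {u : Alg n r} (c : ℂ) (hu : HasPar k u) : HasPar k (c • u) := by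
  rw [HasPar, map_smul, hu, smul_comm]

theorem HasPar.neg {k : ℕ} {u : Alg n r} (hu : HasPar k u) : HasPar k (-u) := by
  rw [HasPar, map_neg, hu, smul_neg]

theorem HasPar.sub {k : ℕ} {u v : Alg n r} (hu : HasPar k u) (hv : HasPar k v) :
    HasPar k (u - v) := by
  rw [sub_eq_add_neg]; exact hu.add hv.neg

theorem HasPar.sum {ι : Type*} {s : Finset ι} {k : ℕ} {u : ι → Alg n r}
    (h : ∀ i ∈ s, HasPar k (u i)) : HasPar k (∑ i ∈ s, u i) := by
  rw [HasPar, map_sum, Finset.smul_sum]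
  exact Finset.sum_congr rfl h

theorem HasPar.mul {k l : ℕ} {u v : Alg n r} (hu : HasPar k u) (hv : HasPar l v) :
    HasPar (k + l) (u * v) := by
  rw [HasPar, map_mul, hu, hv, smul_mul_smul_comm, pow_add]

theorem HasPar.dxZero {k : ℕ} {u : Alg n r} (hu : HasPar k u) : HasPar k (dxZero u) := by
  rw [HasPar, parity_dxZero, hu, map_smul]

theorem hasPar_gen (x : Gen n r) : HasPar (gpar x) (gen x) := parity_gen x

theorem hasPar_dx (μ : Fin (n + 2)) : HasPar 1 (gen (.dx μ) : Alg n r) :=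
  (hasPar_gen _).congr (by simp [gpar, Gen.IsOdd])

/-- The `k`-th power of the parity automorphism. -/
def sg (k : ℕ) : Alg n r →ₐ[ℂ] Alg n r := parity ^ k

theorem sg_zero (u : Alg n r) : sg 0 u = u := rfl

theorem sg_succ (k : ℕ) (u : Alg n r) : sg (k + 1) u = parity (sg k u) := by
  simp [sg, pow_succ', AlgHom.mul_apply]

theorem sg_add (k l : ℕ) (u : Alg n r) : sg (k + l) u = sg k (sg l u) := by
  simp [sg, pow_add, AlgHom.mul_apply]

theorem sg_two_mul (k : ℕ) (u : Alg n r) : sg (2 * k) u = u := by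
  induction k with
  | zero => rfl
  | succ k ih => rw [mul_add, mul_one, sg_succ, sg_succ, ih, parity_parity]

theorem sg_congr {k l : ℕ} (h : k % 2 = l % 2) (u : Alg n r) : sg k u = sg l u := by
  rw [← Nat.mod_add_div k 2, ← Nat.mod_add_div l 2, sg_add, sg_add, h, sg_two_mul, sg_two_mul]

theorem HasPar.sg_eq {k : ℕ} {u : Alg n r} (hu : HasPar k u) (l : ℕ) :
    sg l u = (-1 : ℂ) ^ (l * k) • u := by
  induction l with
  | zero => simp [sg_zero]
  | succ l ih => rw [sg_succ, ih, map_smul, hu, smul_smul, ← pow_add, add_mul, one_mul]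

/-- The automorphism `sg` carries the sign (-1)^{|x||u|}, so that u need not be homogeneous. -/
theorem gen_mul_comm (x : Gen n r) (u : Alg n r) : gen x * u = sg (gpar x) u * gen x := by
  induction u using gen_induction with
  | one => simp
  | add u v hu hv => rw [mul_add, hu, hv, map_add, add_mul]
  | smul c u hu => rw [mul_smul_comm, hu, map_smul, smul_mul_assoc]
  | gen_mul y u hu =>
    rw [← mul_assoc, gen_mul_gen_comm, smul_mul_assoc, mul_assoc, hu, map_mul,
      (hasPar_gen y).sg_eq, smul_mul_assoc, smul_mul_assoc, mul_assoc]

/-- Graded commutativity. -/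
theorem HasPar.mul_comm_sg {k : ℕ} {a : Alg n r} (ha : HasPar k a) (u : Alg n r) :
    a * u = sg k u * a := by
  induction u using gen_induction with
  | one => simp
  | add u v hu hv => rw [mul_add, hu, hv, map_add, add_mul]
  | smul c u hu => rw [mul_smul_comm, hu, map_smul, smul_mul_assoc]
  | gen_mul y u hu =>
    have h : a * gen y = (-1 : ℂ) ^ (k * gpar y) • (gen y * a) := by
      rw [gen_mul_comm, ha.sg_eq, smul_mul_assoc, smul_smul, mul_comm k, neg_one_pow_add_self,
        one_smul]
    rw [← mul_assoc, h, smul_mul_assoc, mul_assoc, hu, map_mul, (hasPar_gen y).sg_eq,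
      smul_mul_assoc, smul_mul_assoc, mul_assoc]

theorem HasPar.mul_comm {k l : ℕ} {u v : Alg n r} (hu : HasPar k u) (hv : HasPar l v) :
    u * v = (-1 : ℂ) ^ (k * l) • (v * u) := by
  rw [hu.mul_comm_sg, hv.sg_eq, smul_mul_assoc]

/-! ## Graded derivations -/

/-- Graded derivations of parity `e`. -/
structure IsGDer (e : ℕ) (D : Module.End ℂ (Alg n r)) : Prop where
  leib : ∀ u v, D (u * v) = D u * v + sg e u * D v
  par : ∀ u, parity (D u) = (-1 : ℂ) ^ e • D (parity u)

namespace IsGDer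

variable {e e' : ℕ} {D D' : Module.End ℂ (Alg n r)}

theorem map_one (h : IsGDer e D) : D 1 = 0 := by
  have := h.leib 1 1
  simpa using this

theorem congr (h : IsGDer e D) (he : e % 2 = e' % 2) : IsGDer e' D where
  leib u v := by rw [h.leib, sg_congr he]
  par u := by rw [h.par, neg_one_pow_congr he]

theorem hasPar (h : IsGDer e D) {k : ℕ} {u : Alg n r} (hu : HasPar k u) : HasPar (k + e) (D u) := by
  rw [HasPar, h.par, hu, map_smul, smul_smul, pow_add, mul_comm]

theorem sg_apply (h : IsGDer e D) (k : ℕ) (u : Alg n r) :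
    sg k (D u) = (-1 : ℂ) ^ (k * e) • D (sg k u) := by
  induction k with
  | zero => simp [sg_zero]
  | succ k ih =>
    rw [sg_succ, ih, map_smul, h.par, sg_succ, smul_smul, add_mul, one_mul, pow_add]

theorem leib_of_hasPar (h : IsGDer e D) {k : ℕ} {u : Alg n r} (hu : HasPar k u) (v : Alg n r) :
    D (u * v) = D u * v + (-1 : ℂ) ^ (e * k) • (u * D v) := by
  rw [h.leib, hu.sg_eq, smul_mul_assoc]

theorem ext (h : IsGDer e D) (h' : IsGDer e D') (H : ∀ x, D (gen x) = D' (gen x)) : D = D' := by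
  refine LinearMap.ext fun u => ?_
  induction u using gen_induction with
  | one => rw [h.map_one, h'.map_one]
  | add u v hu hv => rw [map_add, hu, hv, map_add]
  | smul c u hu => rw [map_smul, hu, map_smul]
  | gen_mul x u hu => rw [h.leib, h'.leib, H, hu]

theorem zero : IsGDer e (0 : Module.End ℂ (Alg n r)) where
  leib u v := by simp
  par u := by simp

theorem add (h : IsGDer e D) (h' : IsGDer e D') : IsGDer e (D + D') where
  leib u v := by
    simp only [LinearMap.add_apply, h.leib, h'.leib, add_mul, mul_add]; abel
  par u := by simp only [LinearMap.add_apply, map_add, h.par, h'.par, smul_add]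

theorem smul (c : ℂ) (h : IsGDer e D) : IsGDer e (c • D) where
  leib u v := by simp only [LinearMap.smul_apply, h.leib, smul_add, smul_mul_assoc, mul_smul_comm]
  par u := by simp only [LinearMap.smul_apply, map_smul, h.par, smul_comm c]

theorem sum {ι : Type*} {s : Finset ι} {D : ι → Module.End ℂ (Alg n r)}
    (h : ∀ i ∈ s, IsGDer e (D i)) : IsGDer e (∑ i ∈ s, D i) := by
  classical
  induction s using Finset.induction_on with
  | empty => exact zero
  | insert a s ha ih =>
    rw [Finset.sum_insert ha]
    exact (h a (by simp)).add (ih fun i hi => h i (by simp [hi]))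

/-- The graded commutator of two graded derivations. -/
theorem comm (h : IsGDer e D) (h' : IsGDer e' D') :
    IsGDer (e + e') (D * D' - (-1 : ℂ) ^ (e * e') • (D' * D)) where
  leib u v := by
    simp only [LinearMap.sub_apply, LinearMap.smul_apply, Module.End.mul_apply, h.leib, h'.leib,
      map_add, h.sg_apply, h'.sg_apply, smul_add, smul_mul_assoc, alg_sub_mul, alg_mul_sub, smul_smul, mul_smul_comm, ← sg_add, mul_comm e' e, neg_one_pow_add_self, one_smul,
      add_comm e' e]
    abel
  par u := by
    simp only [LinearMap.sub_apply, LinearMap.smul_apply, Module.End.mul_apply, map_sub, map_smul,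
      h.par, h'.par, smul_sub, smul_smul, pow_add]
    congr 2; ring

theorem comm_odd (h : IsGDer 1 D) (h' : IsGDer 1 D') : IsGDer 0 (D * D' + D' * D) := by
  have := (h.comm h').congr (e' := 0) rfl
  have h2 : D * D' - (-1 : ℂ) ^ (1 * 1) • (D' * D) = D * D' + D' * D := by module
  rwa [h2] at this

theorem comm_even (h : IsGDer 0 D) (h' : IsGDer e D') : IsGDer e (D * D' - D' * D) := by
  have := h.comm h'
  simpa using this

/-- Left multiples by homogeneous elements. -/
theorem mulLeft (h : IsGDer e D) {k : ℕ} {a : Alg n r} (ha : HasPar k a) :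
    IsGDer (k + e) (LinearMap.mulLeft ℂ a * D) where
  leib u v := by
    simp only [Module.End.mul_apply, LinearMap.mulLeft_apply, h.leib, mul_add, sg_add]
    rw [← mul_assoc, ← mul_assoc, ha.mul_comm_sg (sg e u), mul_assoc (sg k _)]
  par u := by
    simp only [Module.End.mul_apply, LinearMap.mulLeft_apply, map_mul, h.par]
    rw [ha, smul_mul_smul_comm, pow_add]

end IsGDer

theorem parity_pd (x : Gen n r) (u : Alg n r) :
    parity (pd x u) = (-1 : ℂ) ^ gpar x • pd x (parity u) := by
  classical
  induction u using gen_induction with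
  | one => simp [pd_one]
  | add u v hu hv => simp only [map_add, hu, hv, smul_add]
  | smul c u hu => simp only [map_smul, hu, smul_comm c]
  | gen_mul y u hu =>
    simp only [pd_gen_mul, map_add, map_mul, map_smul, parity_gen, hu, smul_mul_assoc, smul_add]
    congr 1
    · split_ifs with h
      · rw [h, smul_smul, neg_one_pow_add_self, one_smul]
      · simp
    · rw [mul_smul_comm, smul_smul, smul_smul, smul_smul, smul_smul]
      congr 1
      ring

theorem isGDer_pd (x : Gen n r) : IsGDer (gpar x) (pd x) where
  leib u v := by
    classical
    induction u using gen_induction with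
    | one => simp [pd_one]
    | add u w hu hv => simp only [add_mul, map_add, hu, hv]; abel
    | smul c u hu => simp only [map_smul, smul_mul_assoc, hu, smul_add]
    | gen_mul y u hu =>
      rw [mul_assoc, pd_gen_mul, hu, pd_gen_mul, map_mul, (hasPar_gen y).sg_eq, add_mul, mul_add,
        smul_add, smul_mul_assoc, smul_mul_assoc, ite_mul, zero_mul, add_assoc]
      simp only [mul_assoc, smul_mul_assoc]
  par := parity_pd x

open Classical in
theorem pd_gen (x y : Gen n r) : pd x (gen y) = if x = y then 1 else 0 := by
  have := pd_gen_mul x y (1 : Alg n r)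
  simpa [pd_one] using this

theorem vf_apply (v : Gen n r → Alg n r) (u : Alg n r) : vf v u = ∑ᶠ x, v x * pd x u := rfl

theorem vf_gen (v : Gen n r → Alg n r) (y : Gen n r) : vf v (gen y) = v y := by
  classical
  rw [vf_apply, finsum_eq_single _ y]
  · simp [pd_gen]
  · intro x hx
    simp [pd_gen, hx]

/-- Both v_x and ∂/∂x have to pass u; their parities |x| + e and |x| add up to e modulo two,
whatever x is. -/
theorem isGDer_vf {e : ℕ} {v : Gen n r → Alg n r} (hv : ∀ x, HasPar (gpar x + e) (v x)) :
    IsGDer e (vf v) where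
  leib u w := by
    have hu : (Function.support fun x => v x * pd x u).Finite :=
      (pd_support_finite u).subset fun x hx h => hx (by simp [h])
    have hw : (Function.support fun x => v x * pd x w).Finite :=
      (pd_support_finite w).subset fun x hx h => hx (by simp [h])
    simp only [vf_apply]
    rw [finsum_mul' _ _ hu, mul_finsum' _ _ hw, ← finsum_add_distrib]
    · refine finsum_congr fun x => ?_
      rw [(isGDer_pd x).leib, mul_add, ← mul_assoc, ← mul_assoc, (hv x).mul_comm_sg (sg _ u),
        mul_assoc (sg _ _), ← sg_add, sg_congr (k := gpar x + e + gpar x) (l := e) (by omega)]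
    · exact hu.subset fun x hx h => hx (by simp only [h, zero_mul])
    · exact hw.subset fun x hx h => hx (by simp only [h, mul_zero])
  par u := by
    simp only [vf_apply]
    rw [← AlgHom.coe_toLinearMap, map_finsum _ (f := fun x => v x * pd x u), smul_finsum]
    · refine finsum_congr fun x => ?_
      rw [AlgHom.coe_toLinearMap, map_mul, hv, parity_pd, smul_mul_smul_comm, ← pow_add]
      congr 1
      exact neg_one_pow_congr (by omega)
    · exact (pd_support_finite u).subset fun x hx h => hx (by simp [h])

/-! ## The exterior algebra of the differentials -/

theorem isGDer_pd_dx (μ : Fin (n + 2)) : IsGDer 1 (pd (.dx μ) : Module.End ℂ (Alg n r)) :=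
  (isGDer_pd _).congr (by simp [gpar, Gen.IsOdd])

/-- Forms without differentials. -/
def DxFree (u : Alg n r) : Prop := dxZero u = u

theorem dxFree_dxZero (u : Alg n r) : DxFree (dxZero u) := dxZero_dxZero u

theorem dxFree_jet (F : Field n) (I) (a : Fin r) (α) : DxFree (gen (.jet F I a α)) :=
  dxZero_jet F I a α

theorem DxFree.mul {u v : Alg n r} (hu : DxFree u) (hv : DxFree v) : DxFree (u * v) := by
  rw [DxFree, map_mul, hu, hv]

theorem DxFree.parity {u : Alg n r} (hu : DxFree u) : DxFree (parity u) := by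
  rw [DxFree, ← parity_dxZero, hu]

theorem DxFree.sg {u : Alg n r} (hu : DxFree u) (k : ℕ) : DxFree (sg k u) := by
  induction k with
  | zero => exact hu
  | succ k ih => rw [sg_succ]; exact ih.parity

theorem pd_dx_dxZero (μ : Fin (n + 2)) (u : Alg n r) : pd (.dx μ) (dxZero u) = 0 := by
  induction u using gen_induction with
  | one => simp [pd_one]
  | add u v hu hv => rw [map_add, map_add, hu, hv, add_zero]
  | smul c u hu => rw [map_smul, map_smul, hu, smul_zero]
  | gen_mul x u hu =>
    cases x with
    | jet F I a α => rw [map_mul, dxZero_jet, (isGDer_pd _).leib, hu, pd_gen]; simp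
    | dx ν => rw [map_mul, dxZero_dx, zero_mul, map_zero]

theorem DxFree.pd_dx {u : Alg n r} (hu : DxFree u) (μ : Fin (n + 2)) : pd (.dx μ) u = 0 := by
  rw [← hu, pd_dx_dxZero]

theorem dxI_empty : (dxI ∅ : Alg n r) = 1 := by simp [dxI]

theorem contr_empty : (contr ∅ : Module.End ℂ (Alg n r)) = 1 := by simp [contr]

theorem dxI_insert {a : Fin (n + 2)} {K : Finset (Fin (n + 2))} (h : ∀ b ∈ K, a < b) :
    (dxI (insert a K) : Alg n r) = gen (.dx a) * dxI K := by
  rw [dxI, dxI, Finset.sort_insert _ (fun b hb => (h b hb).le) (fun ha => lt_irrefl _ (h a ha))]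
  simp

theorem contr_insert {a : Fin (n + 2)} {K : Finset (Fin (n + 2))} (h : ∀ b ∈ K, a < b) :
    (contr (insert a K) : Module.End ℂ (Alg n r)) = contr K * pd (.dx a) := by
  rw [contr, contr, Finset.sort_insert _ (fun b hb => (h b hb).le)
    (fun ha => lt_irrefl _ (h a ha))]
  simp

theorem dx_mul_dx (μ ν : Fin (n + 2)) :
    (gen (.dx μ) * gen (.dx ν) : Alg n r) = - (gen (.dx ν) * gen (.dx μ)) := by
  rw [(hasPar_dx μ).mul_comm (hasPar_dx ν)]
  simp [alg_neg_smul]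

theorem dx_mul_self (μ : Fin (n + 2)) : (gen (.dx μ) * gen (.dx μ) : Alg n r) = 0 :=
  gen_mul_self trivial

theorem dx_mul_dxI (μ : Fin (n + 2)) (J : Finset (Fin (n + 2))) :
    (gen (.dx μ) * dxI J : Alg n r) =
      if μ ∈ J then 0 else (-1 : ℂ) ^ (J.filter (· < μ)).card • dxI (insert μ J) := by
  induction J using Finset.induction_on_min with
  | empty => rw [dxI_insert (by simp)]; simp
  | insert a K h ih =>
    have haK : a ∉ K := fun ha => lt_irrefl _ (h a ha)
    rcases lt_trichotomy μ a with hlt | rfl | hgt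
    · have h1 : ∀ b ∈ insert a K, μ < b := by
        intro b hb
        rcases Finset.mem_insert.1 hb with rfl | hb
        · exact hlt
        · exact hlt.trans (h b hb)
      have h2 : μ ∉ insert a K := fun hm => lt_irrefl _ (h1 μ hm)
      have h3 : (insert a K).filter (· < μ) = ∅ :=
        Finset.filter_eq_empty_iff.2 fun b hb => not_lt.2 (h1 b hb).le
      rw [if_neg h2, h3, dxI_insert h1]
      simp
    · rw [dxI_insert h, ← mul_assoc, dx_mul_self]
      simp
    · rw [dxI_insert h, ← mul_assoc, dx_mul_dx, alg_neg_mul, mul_assoc, ih]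
      by_cases hK : μ ∈ K
      · simp [hK]
      · have h1 : μ ∉ insert a K := by
          simp [hK, hgt.ne']
        have h2 : ∀ b ∈ insert μ K, a < b := by
          intro b hb
          rcases Finset.mem_insert.1 hb with rfl | hb
          · exact hgt
          · exact h b hb
        rw [if_neg hK, if_neg h1, Finset.filter_insert, if_pos hgt,
          Finset.card_insert_of_notMem (by simp [haK]), Finset.insert_comm, dxI_insert h2,
          mul_smul_comm, pow_succ, mul_neg_one, alg_neg_smul]

theorem eps_insert {a : Fin (n + 2)} {K : Finset (Fin (n + 2))} (ha : a ∉ K)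
    (I : Finset (Fin (n + 2))) : eps (insert a K) I = eps K I * (-1) ^ (I.filter (· < a)).card := by
  have : ((insert a K ×ˢ I).filter fun q => q.2 < q.1) =
      ((K ×ˢ I).filter fun q => q.2 < q.1) ∪ (I.filter (· < a)).image fun i => (a, i) := by
    ext ⟨x, y⟩
    simp only [Finset.mem_filter, Finset.mem_product, Finset.mem_insert, Finset.mem_union,
      Finset.mem_image, Prod.mk.injEq]
    constructor
    · rintro ⟨⟨rfl | hx, hy⟩, hlt⟩
      · exact Or.inr ⟨y, ⟨hy, hlt⟩, rfl, rfl⟩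
      · exact Or.inl ⟨⟨hx, hy⟩, hlt⟩
    · rintro (⟨⟨hx, hy⟩, hlt⟩ | ⟨z, ⟨hz, hlt⟩, rfl, rfl⟩)
      · exact ⟨⟨Or.inr hx, hy⟩, hlt⟩
      · exact ⟨⟨Or.inl rfl, hz⟩, hlt⟩
  rw [eps, this, Finset.card_union_of_disjoint, pow_add, Finset.card_image_of_injective, eps]
  · intro i j h; simpa using h
  · rw [Finset.disjoint_left]
    rintro ⟨x, y⟩ hx hy
    simp only [Finset.mem_filter, Finset.mem_product, Finset.mem_image, Prod.mk.injEq] at hx hy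
    obtain ⟨z, _, rfl, rfl⟩ := hy
    exact ha hx.1.1

/-- Induction on the least element a of K: as a lies below the rest of K, moving it into place costs
one sign for each smaller element of I, which are the inversions that `eps` gains. -/
theorem dxI_mul_dxI (K I : Finset (Fin (n + 2))) :
    (dxI K * dxI I : Alg n r) = if Disjoint K I then eps K I • dxI (K ∪ I) else 0 := by
  induction K using Finset.induction_on_min with
  | empty => simp [dxI_empty, eps]
  | insert a K h ih =>
    have haK : a ∉ K := fun ha => lt_irrefl _ (h a ha)
    rw [dxI_insert h, mul_assoc, ih]
    by_cases hK : Disjoint K I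
    · by_cases haI : a ∈ I
      · have : ¬ Disjoint (insert a K) I := by
          rw [Finset.disjoint_insert_left]; simp [haI]
        rw [if_pos hK, if_neg this, mul_smul_comm, dx_mul_dxI, if_pos (by simp [haI]), smul_zero]
      · have : Disjoint (insert a K) I := by
          rw [Finset.disjoint_insert_left]; exact ⟨haI, hK⟩
        have h2 : (K ∪ I).filter (· < a) = I.filter (· < a) := by
          rw [Finset.filter_union, Finset.filter_eq_empty_iff.2 fun b hb => not_lt.2 (h b hb).le,
            Finset.empty_union]
        rw [if_pos hK, if_pos this, mul_smul_comm, dx_mul_dxI, if_neg (by simp [haI, haK]),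
          smul_smul, h2, eps_insert haK, Finset.insert_union]
    · have : ¬ Disjoint (insert a K) I := by
        rw [Finset.disjoint_insert_left]; exact fun h => hK h.2
      rw [if_neg hK, if_neg this, mul_zero]

theorem pd_dx_dx (μ ν : Fin (n + 2)) :
    pd (.dx μ) (gen (.dx ν) : Alg n r) = if μ = ν then 1 else 0 := by
  classical
  rw [pd_gen]
  by_cases h : μ = ν <;> simp [h]

theorem pd_dxI_of_notMem {μ : Fin (n + 2)} {J : Finset (Fin (n + 2))} (h : μ ∉ J) :
    pd (.dx μ) (dxI J : Alg n r) = 0 := by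
  induction J using Finset.induction_on_min with
  | empty => rw [dxI_empty, pd_one]
  | insert a K hK ih =>
    rw [Finset.mem_insert, not_or] at h
    rw [dxI_insert hK, (isGDer_pd_dx μ).leib, pd_dx_dx, if_neg h.1, ih h.2, zero_mul, mul_zero,
      add_zero]

theorem pd_dxI_of_mem {μ : Fin (n + 2)} {J : Finset (Fin (n + 2))} (h : μ ∈ J) :
    pd (.dx μ) (dxI J : Alg n r) = (-1 : ℂ) ^ (J.filter (· < μ)).card • dxI (J.erase μ) := by
  have h1 := dx_mul_dxI (r := r) μ (J.erase μ)
  rw [if_neg (Finset.notMem_erase _ _), Finset.insert_erase h] at h1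
  have h2 : (J.erase μ).filter (· < μ) = J.filter (· < μ) := by
    ext x
    simp only [Finset.mem_filter, Finset.mem_erase]
    exact ⟨fun hx => ⟨hx.1.2, hx.2⟩, fun hx => ⟨⟨hx.2.ne, hx.1⟩, hx.2⟩⟩
  rw [h2] at h1
  -- The formula is obtained by differentiating the reordering dx^μ dx^{J∖μ} = ± dx^J, rather than
  -- by commuting ∂/∂(dx^μ) through the product.
  have h3 := congrArg (pd (.dx μ)) h1
  rw [map_smul, (isGDer_pd_dx μ).leib, pd_dx_dx, if_pos rfl, one_mul,
    pd_dxI_of_notMem (Finset.notMem_erase _ _), mul_zero, add_zero] at h3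
  rw [h3, smul_smul, neg_one_pow_add_self, one_smul]

theorem contr_dxI_of_not_subset {K J : Finset (Fin (n + 2))} (h : ¬ K ⊆ J) :
    contr K (dxI J : Alg n r) = 0 := by
  induction K using Finset.induction_on_min generalizing J with
  | empty => simp at h
  | insert a K hK ih =>
    rw [contr_insert hK, Module.End.mul_apply]
    by_cases ha : a ∈ J
    · rw [pd_dxI_of_mem ha, map_smul, ih, smul_zero]
      intro hs
      refine h (Finset.insert_subset ha (hs.trans (Finset.erase_subset _ _)))
    · rw [pd_dxI_of_notMem ha, map_zero]

theorem exists_contr_dxI (K J : Finset (Fin (n + 2))) :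
    ∃ c : ℂ, contr K (dxI J : Alg n r) = c • dxI (J \ K) := by
  induction K using Finset.induction_on_min generalizing J with
  | empty => exact ⟨1, by simp [contr_empty]⟩
  | insert a K hK ih =>
    rw [contr_insert hK, Module.End.mul_apply]
    by_cases ha : a ∈ J
    · obtain ⟨c, hc⟩ := ih (J.erase a)
      refine ⟨(-1 : ℂ) ^ (J.filter (· < a)).card * c, ?_⟩
      rw [pd_dxI_of_mem ha, map_smul, hc, smul_smul]
      congr 2
      ext x
      simp only [Finset.mem_sdiff, Finset.mem_erase, Finset.mem_insert]
      tauto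
    · exact ⟨0, by rw [pd_dxI_of_notMem ha, map_zero, zero_smul]⟩

theorem contr_dxI_mul {I : Finset (Fin (n + 2))} {w : Alg n r}
    (hw : ∀ i ∈ I, pd (.dx i) w = 0) : contr I (dxI I * w) = w := by
  induction I using Finset.induction_on_min with
  | empty => simp [contr_empty, dxI_empty]
  | insert a K hK ih =>
    rw [contr_insert hK, Module.End.mul_apply, dxI_insert hK, mul_assoc, (isGDer_pd_dx a).leib,
      (isGDer_pd_dx a).leib (dxI K), pd_dxI_of_notMem fun ha => lt_irrefl _ (hK a ha),
      hw a (by simp), pd_dx_dx, if_pos rfl, zero_mul, mul_zero, add_zero, mul_zero, add_zero,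
      one_mul, ih fun i hi => hw i (by simp [hi])]

theorem contr_dxI_self (I : Finset (Fin (n + 2))) : contr I (dxI I : Alg n r) = 1 := by
  have := contr_dxI_mul (r := r) (I := I) (w := 1) fun i _ => pd_one _
  rwa [mul_one] at this

theorem dxZero_dxI {L : Finset (Fin (n + 2))} (hL : L ≠ ∅) : dxZero (dxI L : Alg n r) = 0 := by
  induction L using Finset.induction_on_min with
  | empty => exact absurd rfl hL
  | insert a K hK ih => rw [dxI_insert hK, map_mul, dxZero_dx, zero_mul]

theorem hasPar_dxI (J : Finset (Fin (n + 2))) : HasPar J.card (dxI J : Alg n r) := by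
  induction J using Finset.induction_on_min with
  | empty => rw [dxI_empty]; exact HasPar.one
  | insert a K hK ih =>
    rw [dxI_insert hK, Finset.card_insert_of_notMem fun ha => lt_irrefl _ (hK a ha), add_comm]
    exact (hasPar_dx a).mul ih

theorem contr_mul {u : Alg n r} (hu : DxFree u) (K : Finset (Fin (n + 2))) (v : Alg n r) :
    contr K (u * v) = sg K.card u * contr K v := by
  induction K using Finset.induction_on_min generalizing u v with
  | empty => simp [contr_empty, sg_zero]
  | insert a K hK ih =>
    rw [contr_insert hK, Module.End.mul_apply, (isGDer_pd_dx a).leib, hu.pd_dx, zero_mul,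
      zero_add, ih (hu.sg 1), Finset.card_insert_of_notMem fun ha => lt_irrefl _ (hK a ha), sg_add]
    rfl

theorem coef_apply (I : Finset (Fin (n + 2))) (u : Alg n r) :
    coef I u = dxZero (sg I.card (contr I u)) := by
  have : ∀ (k : ℕ) (v : Alg n r),
      ((parity : Alg n r →ₐ[ℂ] Alg n r).toLinearMap ^ k) v = sg k v := by
    intro k v
    induction k with
    | zero => rfl
    | succ k ih => rw [pow_succ', Module.End.mul_apply, ih, sg_succ]; rfl
  simp only [coef, Module.End.mul_apply, this]
  rfl

/-- The sign picked up by u when `contr` passes it is undone by the parity factor in `coef`. If K is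
a proper subset of J, differentials are left over and `dxZero` kills them; if K is not contained in
J, the contraction vanishes. -/
theorem coef_mul_dxI {u : Alg n r} (hu : DxFree u) (K J : Finset (Fin (n + 2))) :
    coef K (u * dxI J) = if K = J then u else 0 := by
  rw [coef_apply, contr_mul hu, map_mul, map_mul, ← sg_add, sg_congr (l := 0) (by omega), sg_zero,
    hu]
  split_ifs with h
  · subst h
    rw [contr_dxI_self, map_one, map_one, mul_one]
  · by_cases hs : K ⊆ J
    · obtain ⟨c, hc⟩ := exists_contr_dxI (r := r) K J
      rw [hc, map_smul, (hasPar_dxI _).sg_eq, map_smul, map_smul, dxZero_dxI, smul_zero, smul_zero,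
        mul_zero]
      intro h0
      exact h (hs.antisymm (Finset.sdiff_eq_empty_iff_subset.1 h0))
    · rw [contr_dxI_of_not_subset hs, map_zero, map_zero, mul_zero]

theorem dxFree_coef (I : Finset (Fin (n + 2))) (u : Alg n r) : DxFree (coef I u) := by
  rw [coef_apply]; exact dxFree_dxZero _

/-- Behind `lin_ext`: linear identities need only be tested on u dx^J. A further dx^μ is moved
through u at the cost of a parity sign. -/
theorem mem_span_dxI (ω : Alg n r) :
    ω ∈ Submodule.span ℂ {w : Alg n r | ∃ u J, DxFree u ∧ w = u * dxI J} := by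
  induction ω using gen_induction with
  | one => exact Submodule.subset_span ⟨1, ∅, map_one _, by rw [dxI_empty, mul_one]⟩
  | add u v hu hv => exact Submodule.add_mem _ hu hv
  | smul c u hu => exact Submodule.smul_mem _ _ hu
  | gen_mul x w hw =>
    induction hw using Submodule.span_induction with
    | zero => rw [mul_zero]; exact Submodule.zero_mem _
    | add u v _ _ hu hv => rw [mul_add]; exact Submodule.add_mem _ hu hv
    | smul c u _ hu => rw [mul_smul_comm]; exact Submodule.smul_mem _ _ hu
    | mem w hw =>
      obtain ⟨u, J, hu, rfl⟩ := hw
      cases x with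
      | jet F I a α =>
        exact Submodule.subset_span ⟨_, J, (dxFree_jet F I a α).mul hu, (mul_assoc _ _ _).symm⟩
      | dx μ =>
        rw [← mul_assoc, (hasPar_dx μ).mul_comm_sg, mul_assoc, dx_mul_dxI]
        split_ifs
        · rw [mul_zero]; exact Submodule.zero_mem _
        · rw [mul_smul_comm]
          exact Submodule.smul_mem _ _ (Submodule.subset_span ⟨_, _, hu.sg 1, rfl⟩)

/-- Linear maps that agree on `u dx^J` for all `u` without differentials are equal. -/
theorem lin_ext {V : Type*} [AddCommMonoid V] [Module ℂ V] {f g : Alg n r →ₗ[ℂ] V}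
    (h : ∀ u J, DxFree u → f (u * dxI J) = g (u * dxI J)) : f = g := by
  refine LinearMap.ext fun ω => ?_
  induction mem_span_dxI ω using Submodule.span_induction with
  | zero => rw [map_zero, map_zero]
  | add u v _ _ hu hv => rw [map_add, map_add, hu, hv]
  | smul c u _ hu => rw [map_smul, map_smul, hu]
  | mem w hw =>
    obtain ⟨u, J, hu, rfl⟩ := hw
    exact h u J hu

/-! ## Form degree -/

/-- The projection on forms of degree `p`. -/
def proj (p : ℕ) : Module.End ℂ (Alg n r) :=
  ∑ I : Finset (Fin (n + 2)) with I.card = p, LinearMap.mulRight ℂ (dxI I) * coef I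

theorem proj_apply (p : ℕ) (ω : Alg n r) :
    proj p ω = ∑ I : Finset (Fin (n + 2)) with I.card = p, coef I ω * dxI I := by
  simp [proj]

theorem proj_mul_dxI {u : Alg n r} (hu : DxFree u) (p : ℕ) (J : Finset (Fin (n + 2))) :
    proj p (u * dxI J) = if J.card = p then u * dxI J else 0 := by
  rw [proj_apply]
  simp only [coef_mul_dxI hu, ite_mul, zero_mul]
  rw [Finset.sum_ite_eq']
  simp

/-- The form degree operator. -/
def numOp : Module.End ℂ (Alg n r) := ∑ μ, LinearMap.mulLeft ℂ (gen (.dx μ)) * pd (.dx μ)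

theorem isGDer_numOp : IsGDer 0 (numOp : Module.End ℂ (Alg n r)) :=
  IsGDer.sum fun μ _ => ((isGDer_pd_dx μ).mulLeft (hasPar_dx μ)).congr rfl

theorem numOp_apply (u : Alg n r) : numOp u = ∑ μ, gen (.dx μ) * pd (.dx μ) u := by
  simp [numOp]

theorem DxFree.numOp {u : Alg n r} (hu : DxFree u) : numOp u = 0 := by
  simp [numOp_apply, hu.pd_dx]

theorem numOp_dx (μ : Fin (n + 2)) : numOp (gen (.dx μ) : Alg n r) = gen (.dx μ) := by
  simp [numOp_apply, pd_dx_dx]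

theorem numOp_dxI (J : Finset (Fin (n + 2))) :
    numOp (dxI J : Alg n r) = (J.card : ℂ) • dxI J := by
  induction J using Finset.induction_on_min with
  | empty => simp [dxI_empty, isGDer_numOp.map_one]
  | insert a K hK ih =>
    rw [dxI_insert hK, isGDer_numOp.leib, ih, numOp_dx, sg_zero,
      Finset.card_insert_of_notMem fun ha => lt_irrefl _ (hK a ha), mul_smul_comm]
    push_cast
    rw [add_smul, one_smul, add_comm]

theorem numOp_mul_dxI {u : Alg n r} (hu : DxFree u) (J : Finset (Fin (n + 2))) :
    numOp (u * dxI J) = (J.card : ℂ) • (u * dxI J) := by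
  rw [isGDer_numOp.leib, hu.numOp, zero_mul, zero_add, sg_zero, numOp_dxI, mul_smul_comm]

/-- Homogeneous forms of degree `p`. -/
def IsForm (p : ℕ) (u : Alg n r) : Prop := numOp u = (p : ℂ) • u

theorem numOp_proj (p : ℕ) (u : Alg n r) : numOp (proj p u) = (p : ℂ) • proj p u := by
  have : (numOp * proj p : Module.End ℂ (Alg n r)) = (p : ℂ) • proj p := by
    refine lin_ext fun u J hu => ?_
    rw [Module.End.mul_apply, LinearMap.smul_apply, proj_mul_dxI hu]
    split_ifs with h
    · rw [numOp_mul_dxI hu, h]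
    · rw [map_zero, smul_zero]
  exact LinearMap.congr_fun this u

theorem proj_numOp (p : ℕ) (u : Alg n r) : proj p (numOp u) = (p : ℂ) • proj p u := by
  have : (proj p * numOp : Module.End ℂ (Alg n r)) = (p : ℂ) • proj p := by
    refine lin_ext fun u J hu => ?_
    rw [Module.End.mul_apply, LinearMap.smul_apply, numOp_mul_dxI hu, map_smul, proj_mul_dxI hu]
    split_ifs with h
    · rw [h]
    · rw [smul_zero, smul_zero]
  exact LinearMap.congr_fun this u

theorem isForm_proj (p : ℕ) (u : Alg n r) : IsForm p (proj p u) := numOp_proj p u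

theorem card_le (J : Finset (Fin (n + 2))) : J.card ≤ n + 2 := by
  simpa using Finset.card_le_univ J

theorem sum_proj (u : Alg n r) : ∑ p ∈ Finset.range (n + 3), proj p u = u := by
  have : (∑ p ∈ Finset.range (n + 3), proj p : Module.End ℂ (Alg n r)) = LinearMap.id := by
    refine lin_ext fun u J hu => ?_
    have := card_le J
    simp only [LinearMap.sum_apply, proj_mul_dxI hu, Finset.sum_ite_eq, LinearMap.id_apply]
    rw [if_pos (by simp; omega)]
  simpa using LinearMap.congr_fun this u

/-- An eigenvalue argument: `proj q` times the degree operator is q times `proj q`, while u has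
eigenvalue p ≠ q. -/
theorem IsForm.proj_of_ne {p q : ℕ} {u : Alg n r} (hu : IsForm p u) (h : p ≠ q) :
    proj q u = 0 := by
  have h1 := proj_numOp q u
  rw [hu, map_smul, ← sub_eq_zero, ← alg_sub_smul] at h1
  have h2 : (p : ℂ) - q ≠ 0 := by
    rw [sub_ne_zero]; exact_mod_cast h
  exact (smul_eq_zero.1 h1).resolve_left h2

theorem IsForm.eq_zero {p : ℕ} {u : Alg n r} (hu : IsForm p u) (h : n + 2 < p) : u = 0 := by
  rw [← sum_proj u]
  refine Finset.sum_eq_zero fun q hq => hu.proj_of_ne ?_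
  rw [Finset.mem_range] at hq
  omega

theorem IsForm.proj_eq {p : ℕ} {u : Alg n r} (hu : IsForm p u) : proj p u = u := by
  by_cases h : n + 2 < p
  · rw [hu.eq_zero h, map_zero]
  · conv_rhs => rw [← sum_proj u]
    rw [Finset.sum_eq_single p]
    · intro q _ hq
      exact hu.proj_of_ne (Ne.symm hq)
    · intro hp
      rw [Finset.mem_range] at hp
      omega

theorem IsForm.zero (p : ℕ) : IsForm p (0 : Alg n r) := by simp [IsForm]

theorem IsForm.add {p : ℕ} {u v : Alg n r} (hu : IsForm p u) (hv : IsForm p v) :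
    IsForm p (u + v) := by
  rw [IsForm, map_add, hu, hv, smul_add]

theorem IsForm.smul {p : ℕ} {u : Alg n r} (c : ℂ) (hu : IsForm p u) : IsForm p (c • u) := by
  rw [IsForm, map_smul, hu, smul_comm]

theorem IsForm.neg {p : ℕ} {u : Alg n r} (hu : IsForm p u) : IsForm p (-u) := by
  rw [IsForm, map_neg, hu, smul_neg]

theorem IsForm.sub {p : ℕ} {u v : Alg n r} (hu : IsForm p u) (hv : IsForm p v) :
    IsForm p (u - v) := by
  rw [sub_eq_add_neg]; exact hu.add hv.neg

theorem IsForm.sum {ι : Type*} {s : Finset ι} {p : ℕ} {u : ι → Alg n r}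
    (h : ∀ i ∈ s, IsForm p (u i)) : IsForm p (∑ i ∈ s, u i) := by
  rw [IsForm, map_sum, Finset.smul_sum]
  exact Finset.sum_congr rfl h

theorem IsForm.mul {p q : ℕ} {u v : Alg n r} (hu : IsForm p u) (hv : IsForm q v) :
    IsForm (p + q) (u * v) := by
  rw [IsForm, isGDer_numOp.leib, hu, hv, sg_zero, smul_mul_assoc, mul_smul_comm, ← add_smul]
  push_cast
  rfl

theorem isForm_dx (μ : Fin (n + 2)) : IsForm 1 (gen (.dx μ) : Alg n r) := by
  rw [IsForm, numOp_dx]; simp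

theorem isForm_dxI (J : Finset (Fin (n + 2))) : IsForm J.card (dxI J : Alg n r) := numOp_dxI J

theorem DxFree.isForm {u : Alg n r} (hu : DxFree u) : IsForm 0 u := by
  rw [IsForm, hu.numOp]; simp

theorem IsForm.dxFree {u : Alg n r} (hu : IsForm 0 u) : DxFree u := by
  rw [← hu.proj_eq, proj_apply]
  have : (Finset.univ.filter fun I : Finset (Fin (n + 2)) => I.card = 0) = {∅} := by
    ext; simp
  rw [this, Finset.sum_singleton, dxI_empty, mul_one]
  exact dxFree_coef _ _

/-- Follows from [N, ∂/∂(dx^μ)] = -∂/∂(dx^μ) for the degree operator N. The truncated p - 1 is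
harmless, since the derivative of a 0-form vanishes. -/
theorem IsForm.pd_dx {p : ℕ} {u : Alg n r} (hu : IsForm p u) (μ : Fin (n + 2)) :
    IsForm (p - 1) (pd (.dx μ) u) := by
  rcases Nat.eq_zero_or_pos p with rfl | hp
  · rw [hu.dxFree.pd_dx]; exact IsForm.zero _
  · have key : (numOp * pd (.dx μ) - pd (.dx μ) * numOp : Module.End ℂ (Alg n r)) =
        (-1 : ℂ) • pd (.dx μ) := by
      refine (isGDer_numOp.comm_even (isGDer_pd_dx μ)).ext ((isGDer_pd_dx μ).smul _) fun x => ?_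
      have h1 : numOp (pd (.dx μ) (gen x) : Alg n r) = 0 := by
        classical
        rw [pd_gen]
        split_ifs <;> simp [isGDer_numOp.map_one]
      rw [LinearMap.sub_apply, Module.End.mul_apply, Module.End.mul_apply, h1,
        LinearMap.smul_apply]
      cases x with
      | jet => rw [(dxFree_jet _ _ _ _).numOp, (dxFree_jet _ _ _ _).pd_dx]; simp
      | dx ν => rw [numOp_dx, alg_neg_smul, one_smul, zero_sub]
    have h2 := LinearMap.congr_fun key u
    rw [LinearMap.sub_apply, Module.End.mul_apply, Module.End.mul_apply, hu, map_smul,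
      LinearMap.smul_apply, sub_eq_iff_eq_add, ← add_smul] at h2
    rw [IsForm, h2]
    congr 1
    push_cast [Nat.cast_sub hp]
    ring

theorem IsForm.coef_of_ne {p : ℕ} {u : Alg n r} (hu : IsForm p u) {I : Finset (Fin (n + 2))}
    (h : I.card ≠ p) : coef I u = 0 := by
  have : (coef I * proj p : Module.End ℂ (Alg n r)) = 0 := by
    refine lin_ext fun v J hv => ?_
    rw [Module.End.mul_apply, proj_mul_dxI hv, LinearMap.zero_apply]
    split_ifs with h1
    · rw [coef_mul_dxI hv, if_neg]
      rintro rfl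
      exact h h1
    · rw [map_zero]
  rw [← hu.proj_eq]
  exact LinearMap.congr_fun this u

theorem IsForm.sum_coef {p : ℕ} {u : Alg n r} (hu : IsForm p u) :
    ∑ I : {I : Finset (Fin (n + 2)) // I.card = p}, coef I.1 u * dxI I.1 = u := by
  conv_rhs => rw [← hu.proj_eq, proj_apply]
  exact (Finset.sum_subtype _ (by simp) fun I => coef I u * dxI I).symm

/-- Removing `dx^I` from the top component of `dx^I ω` and summing over all `I` of cardinality `m`
recovers the component of degree `n + 2 - m`. -/
theorem sum_contr_dxI_mul {m : ℕ} (hm : m ≤ n + 2) (Y : Alg n r) :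
    ∑ I : {I : Finset (Fin (n + 2)) // I.card = m}, contr I.1 (proj (n + 2) (dxI I.1 * Y)) =
      proj (n + 2 - m) Y := by
  have : (∑ I : {I : Finset (Fin (n + 2)) // I.card = m},
      contr I.1 * proj (n + 2) * LinearMap.mulLeft ℂ (dxI I.1) : Module.End ℂ (Alg n r)) =
      proj (n + 2 - m) := by
    refine lin_ext fun u J hu => ?_
    simp only [LinearMap.sum_apply, Module.End.mul_apply, LinearMap.mulLeft_apply]
    have hform : ∀ I : Finset (Fin (n + 2)), IsForm (I.card + (0 + J.card)) (dxI I * (u * dxI J)) :=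
      fun I => (isForm_dxI I).mul (hu.isForm.mul (isForm_dxI J))
    rw [proj_mul_dxI hu]
    by_cases hJ : J.card = n + 2 - m
    · have hJc : (Jᶜ).card = m := by
        rw [Finset.card_compl, Fintype.card_fin]; omega
      -- Any other I of the same cardinality as the complement of J meets J, so that dx^I dx^J = 0.
      rw [if_pos hJ, Finset.sum_eq_single ⟨Jᶜ, hJc⟩]
      · have := hform Jᶜ
        rw [hJc, hJ, zero_add, Nat.add_sub_cancel' hm] at this
        rw [this.proj_eq, contr_dxI_mul]
        intro i hi
        rw [(isGDer_pd_dx i).leib, hu.pd_dx, pd_dxI_of_notMem (Finset.mem_compl.1 hi)]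
        simp
      · rintro ⟨I, hI⟩ _ hne
        have hd : ¬ Disjoint I J := by
          intro hd
          apply hne
          have h1 : I ⊆ Jᶜ := fun x hx => Finset.mem_compl.2 (Finset.disjoint_left.1 hd hx)
          exact Subtype.ext (Finset.eq_of_subset_of_card_le h1 (by rw [hJc, hI]))
        rw [← mul_assoc, (hasPar_dxI I).mul_comm_sg, mul_assoc, dxI_mul_dxI, if_neg hd, mul_zero,
          map_zero, map_zero]
      · simp
    · rw [if_neg hJ]
      refine Finset.sum_eq_zero fun I _ => ?_
      rw [(hform I.1).proj_of_ne, map_zero]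
      rw [I.2]
      omega
  simpa using LinearMap.congr_fun this Y

/-! ## Inner derivative, vertical derivations -/

theorem inner_apply (ξ : Fin (n + 2) → ℂ) (u : Alg n r) :
    inner ξ u = ∑ μ, ξ μ • pd (.dx μ) u := by simp [inner]

theorem isGDer_inner (ξ : Fin (n + 2) → ℂ) : IsGDer 1 (inner ξ : Module.End ℂ (Alg n r)) :=
  IsGDer.sum fun μ _ => (isGDer_pd_dx μ).smul _

theorem DxFree.inner {u : Alg n r} (hu : DxFree u) (ξ : Fin (n + 2) → ℂ) : inner ξ u = 0 := by
  simp [inner_apply, hu.pd_dx]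

theorem inner_dx (ξ : Fin (n + 2) → ℂ) (μ : Fin (n + 2)) :
    inner ξ (gen (.dx μ) : Alg n r) = ξ μ • 1 := by
  simp [inner_apply, pd_dx_dx]

theorem IsForm.inner {p : ℕ} {u : Alg n r} (hu : IsForm p u) (ξ : Fin (n + 2) → ℂ) :
    IsForm (p - 1) (inner ξ u) := by
  rw [inner_apply]
  exact IsForm.sum fun μ _ => (hu.pd_dx μ).smul _

/-- The anticommutator is a derivation that vanishes on generators, because i_ξ' dx^μ is a constant.
-/
theorem inner_inner (ξ ξ' : Fin (n + 2) → ℂ) (u : Alg n r) :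
    inner ξ (inner ξ' u) = - inner ξ' (inner ξ u) := by
  have : (inner ξ * inner ξ' + inner ξ' * inner ξ : Module.End ℂ (Alg n r)) = 0 := by
    refine ((isGDer_inner ξ).comm_odd (isGDer_inner ξ')).ext IsGDer.zero fun x => ?_
    cases x with
    | jet =>
      simp [(dxFree_jet _ _ _ _).inner]
    | dx μ => simp [inner_dx, (isGDer_inner _).map_one]
  exact eq_neg_of_add_eq_zero_left (LinearMap.congr_fun this u)

/-- Derivations that annihilate the differentials and do not create any. -/
structure IsVert (e : ℕ) (D : Module.End ℂ (Alg n r)) : Prop extends IsGDer e D where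
  dx : ∀ μ, D (gen (.dx μ)) = 0
  jet : ∀ F I a α, DxFree (D (gen (.jet F I a α)))

namespace IsVert

variable {e e' : ℕ} {D D' : Module.End ℂ (Alg n r)}

theorem congr (h : IsVert e D) (he : e % 2 = e' % 2) : IsVert e' D :=
  ⟨h.toIsGDer.congr he, h.dx, h.jet⟩

theorem dxZero_apply (h : IsVert e D) (u : Alg n r) : dxZero (D u) = D (dxZero u) := by
  induction u using gen_induction with
  | one => rw [h.map_one, map_zero, map_one, h.map_one]
  | add u v hu hv => simp only [map_add, hu, hv]
  | smul c u hu => simp only [map_smul, hu]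
  | gen_mul x u hu =>
    rw [h.leib, map_add, map_mul, map_mul, hu, (hasPar_gen x).sg_eq, map_smul, map_mul]
    cases x with
    | jet F I a α => rw [dxZero_jet, h.leib, h.jet, (hasPar_gen _).sg_eq]
    | dx μ => rw [h.dx, dxZero_dx]; simp

theorem dxFree (h : IsVert e D) {u : Alg n r} (hu : DxFree u) : DxFree (D u) := by
  rw [DxFree, h.dxZero_apply, hu]

theorem pd_dx_apply (h : IsVert e D) (μ : Fin (n + 2)) (u : Alg n r) :
    pd (.dx μ) (D u) = (-1 : ℂ) ^ e • D (pd (.dx μ) u) := by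
  have : (pd (.dx μ) * D - (-1 : ℂ) ^ (1 * e) • (D * pd (.dx μ)) : Module.End ℂ (Alg n r)) = 0 := by
    refine ((isGDer_pd_dx μ).comm h.toIsGDer).ext IsGDer.zero fun x => ?_
    cases x with
    | jet =>
      simp [(h.jet _ _ _ _).pd_dx, (dxFree_jet _ _ _ _).pd_dx]
    | dx ν =>
      simp only [LinearMap.sub_apply, Module.End.mul_apply, h.dx, map_zero, LinearMap.smul_apply,
        pd_dx_dx, LinearMap.zero_apply]
      split_ifs <;> simp [h.map_one]
  have := LinearMap.congr_fun this u
  rw [one_mul] at this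
  exact sub_eq_zero.1 this

theorem contr_apply (h : IsVert e D) (K : Finset (Fin (n + 2))) (u : Alg n r) :
    contr K (D u) = (-1 : ℂ) ^ (e * K.card) • D (contr K u) := by
  induction K using Finset.induction_on_min generalizing u with
  | empty => simp [contr_empty]
  | insert a K hK ih =>
    rw [contr_insert hK, Module.End.mul_apply, h.pd_dx_apply, map_smul, ih,
      Finset.card_insert_of_notMem fun ha => lt_irrefl _ (hK a ha), smul_smul, ← pow_add,
      mul_add, mul_one, add_comm, Module.End.mul_apply]

/-- The sign from passing D through the contractions cancels the one from the parity factor in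
`coef`. Vertical derivations hence act component by component, and therefore commute with the degree
projections and with Hodge duality without sign. -/
theorem coef_apply (h : IsVert e D) (K : Finset (Fin (n + 2))) (u : Alg n r) :
    coef K (D u) = D (coef K u) := by
  rw [BF.coef_apply, BF.coef_apply, h.contr_apply, map_smul, h.sg_apply, smul_smul,
    mul_comm e, neg_one_pow_add_self, one_smul, h.dxZero_apply]

theorem dxI (h : IsVert e D) (J : Finset (Fin (n + 2))) : D (dxI J) = 0 := by
  induction J using Finset.induction_on_min with
  | empty => rw [dxI_empty, h.map_one]
  | insert a K hK ih => rw [dxI_insert hK, h.leib, h.dx, ih, zero_mul, mul_zero, add_zero]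

theorem mul_dxI (h : IsVert e D) (u : Alg n r) (J : Finset (Fin (n + 2))) :
    D (u * BF.dxI J) = D u * BF.dxI J := by
  rw [h.leib, h.dxI, mul_zero, add_zero]

theorem proj_apply (h : IsVert e D) (p : ℕ) (u : Alg n r) : proj p (D u) = D (proj p u) := by
  rw [BF.proj_apply, BF.proj_apply, map_sum]
  simp only [h.mul_dxI, h.coef_apply]

theorem isForm (h : IsVert e D) {p : ℕ} {u : Alg n r} (hu : IsForm p u) : IsForm p (D u) := by
  rw [← hu.proj_eq, ← h.proj_apply]
  exact isForm_proj _ _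

theorem inner_apply (h : IsVert e D) (ξ : Fin (n + 2) → ℂ) (u : Alg n r) :
    inner ξ (D u) = (-1 : ℂ) ^ e • D (inner ξ u) := by
  rw [BF.inner_apply, BF.inner_apply, map_sum, Finset.smul_sum]
  refine Finset.sum_congr rfl fun μ _ => ?_
  rw [h.pd_dx_apply, map_smul, smul_comm]

theorem zero : IsVert e (0 : Module.End ℂ (Alg n r)) :=
  ⟨IsGDer.zero, fun _ => rfl, fun _ _ _ _ => map_zero _⟩

theorem add (h : IsVert e D) (h' : IsVert e D') : IsVert e (D + D') where
  toIsGDer := h.toIsGDer.add h'.toIsGDer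
  dx μ := by simp [h.dx, h'.dx]
  jet F I a α := by
    rw [DxFree, LinearMap.add_apply, map_add, h.jet, h'.jet]

theorem smul (c : ℂ) (h : IsVert e D) : IsVert e (c • D) where
  toIsGDer := h.toIsGDer.smul c
  dx μ := by simp [h.dx]
  jet F I a α := by
    rw [DxFree, LinearMap.smul_apply, map_smul, h.jet]

theorem sum {ι : Type*} {s : Finset ι} {D : ι → Module.End ℂ (Alg n r)}
    (h : ∀ i ∈ s, IsVert e (D i)) : IsVert e (∑ i ∈ s, D i) := by
  classical
  induction s using Finset.induction_on with
  | empty => exact zero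
  | insert a s ha ih =>
    rw [Finset.sum_insert ha]
    exact (h a (by simp)).add (ih fun i hi => h i (by simp [hi]))

theorem comm_odd (h : IsVert 1 D) (h' : IsVert 1 D') : IsVert 0 (D * D' + D' * D) where
  toIsGDer := h.toIsGDer.comm_odd h'.toIsGDer
  dx μ := by simp [h.dx, h'.dx]
  jet F I a α := by
    rw [DxFree, LinearMap.add_apply, map_add, Module.End.mul_apply, Module.End.mul_apply,
      h.dxFree (h'.jet F I a α), h'.dxFree (h.jet F I a α)]

theorem comm_even (h : IsVert 0 D) (h' : IsVert e D') : IsVert e (D * D' - D' * D) where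
  toIsGDer := h.toIsGDer.comm_even h'.toIsGDer
  dx μ := by simp [h.dx, h'.dx]
  jet F I a α := by
    rw [DxFree, LinearMap.sub_apply, map_sub, Module.End.mul_apply, Module.End.mul_apply,
      h.dxFree (h'.jet F I a α), h'.dxFree (h.jet F I a α)]

/-- Vertical derivations agree if they agree on the derivatives of the field components. -/
theorem ext (h : IsVert e D) (h' : IsVert e D')
    (H : ∀ F I a α, D (gen (.jet F I a α)) = D' (gen (.jet F I a α))) : D = D' := by
  refine h.toIsGDer.ext h'.toIsGDer fun x => ?_
  cases x with
  | jet F I a α => exact H F I a α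
  | dx μ => rw [h.dx, h'.dx]

end IsVert

/-! ## Hodge duality -/

/-- The coefficient of Hodge duality: `* dx^I = hodgeC η I dx^{Iᶜ}`. -/
def hodgeC (η : Fin (n + 2) → ℤˣ) (I : Finset (Fin (n + 2))) : ℂ :=
  (-1) ^ (I.card * (I.card - 1) / 2) * eps Iᶜ I * ∏ μ ∈ I, ((η μ : ℤ) : ℂ)

theorem hodge_apply (η : Fin (n + 2) → ℤˣ) (u : Alg n r) :
    hodge η u = ∑ I, hodgeC η I • (coef I u * dxI Iᶜ) := by
  simp [hodge, hodgeC]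

theorem hodge_mul_dxI (η : Fin (n + 2) → ℤˣ) {u : Alg n r} (hu : DxFree u)
    (J : Finset (Fin (n + 2))) : hodge η (u * dxI J) = hodgeC η J • (u * dxI Jᶜ) := by
  simp [hodge_apply, coef_mul_dxI hu]

theorem IsVert.hodge_apply {e : ℕ} {D : Module.End ℂ (Alg n r)} (h : IsVert e D)
    (η : Fin (n + 2) → ℤˣ) (u : Alg n r) : hodge η (D u) = D (hodge η u) := by
  simp only [BF.hodge_apply, map_sum, map_smul, h.mul_dxI, h.coef_apply]

theorem card_compl_eq (J : Finset (Fin (n + 2))) : Jᶜ.card = n + 2 - J.card := by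
  rw [Finset.card_compl, Fintype.card_fin]

theorem IsForm.hodge {p : ℕ} {u : Alg n r} (hu : IsForm p u) (η : Fin (n + 2) → ℤˣ) :
    IsForm (n + 2 - p) (hodge η u) := by
  rw [hodge_apply]
  refine IsForm.sum fun I _ => IsForm.smul _ ?_
  by_cases h : I.card = p
  · have := (dxFree_coef I u).isForm.mul (isForm_dxI Iᶜ)
    rwa [zero_add, card_compl_eq, h] at this
  · rw [hu.coef_of_ne h, zero_mul]
    exact IsForm.zero _

theorem hasPar_contr {k : ℕ} {u : Alg n r} (hu : HasPar k u) (K : Finset (Fin (n + 2))) :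
    HasPar (k + K.card) (contr K u) := by
  induction K using Finset.induction_on_min generalizing k u with
  | empty => simpa [contr_empty] using hu
  | insert a K hK ih =>
    rw [contr_insert hK, Finset.card_insert_of_notMem fun ha => lt_irrefl _ (hK a ha)]
    exact (ih ((isGDer_pd_dx a).hasPar hu)).congr (by omega)

theorem HasPar.coef {k : ℕ} {u : Alg n r} (hu : HasPar k u) (K : Finset (Fin (n + 2))) :
    HasPar (k + K.card) (coef K u) := by
  rw [coef_apply, (hasPar_contr hu K).sg_eq, map_smul]
  exact ((hasPar_contr hu K).dxZero).smul _

theorem HasPar.proj {k : ℕ} {u : Alg n r} (hu : HasPar k u) (p : ℕ) : HasPar k (proj p u) := by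
  rw [proj_apply]
  exact HasPar.sum fun I _ => ((hu.coef I).mul (hasPar_dxI I)).congr (by omega)

theorem HasPar.hodge {k : ℕ} {u : Alg n r} (hu : HasPar k u) (η : Fin (n + 2) → ℤˣ) :
    HasPar (k + n) (hodge η u) := by
  rw [hodge_apply]
  refine HasPar.sum fun I _ => HasPar.smul _ (((hu.coef I).mul (hasPar_dxI Iᶜ)).congr ?_)
  have := card_le I
  rw [card_compl_eq]
  omega

/-! ## Total derivatives -/

theorem del_jet (μ : Fin (n + 2)) (F : Field n) (I) (a : Fin r) (α) :
    del μ (gen (.jet F I a α)) = gen (.jet F I a (α + Pi.single μ 1)) := by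
  rw [del, vf_gen]

theorem isVert_del (μ : Fin (n + 2)) : IsVert 0 (del μ : Module.End ℂ (Alg n r)) where
  toIsGDer := by
    refine isGDer_vf fun x => ?_
    cases x with
    | jet F I a α => exact hasPar_gen _
    | dx ν => exact HasPar.zero _
  dx ν := by rw [del, vf_gen]
  jet F I a α := by rw [del_jet]; exact dxFree_jet _ _ _ _

/-- Vertical derivations that commute with the total derivatives. -/
structure IsEvol (e : ℕ) (D : Module.End ℂ (Alg n r)) : Prop extends IsVert e D where
  comm_del : ∀ μ u, D (del μ u) = del μ (D u)

theorem isEvol_del (ν : Fin (n + 2)) : IsEvol 0 (del ν : Module.End ℂ (Alg n r)) where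
  toIsVert := isVert_del ν
  comm_del μ u := by
    have : (del ν * del μ - del μ * del ν : Module.End ℂ (Alg n r)) = 0 := by
      refine ((isVert_del ν).comm_even (isVert_del μ)).ext IsVert.zero fun F I a α => ?_
      simp only [LinearMap.sub_apply, Module.End.mul_apply, del_jet, LinearMap.zero_apply]
      rw [add_right_comm, sub_self]
    exact sub_eq_zero.1 (LinearMap.congr_fun this u)

theorem extd_apply (u : Alg n r) : extd u = ∑ μ, gen (.dx μ) * del μ u := by
  simp [extd]

theorem isGDer_extd : IsGDer 1 (extd : Module.End ℂ (Alg n r)) :=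
  IsGDer.sum fun μ _ => ((isVert_del μ).toIsGDer.mulLeft (hasPar_dx μ)).congr rfl

theorem IsForm.extd {p : ℕ} {u : Alg n r} (hu : IsForm p u) : IsForm (p + 1) (extd u) := by
  rw [extd_apply, add_comm]
  exact IsForm.sum fun μ _ => (isForm_dx μ).mul ((isVert_del μ).isForm hu)

theorem eq_zero_of_eq_neg {u : Alg n r} (h : u = -u) : u = 0 := by
  have h1 : (2 : ℂ) • u = 0 := by
    rw [two_smul]
    nth_rewrite 2 [h]
    exact add_neg_cancel u
  exact (smul_eq_zero.1 h1).resolve_left two_ne_zero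

/-- The products dx^μ dx^ν are antisymmetric and ∂_μ ∂_ν is symmetric, so d²u equals its own
negative. -/
theorem extd_extd (u : Alg n r) : extd (extd u) = 0 := by
  have h : extd (extd u) = ∑ μ, ∑ ν, gen (.dx μ) * gen (.dx ν) * del μ (del ν u) := by
    rw [extd_apply]
    refine Finset.sum_congr rfl fun μ _ => ?_
    rw [extd_apply, map_sum, Finset.mul_sum]
    refine Finset.sum_congr rfl fun ν _ => ?_
    rw [(isVert_del μ).leib, (isVert_del μ).dx, zero_mul, zero_add, sg_zero, mul_assoc]
  apply eq_zero_of_eq_neg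
  rw [h]
  conv_lhs => rw [Finset.sum_comm]
  rw [← Finset.sum_neg_distrib]
  refine Finset.sum_congr rfl fun μ _ => ?_
  rw [← Finset.sum_neg_distrib]
  refine Finset.sum_congr rfl fun ν _ => ?_
  rw [dx_mul_dx, alg_neg_mul, (isEvol_del ν).comm_del]

/-- Both sides are even derivations and agree on generators; the constancy of ξ enters through L_ξ
dx^ν = 0. In this form L_ξ is visibly vertical and commutes with every evolutionary derivation. -/
theorem lie_eq (ξ : Fin (n + 2) → ℂ) :
    (lie ξ : Module.End ℂ (Alg n r)) = ∑ μ, ξ μ • del μ := by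
  refine ((isGDer_inner ξ).comm_odd isGDer_extd).ext
    (IsGDer.sum fun μ _ => (isVert_del μ).toIsGDer.smul _) fun x => ?_
  simp only [LinearMap.add_apply, Module.End.mul_apply, LinearMap.sum_apply, LinearMap.smul_apply]
  cases x with
  | jet F I a α =>
    rw [(dxFree_jet F I a α).inner, map_zero, add_zero, extd_apply, map_sum]
    refine Finset.sum_congr rfl fun μ _ => ?_
    rw [(isGDer_inner ξ).leib, ((isVert_del μ).jet F I a α).inner, mul_zero, add_zero, inner_dx,
      smul_mul_assoc, one_mul]
  | dx ν =>
    simp [inner_dx, extd_apply, (isVert_del _).dx, (isVert_del _).map_one]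

theorem lie_apply (ξ : Fin (n + 2) → ℂ) (u : Alg n r) :
    lie ξ u = inner ξ (extd u) + extd (inner ξ u) := rfl

theorem isVert_lie (ξ : Fin (n + 2) → ℂ) : IsVert 0 (lie ξ : Module.End ℂ (Alg n r)) := by
  rw [lie_eq]
  exact IsVert.sum fun μ _ => (isVert_del μ).smul _

theorem isEvol_lie (ξ : Fin (n + 2) → ℂ) : IsEvol 0 (lie ξ : Module.End ℂ (Alg n r)) where
  toIsVert := isVert_lie ξ
  comm_del μ u := by
    simp only [lie_eq, LinearMap.sum_apply, LinearMap.smul_apply, map_sum, map_smul,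
      (isEvol_del _).comm_del μ]

/-! ## Evolutionary derivations -/

namespace IsEvol

variable {e e' : ℕ} {D D' : Module.End ℂ (Alg n r)}

theorem comm_odd (h : IsEvol 1 D) (h' : IsEvol 1 D') : IsEvol 0 (D * D' + D' * D) where
  toIsVert := h.toIsVert.comm_odd h'.toIsVert
  comm_del μ u := by simp [h.comm_del, h'.comm_del]

theorem zero : IsEvol e (0 : Module.End ℂ (Alg n r)) where
  toIsVert := IsVert.zero
  comm_del μ u := by simp

theorem extd_apply (h : IsEvol e D) (u : Alg n r) : D (extd u) = (-1 : ℂ) ^ e • extd (D u) := by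
  rw [BF.extd_apply, BF.extd_apply, map_sum, Finset.smul_sum]
  refine Finset.sum_congr rfl fun μ _ => ?_
  rw [h.leib, h.dx, zero_mul, zero_add, (hasPar_dx μ).sg_eq, mul_one, smul_mul_assoc, h.comm_del]

theorem lie_apply (h : IsEvol e D) (ξ : Fin (n + 2) → ℂ) (u : Alg n r) :
    D (lie ξ u) = lie ξ (D u) := by
  simp only [lie_eq, LinearMap.sum_apply, LinearMap.smul_apply, map_sum, map_smul, h.comm_del]

theorem gMul_apply (h : IsEvol e D) (η : Fin (n + 2) → ℤˣ) (ξ : Fin (n + 2) → ℂ) (u : Alg n r) :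
    D (gMul η ξ u) = (-1 : ℂ) ^ e • gMul η ξ (D u) := by
  simp only [gMul, LinearMap.mulLeft_apply, Finset.sum_mul, map_sum, Finset.smul_sum,
    smul_mul_assoc, map_smul]
  refine Finset.sum_congr rfl fun μ _ => ?_
  rw [h.leib, h.dx, zero_mul, zero_add, (hasPar_dx μ).sg_eq, mul_one, smul_mul_assoc, smul_comm]

end IsEvol

/-- `delIter` is an ordered product in a noncommutative ring. Commutativity of the factors lets the
additional one slide to the front, which gives the recursion for `delIter`. -/
theorem ofFn_prod_pow {M : Type*} [Monoid M] {m : ℕ} (f : Fin m → M)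
    (hf : ∀ i j, Commute (f i) (f j)) (α : Fin m → ℕ) (j : Fin m) :
    (List.ofFn fun i => f i ^ (α + Pi.single j 1 : Fin m → ℕ) i).prod =
      f j * (List.ofFn fun i => f i ^ α i).prod := by
  induction m with
  | zero => exact j.elim0
  | succ m ih =>
    rw [List.ofFn_succ, List.ofFn_succ, List.prod_cons, List.prod_cons]
    refine Fin.cases ?_ (fun j => ?_) j
    · have : ∀ i : Fin m, (α + Pi.single 0 1 : Fin (m + 1) → ℕ) i.succ = α i.succ := by
        intro i; simp
      simp only [this]
      simp [pow_succ', mul_assoc]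
    · have h1 : (α + Pi.single j.succ 1 : Fin (m + 1) → ℕ) 0 = α 0 := by simp
      have h2 : ∀ i : Fin m, (α + Pi.single j.succ 1 : Fin (m + 1) → ℕ) i.succ =
          ((fun i => α i.succ) + Pi.single j 1 : Fin m → ℕ) i := by
        intro i; simp [Pi.single_apply]
      simp only [h1, h2]
      rw [ih (fun i => f i.succ) (fun i j => hf _ _), ← mul_assoc, ← mul_assoc,
        ((hf 0 j.succ).pow_left _).eq]

theorem delIter_zero : (delIter 0 : Module.End ℂ (Alg n r)) = 1 := by
  simp [delIter, List.ofFn_const]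

theorem delIter_add_single (α : Fin (n + 2) → ℕ) (μ : Fin (n + 2)) :
    (delIter (α + Pi.single μ 1) : Module.End ℂ (Alg n r)) = del μ * delIter α :=
  ofFn_prod_pow (fun μ => (del μ : Module.End ℂ (Alg n r)))
    (fun i j => LinearMap.ext fun u => (isEvol_del i).comm_del j u) _ _

theorem multiIndex_induction {m : ℕ} {C : (Fin m → ℕ) → Prop} (zero : C 0)
    (add_single : ∀ α μ, C α → C (α + Pi.single μ 1)) (α : Fin m → ℕ) : C α := by
  induction hk : ∑ μ, α μ generalizing α with
  | zero =>
    have : α = 0 := by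
      ext μ
      exact Finset.sum_eq_zero_iff.1 hk μ (Finset.mem_univ μ)
    rw [this]; exact zero
  | succ k ih =>
    obtain ⟨μ, hμ⟩ : ∃ μ, 0 < α μ := by
      by_contra! h
      have : ∑ μ, α μ = 0 := Finset.sum_eq_zero fun μ _ => Nat.le_zero.1 (h μ)
      omega
    have h1 : α = (α - Pi.single μ 1) + Pi.single μ 1 := by
      ext ν
      by_cases h : ν = μ
      · subst h; simp; omega
      · simp [h]
    rw [h1]
    refine add_single _ _ (ih _ ?_)
    rw [h1] at hk
    simp only [Pi.add_apply, Finset.sum_add_distrib, Finset.sum_pi_single', Finset.mem_univ,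
      if_true] at hk
    exact Nat.succ_injective hk

theorem IsEvol.delIter_apply {e : ℕ} {D : Module.End ℂ (Alg n r)} (h : IsEvol e D)
    (α : Fin (n + 2) → ℕ) (u : Alg n r) : D (delIter α u) = delIter α (D u) := by
  induction α using multiIndex_induction with
  | zero => simp [delIter_zero]
  | add_single α μ ih =>
    rw [delIter_add_single, Module.End.mul_apply, Module.End.mul_apply, h.comm_del, ih]

theorem dxFree_delIter (α : Fin (n + 2) → ℕ) {u : Alg n r} (hu : DxFree u) :
    DxFree (delIter α u) := by
  induction α using multiIndex_induction with
  | zero => rwa [delIter_zero]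
  | add_single α μ ih =>
    rw [delIter_add_single, Module.End.mul_apply]
    exact (isVert_del μ).dxFree ih

theorem hasPar_delIter (α : Fin (n + 2) → ℕ) {k : ℕ} {u : Alg n r} (hu : HasPar k u) :
    HasPar k (delIter α u) := by
  induction α using multiIndex_induction with
  | zero => rwa [delIter_zero]
  | add_single α μ ih =>
    rw [delIter_add_single, Module.End.mul_apply]
    exact (isVert_del μ).hasPar ih

theorem delIter_jet (F : Field n) (I) (a : Fin r) (α) :
    delIter α (gen (.jet F I a 0)) = gen (.jet F I a α) := by
  induction α using multiIndex_induction with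
  | zero => rw [delIter_zero]; rfl
  | add_single α μ ih => rw [delIter_add_single, Module.End.mul_apply, ih, del_jet]

/-- The grading of a field modulo two. -/
def Field.par (F : Field n) : ℕ := F.gh.natAbs + F.deg

theorem gpar_jet (F : Field n) (I) (a : Fin r) (α) :
    gpar (Gen.jet F I a α) % 2 = F.gh.natAbs % 2 := by
  by_cases h : Odd F.gh
  · have h' := Int.natAbs_odd.2 h
    rw [Nat.odd_iff] at h'
    simp [gpar, Gen.IsOdd, h, h']
  · have h' : Even F.gh.natAbs := Int.natAbs_even.2 (Int.not_odd_iff_even.1 h)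
    rw [Nat.even_iff] at h'
    simp [gpar, Gen.IsOdd, h, h']

theorem hasPar_jet (F : Field n) (I) (a : Fin r) (α) :
    HasPar F.gh.natAbs (gen (.jet F I a α)) := by
  exact (hasPar_gen _).congr (gpar_jet F I a α)

theorem isForm_fld (F : Field n) (a : Fin r) : IsForm F.deg (fld F a) := by
  refine IsForm.sum fun I _ => ?_
  have := (dxFree_jet F I a 0).isForm.mul (isForm_dxI I.1)
  rwa [zero_add, I.2] at this

theorem hasPar_fld (F : Field n) (a : Fin r) : HasPar F.par (fld F a) := by
  refine HasPar.sum fun I _ => ?_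
  have := (hasPar_jet F I a 0).mul (hasPar_dxI I.1)
  rwa [I.2] at this

theorem coef_fld (F : Field n) (I : {I : Finset (Fin (n + 2)) // I.card = F.deg}) (a : Fin r) :
    coef I.1 (fld F a) = gen (.jet F I a 0) := by
  rw [fld, map_sum, Finset.sum_eq_single I]
  · rw [coef_mul_dxI (dxFree_jet F I a 0), if_pos rfl]
  · intro J _ hJ
    rw [coef_mul_dxI (dxFree_jet F J a 0), if_neg]
    exact fun h => hJ (Subtype.ext h.symm)
  · simp

/-- Evolutionary derivations agree if they agree on the fields. -/
theorem IsEvol.ext {e : ℕ} {D D' : Module.End ℂ (Alg n r)} (h : IsEvol e D) (h' : IsEvol e D')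
    (H : ∀ F, app D (fld F) = app D' (fld F)) : D = D' := by
  refine h.toIsVert.ext h'.toIsVert fun F I a α => ?_
  have : D (fld F a) = D' (fld F a) := congrFun (H F) a
  rw [← delIter_jet, h.delIter_apply, h'.delIter_apply, ← coef_fld, ← h.coef_apply,
    ← h'.coef_apply, this]

/-- Commutation with ∂_μ is built in, as the jet component with index α is sent to ∂_α of the
component of Q. Taking a component removes the form degree from the parity. -/
theorem isEvol_ward {e : ℕ} {Q : Field n → LForm n r} (hQ : ∀ F a, HasPar (F.par + e) (Q F a)) :
    IsEvol e (ward Q) := by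
  have hjet : ∀ F I a α, ward Q (gen (.jet F I a α)) = delIter α (coef I.1 (Q F a)) := by
    intro F I a α
    rw [ward, vf_gen]
  have hv : IsVert e (ward Q) :=
  { toIsGDer := by
      refine isGDer_vf fun x => ?_
      cases x with
      | jet F I a α =>
        refine hasPar_delIter α ((hQ F a).coef I.1 |>.congr ?_)
        have := gpar_jet F I a α
        rw [I.2, Field.par]
        omega
      | dx ν => exact HasPar.zero _
    dx := fun μ => by rw [ward, vf_gen]
    jet := fun F I a α => by
      rw [hjet]
      exact dxFree_delIter α (dxFree_coef _ _) }
  refine ⟨hv, fun μ u => ?_⟩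
  have : (del μ * ward Q - ward Q * del μ : Module.End ℂ (Alg n r)) = 0 := by
    refine ((isVert_del μ).comm_even hv).ext IsVert.zero fun F I a α => ?_
    simp only [LinearMap.sub_apply, Module.End.mul_apply, del_jet, hjet, LinearMap.zero_apply,
      delIter_add_single, sub_self]
  exact (sub_eq_zero.1 (LinearMap.congr_fun this u)).symm

/-- Only the components of Q of degree deg F enter the operator, so the prescribed variation is
recovered provided that it is homogeneous of that degree. -/
theorem ward_fld {Q : Field n → LForm n r} {F : Field n} (hQ : ∀ a, IsForm F.deg (Q F a))
    {e : ℕ} (h : IsVert e (ward Q)) : app (ward Q) (fld F) = Q F := by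
  funext a
  rw [app, fld, map_sum, ← (hQ a).sum_coef]
  refine Finset.sum_congr rfl fun I _ => ?_
  rw [h.mul_dxI, ward, vf_gen]
  change delIter 0 (coef I.1 (Q F a)) * _ = _
  rw [delIter_zero]
  rfl

/-! ## The gauge algebra -/

namespace GaugeAlgebra

variable (G : GaugeAlgebra r N)

/-- The T_c are orthonormal for the trace, so this trace isolates one structure constant. All
symmetries of f follow from those of the trace. -/
theorem trace_comm_mul (a b c : Fin r) :
    ((G.T a * G.T b - G.T b * G.T a) * G.T c).trace = Complex.I * G.f a b c := by
  rw [G.comm, Finset.sum_mul, Matrix.trace_sum]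
  simp [Matrix.trace_smul, G.trace_mul]

theorem f_swap (a b c : Fin r) : G.f b a c = - G.f a b c := by
  have h1 := G.trace_comm_mul a b c
  have h2 := G.trace_comm_mul b a c
  rw [← neg_sub, Matrix.neg_mul, Matrix.trace_neg, h1] at h2
  have := mul_left_cancel₀ Complex.I_ne_zero (h2.symm.trans (mul_neg _ _).symm)
  exact this

theorem f_cycl (a b c : Fin r) : G.f a b c = G.f b c a := by
  have h1 := G.trace_comm_mul a b c
  have h2 := G.trace_comm_mul b c a
  refine mul_left_cancel₀ Complex.I_ne_zero (h1.symm.trans (Eq.trans ?_ h2))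
  have e1 : (G.T a * G.T b * G.T c).trace = (G.T b * G.T c * G.T a).trace := by
    rw [Matrix.trace_mul_cycle, Matrix.trace_mul_cycle]
  have e2 : (G.T b * G.T a * G.T c).trace = (G.T c * G.T b * G.T a).trace :=
    Matrix.trace_mul_cycle _ _ _
  rw [sub_mul, sub_mul, Matrix.trace_sub, Matrix.trace_sub, e1, e2]

theorem trace_comm_comm_mul (a b c d : Fin r) :
    (((G.T a * G.T b - G.T b * G.T a) * G.T c - G.T c * (G.T a * G.T b - G.T b * G.T a)) *
      G.T d).trace = ∑ e, (Complex.I * G.f a b e) * (Complex.I * G.f e c d) := by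
  rw [G.comm, Finset.sum_mul, Finset.mul_sum, ← Finset.sum_sub_distrib, Finset.sum_mul,
    Matrix.trace_sum]
  refine Finset.sum_congr rfl fun e _ => ?_
  rw [smul_mul_assoc, mul_smul_comm, ← smul_sub, smul_mul_assoc, Matrix.trace_smul,
    trace_comm_mul, smul_eq_mul]

/-- The Jacobi identity of matrix commutators, traced against T_d; both sides are traces of nested
commutators. -/
theorem jacobi (a b c d : Fin r) :
    ∑ e, (Complex.I * G.f a b e) * (Complex.I * G.f e c d) =
      ∑ e, (Complex.I * G.f b c e) * (Complex.I * G.f a e d) -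
        ∑ e, (Complex.I * G.f a c e) * (Complex.I * G.f b e d) := by
  have h : ∀ a b c, ∑ e, (Complex.I * G.f b c e) * (Complex.I * G.f a e d) =
      - ∑ e, (Complex.I * G.f b c e) * (Complex.I * G.f e a d) := by
    intro a b c
    rw [← Finset.sum_neg_distrib]
    refine Finset.sum_congr rfl fun e _ => ?_
    rw [G.f_swap e a]; ring
  rw [h, h, ← trace_comm_comm_mul, ← trace_comm_comm_mul, ← trace_comm_comm_mul,
    ← Matrix.trace_neg, ← Matrix.trace_neg, ← Matrix.trace_sub]
  congr 1
  noncomm_ring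

end GaugeAlgebra

/-! ### Lie algebra valued forms and the graded bracket -/

/-- Lie algebra valued forms of parity `k`. -/
def LPar (k : ℕ) (X : LForm n r) : Prop := ∀ a, HasPar k (X a)

/-- Lie algebra valued forms of degree `p`. -/
def LDeg (p : ℕ) (X : LForm n r) : Prop := ∀ a, IsForm p (X a)

theorem Tr_eq (G : GaugeAlgebra r N) (X Y : LForm n r) : Tr G X Y = ∑ a, X a * Y a := by
  simp [Tr, G.trace_mul]

section bracket

variable (G : GaugeAlgebra r N)

theorem bracket_apply (X Y : LForm n r) (c : Fin r) :
    bracket G X Y c = ∑ a, ∑ b, (Complex.I * G.f a b c) • (X a * Y b) := rfl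

theorem bracket_add_left (X X' Y : LForm n r) :
    bracket G (X + X') Y = bracket G X Y + bracket G X' Y := by
  funext c
  simp [bracket_apply, add_mul, Finset.sum_add_distrib]

theorem bracket_add_right (X Y Y' : LForm n r) :
    bracket G X (Y + Y') = bracket G X Y + bracket G X Y' := by
  funext c
  simp [bracket_apply, mul_add, Finset.sum_add_distrib]

theorem bracket_smul_left (t : ℂ) (X Y : LForm n r) :
    bracket G (t • X) Y = t • bracket G X Y := by
  funext c
  simp [bracket_apply, Finset.smul_sum, smul_comm t, smul_mul_assoc]

theorem bracket_smul_right (t : ℂ) (X Y : LForm n r) :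
    bracket G X (t • Y) = t • bracket G X Y := by
  funext c
  simp [bracket_apply, Finset.smul_sum, smul_comm t, mul_smul_comm]

/-- The bracket as a bilinear map. -/
def bracketL : LForm n r →ₗ[ℂ] LForm n r →ₗ[ℂ] LForm n r :=
  LinearMap.mk₂ ℂ (bracket G) (bracket_add_left G) (bracket_smul_left G) (bracket_add_right G)
    (bracket_smul_right G)

theorem bracket_sum_left {ι : Type*} (s : Finset ι) (X : ι → LForm n r) (Y : LForm n r) :
    bracket G (∑ i ∈ s, X i) Y = ∑ i ∈ s, bracket G (X i) Y :=
  (congrArg (fun f => f Y) (map_sum (bracketL G) X s)).trans (by simp; rfl)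

theorem bracket_sum_right {ι : Type*} (s : Finset ι) (X : LForm n r) (Y : ι → LForm n r) :
    bracket G X (∑ i ∈ s, Y i) = ∑ i ∈ s, bracket G X (Y i) :=
  map_sum (bracketL G X) Y s

theorem LPar.bracket {k l : ℕ} {X Y : LForm n r} (hX : LPar k X) (hY : LPar l Y) :
    LPar (k + l) (bracket G X Y) := fun _ =>
  HasPar.sum fun a _ => HasPar.sum fun b _ => ((hX a).mul (hY b)).smul _

theorem LDeg.bracket {k l : ℕ} {X Y : LForm n r} (hX : LDeg k X) (hY : LDeg l Y) :
    LDeg (k + l) (bracket G X Y) := fun _ =>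
  IsForm.sum fun a _ => IsForm.sum fun b _ => ((hX a).mul (hY b)).smul _

theorem bracket_comm {k l : ℕ} {X Y : LForm n r} (hX : LPar k X) (hY : LPar l Y) :
    bracket G X Y = (-1 : ℂ) ^ (k * l + 1) • bracket G Y X := by
  funext c
  rw [Pi.smul_apply, bracket_apply, bracket_apply, Finset.sum_comm, Finset.smul_sum]
  refine Finset.sum_congr rfl fun b _ => ?_
  rw [Finset.smul_sum]
  refine Finset.sum_congr rfl fun a _ => ?_
  rw [(hX a).mul_comm (hY b), G.f_swap b a, smul_smul, smul_smul]
  congr 1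
  ring

/-- Invariance of the trace form. The factors X, Y, Z keep their order, so cyclicity of f is all
that is needed and no sign occurs. -/
theorem Tr_bracket (X Y Z : LForm n r) :
    Tr G (bracket G X Y) Z = Tr G X (bracket G Y Z) := by
  rw [Tr_eq, Tr_eq]
  simp only [bracket_apply, Finset.sum_mul, Finset.mul_sum, smul_mul_assoc, mul_smul_comm,
    mul_assoc]
  rw [Finset.sum_comm]
  refine Finset.sum_congr rfl fun a _ => ?_
  rw [Finset.sum_comm]
  refine Finset.sum_congr rfl fun b _ => Finset.sum_congr rfl fun c _ => ?_
  rw [G.f_cycl]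

theorem app_bracket {e k : ℕ} {D : Module.End ℂ (Alg n r)} (hD : IsGDer e D) {X : LForm n r}
    (hX : LPar k X) (Y : LForm n r) : app D (bracket G X Y) =
      bracket G (app D X) Y + (-1 : ℂ) ^ (e * k) • bracket G X (app D Y) := by
  funext c
  simp only [app, Pi.add_apply, Pi.smul_apply, bracket_apply, map_sum, map_smul,
    hD.leib_of_hasPar (hX _), smul_add, Finset.sum_add_distrib, Finset.smul_sum,
    smul_comm ((-1 : ℂ) ^ (e * k))]

/-- For odd X the products X^a X^b are antisymmetric in a and b. By the Jacobi identity [[X,X],Z]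
has coefficients K_{abc} - K_{bac}, and antisymmetry turns this difference into 2K_{abc}. -/
theorem bracket_bracket {X : LForm n r} (hX : LPar 1 X) (Z : LForm n r) :
    bracket G X (bracket G X Z) = (1 / 2 : ℂ) • bracket G (bracket G X X) Z := by
  funext d
  let K : Fin r → Fin r → Fin r → ℂ := fun a b c =>
    ∑ e, (Complex.I * G.f b c e) * (Complex.I * G.f a e d)
  have h1 : bracket G X (bracket G X Z) d = ∑ a, ∑ b, ∑ c, K a b c • (X a * X b * Z c) := by
    simp only [bracket_apply, Finset.mul_sum, Finset.smul_sum, K, Finset.sum_smul, mul_smul_comm,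
      smul_smul, mul_assoc]
    refine Finset.sum_congr rfl fun a _ => ?_
    rw [Finset.sum_comm]
    refine Finset.sum_congr rfl fun b _ => ?_
    rw [Finset.sum_comm]
    refine Finset.sum_congr rfl fun c _ => Finset.sum_congr rfl fun e _ => ?_
    congr 1
    ring
  have h2 : bracket G (bracket G X X) Z d =
      ∑ a, ∑ b, ∑ c, (K a b c - K b a c) • (X a * X b * Z c) := by
    simp only [K, ← G.jacobi]
    simp only [bracket_apply, Finset.sum_mul, Finset.smul_sum, Finset.sum_smul, smul_mul_assoc,
      smul_smul]
    calc _ = ∑ c, ∑ e, ∑ a, ∑ b, (Complex.I * G.f e c d * (Complex.I * G.f a b e)) •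
          (X a * X b * Z c) := Finset.sum_comm
      _ = ∑ c, ∑ a, ∑ b, ∑ e, (Complex.I * G.f e c d * (Complex.I * G.f a b e)) •
          (X a * X b * Z c) := by
        refine Finset.sum_congr rfl fun c _ => ?_
        rw [Finset.sum_comm]
        exact Finset.sum_congr rfl fun a _ => Finset.sum_comm
      _ = _ := by
        rw [Finset.sum_comm]
        refine Finset.sum_congr rfl fun a _ => ?_
        rw [Finset.sum_comm]
        refine Finset.sum_congr rfl fun b _ => Finset.sum_congr rfl fun c _ =>
          Finset.sum_congr rfl fun e _ => ?_
        congr 1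
        ring
  have h3 : ∑ a, ∑ b, ∑ c, K b a c • (X a * X b * Z c) =
      - ∑ a, ∑ b, ∑ c, K a b c • (X a * X b * Z c) := by
    rw [Finset.sum_comm]
    simp only [← Finset.sum_neg_distrib]
    refine Finset.sum_congr rfl fun a _ => Finset.sum_congr rfl fun b _ =>
      Finset.sum_congr rfl fun c _ => ?_
    rw [(hX b).mul_comm (hX a), smul_mul_assoc, smul_comm]
    rw [mul_one, pow_one, alg_neg_smul, one_smul]
  rw [Pi.smul_apply, h1, h2]
  simp only [alg_sub_smul, Finset.sum_sub_distrib]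
  rw [h3]
  module

/-- Graded antisymmetry gives [X,[X,X]] = -[[X,X],X], whereas `bracket_bracket` gives ½[[X,X],X];
hence 3/2 of it vanishes. -/
theorem bracket_bracket_self {X : LForm n r} (hX : LPar 1 X) :
    bracket G (bracket G X X) X = 0 := by
  have h1 := bracket_bracket G hX X
  rw [bracket_comm G hX (hX.bracket G hX)] at h1
  have h2 : (3 / 2 : ℂ) • bracket G (bracket G X X) X = 0 := by
    have h3 : (3 / 2 : ℂ) • bracket G (bracket G X X) X = (1 / 2 : ℂ) • bracket G (bracket G X X) X -
        (-1 : ℂ) ^ (1 * (1 + 1) + 1) • bracket G (bracket G X X) X := by module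
    rw [h3, h1, sub_self]
  exact (smul_eq_zero.1 h2).resolve_left (by norm_num)

end bracket

/-! ## Operators on Lie algebra valued forms -/

theorem app_apply (D : Module.End ℂ (Alg n r)) (X : LForm n r) (a : Fin r) :
    app D X a = D (X a) := rfl

theorem app_add (D : Module.End ℂ (Alg n r)) (X Y : LForm n r) :
    app D (X + Y) = app D X + app D Y := map_add (D.compLeft (Fin r)) X Y

theorem app_sub (D : Module.End ℂ (Alg n r)) (X Y : LForm n r) :
    app D (X - Y) = app D X - app D Y := map_sub (D.compLeft (Fin r)) X Y

theorem app_neg (D : Module.End ℂ (Alg n r)) (X : LForm n r) :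
    app D (-X) = - app D X := map_neg (D.compLeft (Fin r)) X

theorem app_smul (D : Module.End ℂ (Alg n r)) (c : ℂ) (X : LForm n r) :
    app D (c • X) = c • app D X := map_smul (D.compLeft (Fin r)) c X

theorem app_zero (D : Module.End ℂ (Alg n r)) : app D 0 = 0 := map_zero (D.compLeft (Fin r))

theorem app_sum {ι : Type*} (D : Module.End ℂ (Alg n r)) (s : Finset ι) (X : ι → LForm n r) :
    app D (∑ i ∈ s, X i) = ∑ i ∈ s, app D (X i) := map_sum (D.compLeft (Fin r)) X s

namespace LPar

variable {k l : ℕ} {X Y : LForm n r}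

theorem congr (hX : LPar k X) (h : k % 2 = l % 2) : LPar l X := fun a => (hX a).congr h
theorem zero (k : ℕ) : LPar k (0 : LForm n r) := fun _ => HasPar.zero k
theorem add (hX : LPar k X) (hY : LPar k Y) : LPar k (X + Y) := fun a => (hX a).add (hY a)
theorem sub (hX : LPar k X) (hY : LPar k Y) : LPar k (X - Y) := fun a => (hX a).sub (hY a)
theorem neg (hX : LPar k X) : LPar k (-X) := fun a => (hX a).neg
theorem smul (c : ℂ) (hX : LPar k X) : LPar k (c • X) := fun a => (hX a).smul c

theorem sum {ι : Type*} {s : Finset ι} {X : ι → LForm n r} (h : ∀ i ∈ s, LPar k (X i)) :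
    LPar k (∑ i ∈ s, X i) := fun a => by
  rw [Finset.sum_apply]
  exact HasPar.sum fun i hi => h i hi a

theorem app {e : ℕ} {D : Module.End ℂ (Alg n r)} (hX : LPar k X) (hD : IsGDer e D) :
    LPar (k + e) (app D X) := fun a => hD.hasPar (hX a)

theorem extd (hX : LPar k X) : LPar (k + 1) (BF.app extd X) := hX.app isGDer_extd

theorem inner (hX : LPar k X) (ξ : Fin (n + 2) → ℂ) : LPar (k + 1) (BF.app (inner ξ) X) :=
  hX.app (isGDer_inner ξ)

theorem lie (hX : LPar k X) (ξ : Fin (n + 2) → ℂ) : LPar k (BF.app (lie ξ) X) :=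
  LPar.app (e := 0) hX (isVert_lie ξ).toIsGDer

theorem hodge (hX : LPar k X) (η : Fin (n + 2) → ℤˣ) : LPar (k + n) (BF.app (hodge η) X) :=
  fun a => (hX a).hodge η

theorem proj (hX : LPar k X) (p : ℕ) : LPar k (BF.app (proj p) X) := fun a => (hX a).proj p

end LPar

theorem HasPar.gMul {k : ℕ} {u : Alg n r} (hu : HasPar k u) (η : Fin (n + 2) → ℤˣ)
    (ξ : Fin (n + 2) → ℂ) : HasPar (k + 1) (gMul η ξ u) := by
  rw [BF.gMul, LinearMap.mulLeft_apply, add_comm]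
  exact (HasPar.sum fun μ _ => (hasPar_dx μ).smul _).mul hu

theorem IsForm.gMul {p : ℕ} {u : Alg n r} (hu : IsForm p u) (η : Fin (n + 2) → ℤˣ)
    (ξ : Fin (n + 2) → ℂ) : IsForm (p + 1) (gMul η ξ u) := by
  rw [BF.gMul, LinearMap.mulLeft_apply, add_comm]
  exact (IsForm.sum fun μ _ => (isForm_dx μ).smul _).mul hu

theorem LPar.gMul {k : ℕ} {X : LForm n r} (hX : LPar k X) (η : Fin (n + 2) → ℤˣ)
    (ξ : Fin (n + 2) → ℂ) : LPar (k + 1) (BF.app (gMul η ξ) X) := fun a => (hX a).gMul η ξ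

namespace LDeg

variable {p q : ℕ} {X Y : LForm n r}

theorem zero (p : ℕ) : LDeg p (0 : LForm n r) := fun _ => IsForm.zero p
theorem add (hX : LDeg p X) (hY : LDeg p Y) : LDeg p (X + Y) := fun a => (hX a).add (hY a)
theorem sub (hX : LDeg p X) (hY : LDeg p Y) : LDeg p (X - Y) := fun a => (hX a).sub (hY a)
theorem neg (hX : LDeg p X) : LDeg p (-X) := fun a => (hX a).neg
theorem smul (c : ℂ) (hX : LDeg p X) : LDeg p (c • X) := fun a => (hX a).smul c
theorem congr (hX : LDeg p X) (h : p = q) : LDeg q X := h ▸ hX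

theorem extd (hX : LDeg p X) : LDeg (p + 1) (app extd X) := fun a => (hX a).extd

theorem inner (hX : LDeg p X) (ξ : Fin (n + 2) → ℂ) : LDeg (p - 1) (app (inner ξ) X) :=
  fun a => (hX a).inner ξ

theorem lie (hX : LDeg p X) (ξ : Fin (n + 2) → ℂ) : LDeg p (app (lie ξ) X) :=
  fun a => (isVert_lie ξ).isForm (hX a)

theorem hodge (hX : LDeg p X) (η : Fin (n + 2) → ℤˣ) : LDeg (n + 2 - p) (app (hodge η) X) :=
  fun a => (hX a).hodge η

theorem gMul (hX : LDeg p X) (η : Fin (n + 2) → ℤˣ) (ξ : Fin (n + 2) → ℂ) :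
    LDeg (p + 1) (app (gMul η ξ) X) := fun a => (hX a).gMul η ξ

theorem proj (p : ℕ) (X : LForm n r) : LDeg p (app (proj p) X) := fun a => isForm_proj p (X a)

theorem proj_eq (hX : LDeg p X) : app (BF.proj p) X = X := funext fun a => (hX a).proj_eq

theorem proj_of_ne (hX : LDeg p X) (h : p ≠ q) : app (BF.proj q) X = 0 :=
  funext fun a => (hX a).proj_of_ne h

theorem eq_zero (hX : LDeg p X) (h : n + 2 < p) : X = 0 := funext fun a => (hX a).eq_zero h

end LDeg

theorem LPar.fld (F : Field n) : LPar F.par (fld F : LForm n r) := hasPar_fld F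

theorem LDeg.fld (F : Field n) : LDeg F.deg (fld F : LForm n r) := isForm_fld F

theorem sum_app_proj (X : LForm n r) : ∑ p ∈ Finset.range (n + 3), app (proj p) X = X := by
  funext a
  rw [Finset.sum_apply]
  exact sum_proj (X a)

/-! ### The trace form and its symmetry under Hodge duality -/

section Tr

variable (G : GaugeAlgebra r N)

/-- The trace form as a bilinear map. -/
def TrL : LForm n r →ₗ[ℂ] LForm n r →ₗ[ℂ] Alg n r :=
  LinearMap.mk₂ ℂ (Tr G) (fun X X' Y => by simp [Tr_eq, add_mul, Finset.sum_add_distrib])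
    (fun c X Y => by simp [Tr_eq, Finset.smul_sum, smul_mul_assoc])
    (fun X Y Y' => by simp [Tr_eq, mul_add, Finset.sum_add_distrib])
    (fun c X Y => by simp [Tr_eq, Finset.smul_sum, mul_smul_comm])

theorem Tr_sum_left {ι : Type*} (s : Finset ι) (X : ι → LForm n r) (Y : LForm n r) :
    Tr G (∑ i ∈ s, X i) Y = ∑ i ∈ s, Tr G (X i) Y :=
  (congrArg (fun f => f Y) (map_sum (TrL G) X s)).trans (LinearMap.sum_apply _ _ _)

theorem Tr_sum_right {ι : Type*} (s : Finset ι) (X : LForm n r) (Y : ι → LForm n r) :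
    Tr G X (∑ i ∈ s, Y i) = ∑ i ∈ s, Tr G X (Y i) := map_sum (TrL G X) Y s

theorem Tr_add_left (X X' Y : LForm n r) : Tr G (X + X') Y = Tr G X Y + Tr G X' Y :=
  LinearMap.map_add₂ (TrL G) X X' Y

theorem Tr_add_right (X Y Y' : LForm n r) : Tr G X (Y + Y') = Tr G X Y + Tr G X Y' :=
  map_add (TrL G X) Y Y'

theorem Tr_smul_left (c : ℂ) (X Y : LForm n r) : Tr G (c • X) Y = c • Tr G X Y :=
  LinearMap.map_smul₂ (TrL G) c X Y

theorem Tr_smul_right (c : ℂ) (X Y : LForm n r) : Tr G X (c • Y) = c • Tr G X Y :=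
  map_smul (TrL G X) c Y

theorem Tr_neg_right (X Y : LForm n r) : Tr G X (-Y) = - Tr G X Y := map_neg (TrL G X) Y

theorem Tr_sub_right (X Y Y' : LForm n r) : Tr G X (Y - Y') = Tr G X Y - Tr G X Y' :=
  map_sub (TrL G X) Y Y'

theorem Tr_zero_left (Y : LForm n r) : Tr G 0 Y = 0 := LinearMap.map_zero₂ (TrL G) Y

theorem Tr_zero_right (X : LForm n r) : Tr G X 0 = 0 := map_zero (TrL G X)

theorem IsForm.Tr {p q : ℕ} {X Y : LForm n r} (hX : LDeg p X) (hY : LDeg q Y) :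
    IsForm (p + q) (Tr G X Y) := by
  rw [Tr_eq]
  exact IsForm.sum fun a _ => (hX a).mul (hY a)

theorem Tr_comm {k l : ℕ} {X Y : LForm n r} (hX : LPar k X) (hY : LPar l Y) :
    Tr G X Y = (-1 : ℂ) ^ (k * l) • Tr G Y X := by
  rw [Tr_eq, Tr_eq, Finset.smul_sum]
  exact Finset.sum_congr rfl fun a _ => (hX a).mul_comm (hY a)

theorem IsGDer.Tr {e k : ℕ} {D : Module.End ℂ (Alg n r)} (hD : IsGDer e D) {X : LForm n r}
    (hX : LPar k X) (Y : LForm n r) :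
    D (Tr G X Y) = Tr G (app D X) Y + (-1 : ℂ) ^ (e * k) • Tr G X (app D Y) := by
  simp only [Tr_eq, map_sum, hD.leib_of_hasPar (hX _), Finset.sum_add_distrib, Finset.smul_sum,
    app_apply]

/-- Only equal multi-indices survive in dx^I dx^{Jᶜ} when I and J have the same cardinality. Both
sides then are sums over I of u_I v_I times the volume form, and the sign is the one of exchanging
the components and moving dx^I past one of them. -/
theorem mul_hodge_comm (η : Fin (n + 2) → ℤˣ) {i j p : ℕ} {u v : Alg n r} (hu : HasPar i u)
    (hv : HasPar j v) (hu' : IsForm p u) (hv' : IsForm p v) :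
    u * hodge η v = (-1 : ℂ) ^ (i * j + p) • (v * hodge η u) := by
  have key : ∀ {i j : ℕ} {u v : Alg n r}, HasPar i u → HasPar j v → IsForm p u → IsForm p v →
      u * hodge η v = ∑ I : {I : Finset (Fin (n + 2)) // I.card = p},
        ((-1 : ℂ) ^ (p * (j + p)) * hodgeC η I.1) •
          (coef I.1 u * coef I.1 v * (dxI I.1 * dxI I.1ᶜ)) := by
    intro i j u v hu hv hu' hv'
    conv_lhs => rw [← hu'.sum_coef, Finset.sum_mul]
    refine Finset.sum_congr rfl fun I _ => ?_
    conv_lhs => rw [← hv'.sum_coef, map_sum, Finset.mul_sum]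
    rw [Finset.sum_eq_single I]
    · rw [hodge_mul_dxI η (dxFree_coef _ _), mul_smul_comm, mul_assoc,
        ← mul_assoc (dxI I.1) (coef I.1 v), (hasPar_dxI I.1).mul_comm (hv.coef I.1), I.2]
      rw [smul_mul_assoc, mul_smul_comm, smul_smul, mul_comm (hodgeC η I.1)]
      simp only [mul_assoc]
    · intro J _ hJ
      have hd : ¬ Disjoint I.1 J.1ᶜ := by
        intro hd
        refine hJ (Subtype.ext (Finset.eq_of_subset_of_card_le ?_ (by rw [I.2, J.2])).symm)
        intro x hx
        by_contra hx'
        exact Finset.disjoint_left.1 hd hx (Finset.mem_compl.2 hx')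
      rw [hodge_mul_dxI η (dxFree_coef _ _), mul_smul_comm, mul_assoc,
        ← mul_assoc (dxI I.1) (coef J.1 v), (hasPar_dxI I.1).mul_comm (hv.coef J.1),
        smul_mul_assoc, mul_assoc (coef J.1 v), dxI_mul_dxI, if_neg hd]
      simp
    · simp
  rw [key hu hv hu' hv', key hv hu hv' hu', Finset.smul_sum]
  refine Finset.sum_congr rfl fun I _ => ?_
  rw [(hu.coef I.1).mul_comm (hv.coef I.1), smul_mul_assoc, smul_smul, smul_smul, I.2]
  congr 1
  rw [mul_right_comm, ← pow_add, ← mul_assoc, ← pow_add]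
  congr 1
  apply neg_one_pow_congr
  rcases Nat.mod_two_eq_zero_or_one i with hi | hi <;>
    rcases Nat.mod_two_eq_zero_or_one j with hj | hj <;>
    rcases Nat.mod_two_eq_zero_or_one p with hp | hp <;>
    simp [Nat.add_mod, Nat.mul_mod, hi, hj, hp]

theorem Tr_hodge_comm (η : Fin (n + 2) → ℤˣ) {i j p : ℕ} {X Y : LForm n r} (hX : LPar i X)
    (hY : LPar j Y) (hX' : LDeg p X) (hY' : LDeg p Y) :
    Tr G X (app (hodge η) Y) = (-1 : ℂ) ^ (i * j + p) • Tr G Y (app (hodge η) X) := by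
  rw [Tr_eq, Tr_eq, Finset.smul_sum]
  exact Finset.sum_congr rfl fun a _ => mul_hodge_comm η (hX a) (hY a) (hX' a) (hY' a)

end Tr

/-! ## Parities and degrees of the ladders and of the pyramids -/

/-- For k even the grading is g + (n-g-k), for k odd it is (-g-1) + (n-g-k), and both are n modulo
two. All antighosts thus share one parity and all multipliers the opposite one, which keeps the
later signs independent of the position. -/
theorem par_slot (s : Slot n) : (Field.Cbar s).par % 2 = n % 2 ∧ (Field.Pi s).par % 2 = (n + 1) % 2 := by
  obtain ⟨⟨k, g⟩, hk, hg⟩ := s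
  simp only at hk hg
  simp only [Field.par, Field.gh, Field.deg, gammaIdx]
  by_cases h : Even k
  · rw [if_pos h]
    rw [Nat.even_iff] at h
    omega
  · rw [if_neg h]
    rw [Nat.even_iff] at h
    omega

theorem LPar.CbarF (k g : ℕ) : LPar n (CbarF k g : LForm n r) := by
  rw [BF.CbarF]
  split_ifs with h
  · exact (LPar.fld _).congr (par_slot _).1
  · exact LPar.zero _

theorem LPar.PiF (k g : ℕ) : LPar (n + 1) (PiF k g : LForm n r) := by
  rw [BF.PiF]
  split_ifs with h
  · exact (LPar.fld _).congr (par_slot _).2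
  · exact LPar.zero _

theorem LDeg.CbarF (k g : ℕ) : LDeg (n - g - k) (CbarF k g : LForm n r) := by
  rw [BF.CbarF]
  split_ifs with h
  · exact LDeg.fld _
  · exact LDeg.zero _

theorem LDeg.PiF (k g : ℕ) : LDeg (n - g - k) (PiF k g : LForm n r) := by
  rw [BF.PiF]
  split_ifs with h
  · exact LDeg.fld _
  · exact LDeg.zero _

theorem LPar.B (g : Fin (n + 1)) : LPar n (BF.fld (.B g) : LForm n r) :=
  (LPar.fld _).congr (by simp only [Field.par, Field.gh, Field.deg]; omega)

theorem LPar.b (g : Fin (n + 1)) : LPar 1 (BF.fld (.b g) : LForm n r) :=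
  (LPar.fld _).congr (by simp only [Field.par, Field.gh, Field.deg]; omega)

theorem LPar.A : LPar 1 (BF.fld .A : LForm n r) := LPar.fld _

theorem LPar.c : LPar 1 (BF.fld .c : LForm n r) := LPar.fld _

theorem LPar.cbar : LPar 1 (BF.fld .cbar : LForm n r) := LPar.fld _

theorem LPar.pi : LPar 0 (BF.fld .pi : LForm n r) := LPar.fld _

theorem LPar.gamma : LPar n (BF.fld .gamma : LForm n r) :=
  (LPar.fld _).congr (by simp only [Field.par, Field.gh, Field.deg]; omega)

theorem LPar.tau : LPar n (BF.fld .tau : LForm n r) :=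
  (LPar.fld _).congr (by simp only [Field.par, Field.gh, Field.deg]; omega)

theorem LPar.bHat (η : Fin (n + 2) → ℤˣ) (g : Fin (n + 1)) : LPar 1 (bHat η g : LForm n r) :=
  (LPar.b g).add ((((LPar.CbarF 1 g).extd.hodge η).congr (by omega)).smul _)

theorem LPar.gammaHat (η : Fin (n + 2) → ℤˣ) : LPar n (gammaHat η : LForm n r) :=
  LPar.gamma.sub ((LPar.cbar.extd.hodge η).congr (by omega))

theorem LDeg.bHat (η : Fin (n + 2) → ℤˣ) (g : Fin (n + 1)) :
    LDeg (g + 2) (bHat η g : LForm n r) := by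
  refine (LDeg.fld (.b g)).add (LDeg.smul _ ?_)
  by_cases h : (g : ℕ) < n
  · exact ((LDeg.CbarF 1 g).extd.hodge η).congr (by change _ = (g : ℕ) + 2; omega)
  · rw [BF.CbarF, dif_neg (by omega), app_zero, app_zero]
    exact LDeg.zero _

theorem LDeg.gammaHat (η : Fin (n + 2) → ℤˣ) : LDeg (n + 1) (gammaHat η : LForm n r) :=
  (LDeg.fld .gamma).sub ((LDeg.fld .cbar).extd.hodge η)

theorem LPar.phi1 (η : Fin (n + 2) → ℤˣ) (p : ℕ) : LPar 1 (phi1 η p : LForm n r) := by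
  rcases p with _ | _ | p
  · exact LPar.c
  · exact LPar.A
  · rw [BF.phi1]
    split_ifs
    · exact LPar.bHat _ _
    · exact LPar.zero _

theorem LDeg.phi1 (η : Fin (n + 2) → ℤˣ) (p : ℕ) : LDeg p (phi1 η p : LForm n r) := by
  rcases p with _ | _ | p
  · exact LDeg.fld _
  · exact LDeg.fld _
  · rw [BF.phi1]
    split_ifs
    · exact LDeg.bHat _ _
    · exact LDeg.zero _

theorem LPar.phi2 (η : Fin (n + 2) → ℤˣ) (p : ℕ) : LPar n (phi2 η p : LForm n r) := by
  rw [BF.phi2]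
  split_ifs
  · exact LPar.B _
  · exact LPar.gammaHat _
  · exact LPar.tau
  · exact LPar.zero _

theorem LDeg.phi2 (η : Fin (n + 2) → ℤˣ) (p : ℕ) : LDeg p (phi2 η p : LForm n r) := by
  rw [BF.phi2]
  split_ifs with h1 h2 h3
  · exact (LDeg.fld _).congr (by simp only [Field.deg]; omega)
  · subst h2; exact LDeg.gammaHat _
  · subst h3; exact LDeg.fld _
  · exact LDeg.zero _

/-- The first ladder as an inhomogeneous form. -/
def Phi1 (η : Fin (n + 2) → ℤˣ) : LForm n r := ∑ p ∈ Finset.range (n + 3), phi1 η p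

/-- The second ladder as an inhomogeneous form. -/
def Phi2 (η : Fin (n + 2) → ℤˣ) : LForm n r := ∑ p ∈ Finset.range (n + 3), phi2 η p

theorem LPar.Phi1 (η : Fin (n + 2) → ℤˣ) : LPar 1 (Phi1 η : LForm n r) :=
  LPar.sum fun p _ => LPar.phi1 η p

theorem LPar.Phi2 (η : Fin (n + 2) → ℤˣ) : LPar n (Phi2 η : LForm n r) :=
  LPar.sum fun p _ => LPar.phi2 η p

theorem proj_sum_of_LDeg {X : ℕ → LForm n r} (hX : ∀ p, LDeg p (X p)) (q : ℕ) :
    app (proj q) (∑ p ∈ Finset.range (n + 3), X p) = X q := by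
  rw [app_sum]
  by_cases hq : q < n + 3
  · rw [Finset.sum_eq_single q]
    · exact (hX q).proj_eq
    · intro p _ hp
      exact (hX p).proj_of_ne hp
    · intro h; exact absurd (Finset.mem_range.2 hq) h
  · rw [(hX q).eq_zero (by omega)]
    refine Finset.sum_eq_zero fun p hp => (hX p).proj_of_ne ?_
    rw [Finset.mem_range] at hp
    omega

theorem proj_Phi1 (η : Fin (n + 2) → ℤˣ) (q : ℕ) :
    app (proj q) (Phi1 η : LForm n r) = phi1 η q := proj_sum_of_LDeg (LDeg.phi1 η) q

theorem proj_Phi2 (η : Fin (n + 2) → ℤˣ) (q : ℕ) :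
    app (proj q) (Phi2 η : LForm n r) = phi2 η q := proj_sum_of_LDeg (LDeg.phi2 η) q

/-- The inhomogeneous density whose top component is the truncated action. -/
def polyAction (G : GaugeAlgebra r N) (X Y : LForm n r) : Alg n r :=
  Tr G X (app extd Y) + (1 / 2 : ℂ) • Tr G (bracket G X X) Y

theorem proj_Tr_sum (G : GaugeAlgebra r N) {m : ℕ} (hm : m < n + 3) {X Y : ℕ → LForm n r}
    (hX : ∀ p, LDeg p (X p)) (hY : ∀ p, LDeg p (Y p)) :
    proj m (Tr G (∑ p ∈ Finset.range (n + 3), X p) (∑ p ∈ Finset.range (n + 3), Y p)) =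
      ∑ p ∈ Finset.range (m + 1), Tr G (X p) (Y (m - p)) := by
  rw [Tr_sum_left, map_sum,
    ← Finset.sum_subset (Finset.range_subset_range.2 (by omega : m + 1 ≤ n + 3))]
  · refine Finset.sum_congr rfl fun p hp => ?_
    rw [Finset.mem_range] at hp
    rw [Tr_sum_right, map_sum, Finset.sum_eq_single (m - p)]
    · have := IsForm.Tr G (hX p) (hY (m - p))
      rw [Nat.add_sub_cancel' (by omega)] at this
      exact this.proj_eq
    · intro q _ hq
      exact (IsForm.Tr G (hX p) (hY q)).proj_of_ne (by omega)
    · intro h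
      rw [Finset.mem_range] at h
      omega
  · intro p _ hp
    rw [Finset.mem_range] at hp
    rw [Tr_sum_right, map_sum]
    exact Finset.sum_eq_zero fun q _ => (IsForm.Tr G (hX p) (hY q)).proj_of_ne (by omega)

/-- This form of the action carries the whole argument: the ladders enter only through Φ₁ and Φ₂,
and the index constraints of the double sum become a projection on top degree. -/
theorem sigmaHat_eq (G : GaugeAlgebra r N) (η : Fin (n + 2) → ℤˣ) :
    sigmaHat G η = proj (n + 2) (polyAction G (Phi1 η) (Phi2 η)) := by
  rw [sigmaHat, polyAction, map_add, map_smul]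
  congr 1
  · have h1 : app extd (Phi2 η : LForm n r) = ∑ p ∈ Finset.range (n + 3),
        if p = 0 then 0 else app extd (phi2 η (p - 1)) := by
      rw [Phi2, app_sum, Finset.sum_range_succ, Finset.sum_range_succ' _ (n + 2),
        (LDeg.phi2 η (n + 2)).extd.eq_zero (by omega), add_zero, if_pos rfl, add_zero]
      exact Finset.sum_congr rfl fun p _ => by rw [if_neg (by omega), Nat.add_sub_cancel]
    rw [h1, Phi1, proj_Tr_sum G (by omega) (LDeg.phi1 η), Finset.sum_range_succ _ (n + 2)]
    · rw [Nat.sub_self, if_pos rfl, Tr_zero_right, add_zero]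
      refine Finset.sum_congr rfl fun p hp => ?_
      rw [Finset.mem_range] at hp
      rw [if_neg (by omega), show n + 2 - p - 1 = n + 1 - p by omega]
    · intro p
      split_ifs with hp
      · exact LDeg.zero _
      · exact (LDeg.phi2 η (p - 1)).extd.congr (by omega)
  · congr 1
    rw [Tr_bracket, Phi1, Tr_sum_left, map_sum]
    refine Finset.sum_congr rfl fun p hp => ?_
    rw [Finset.mem_range] at hp
    simp only [Tr_bracket]
    rw [Phi2, bracket_sum_left]
    simp only [bracket_sum_right, Tr_sum_right, map_sum]
    have hf : ∀ q s, IsForm (p + (q + s))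
        (Tr G (phi1 η p) (bracket G (phi1 η q) (phi2 η s)) : Alg n r) := fun q s =>
      IsForm.Tr G (LDeg.phi1 η p) ((LDeg.phi1 η q).bracket G (LDeg.phi2 η s))
    rw [← Finset.sum_subset (Finset.range_subset_range.2 (by omega : n + 3 - p ≤ n + 3))]
    · refine Finset.sum_congr rfl fun q hq => ?_
      rw [Finset.mem_range] at hq
      rw [Finset.sum_eq_single (n + 2 - p - q)]
      · have := hf q (n + 2 - p - q)
        rw [show p + (q + (n + 2 - p - q)) = n + 2 by omega] at this
        exact this.proj_eq.symm
      · intro s _ hs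
        exact (hf q s).proj_of_ne (by omega)
      · intro h
        rw [Finset.mem_range] at h
        omega
    · intro q _ hq
      rw [Finset.mem_range] at hq
      exact Finset.sum_eq_zero fun s _ => (hf q s).proj_of_ne (by omega)

/-! ## Functional derivatives -/

theorem isVert_pd_jet (F : Field n) (I) (a : Fin r) (α) :
    IsVert (gpar (.jet F I a α)) (pd (.jet F I a α) : Module.End ℂ (Alg n r)) where
  toIsGDer := isGDer_pd _
  dx μ := by rw [pd_gen, if_neg (by simp)]
  jet F' I' a' α' := by
    rw [pd_gen]
    split_ifs
    · exact map_one _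
    · exact map_zero _

open Classical in
/-- Commutation of jet derivatives with total derivatives. -/
theorem pd_jet_del (F : Field n) (I) (a : Fin r) (α) (μ : Fin (n + 2)) (u : Alg n r) :
    pd (.jet F I a α) (del μ u) = del μ (pd (.jet F I a α) u) +
      if 0 < α μ then pd (.jet F I a (α - Pi.single μ 1)) u else 0 := by
  have hv : IsVert (gpar (.jet F I a α)) (if 0 < α μ then pd (.jet F I a (α - Pi.single μ 1)) else 0 :
      Module.End ℂ (Alg n r)) := by
    split_ifs
    · exact (isVert_pd_jet F I a _).congr ((gpar_jet _ _ _ _).trans (gpar_jet _ _ _ _).symm)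
    · exact IsVert.zero
  have key : (del μ * pd (.jet F I a α) - pd (.jet F I a α) * del μ : Module.End ℂ (Alg n r)) =
      (-1 : ℂ) • (if 0 < α μ then pd (.jet F I a (α - Pi.single μ 1)) else 0) := by
    refine ((isVert_del μ).comm_even (isVert_pd_jet F I a α)).ext (hv.smul _)
      fun F' I' a' β => ?_
    have h0 : del μ (pd (.jet F I a α) (gen (.jet F' I' a' β)) : Alg n r) = 0 := by
      rw [pd_gen]
      split_ifs
      · exact (isVert_del μ).map_one
      · exact map_zero _
    rw [LinearMap.sub_apply, Module.End.mul_apply, Module.End.mul_apply, h0, zero_sub, del_jet,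
      LinearMap.smul_apply, alg_neg_smul, one_smul, neg_inj, pd_gen]
    by_cases hα : 0 < α μ
    · rw [if_pos hα, pd_gen]
      have h1 : α = β + Pi.single μ 1 ↔ α - Pi.single μ 1 = β := by
        constructor
        · rintro rfl; ext ν; simp
        · rintro rfl
          ext ν
          by_cases h : ν = μ
          · subst h; simp; omega
          · simp [h]
      have h2 : Gen.jet F I a α = Gen.jet F' I' a' (β + Pi.single μ 1) ↔
          Gen.jet F I a (α - Pi.single μ 1) = Gen.jet F' I' a' β := by
        simp only [Gen.jet.injEq, h1]
      simp only [h2]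
    · rw [if_neg hα, if_neg, LinearMap.zero_apply]
      intro h
      rw [Gen.jet.injEq] at h
      rw [h.2.2.2] at hα
      simp at hα
  have := LinearMap.congr_fun key u
  rw [LinearMap.sub_apply, LinearMap.smul_apply, alg_neg_smul, one_smul, Module.End.mul_apply,
    Module.End.mul_apply, sub_eq_iff_eq_add] at this
  rw [this]
  split_ifs
  · abel
  · simp

/-- Independence of the field `F` and of its derivatives. -/
def Indep (F : Field n) (u : Alg n r) : Prop := ∀ I a α, pd (.jet F I a α) u = 0

/-- Independence of the field `F` and of its derivatives. -/
def LIndep (F : Field n) (X : LForm n r) : Prop := ∀ I a α, app (pd (.jet F I a α)) X = 0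

theorem Indep.del {F : Field n} {u : Alg n r} (hu : Indep F u) (μ : Fin (n + 2)) :
    Indep F (del μ u) := fun I a α => by
  classical
  rw [pd_jet_del, hu, hu, map_zero, ite_self, add_zero]

theorem Indep.extd {F : Field n} {u : Alg n r} (hu : Indep F u) : Indep F (extd u) :=
    fun I a α => by
  rw [extd_apply, map_sum]
  refine Finset.sum_eq_zero fun μ _ => ?_
  rw [(isVert_pd_jet F I a α).leib, (isVert_pd_jet F I a α).dx, hu.del μ, zero_mul, mul_zero,
    add_zero]

namespace LIndep

variable {F : Field n} {X Y : LForm n r}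

theorem indep (hX : LIndep F X) (a : Fin r) : Indep F (X a) := fun I b α => congrFun (hX I b α) a

theorem zero (F : Field n) : LIndep F (0 : LForm n r) := fun _ _ _ => app_zero _

theorem add (hX : LIndep F X) (hY : LIndep F Y) : LIndep F (X + Y) := fun I a α => by
  rw [app_add, hX, hY, add_zero]

theorem sub (hX : LIndep F X) (hY : LIndep F Y) : LIndep F (X - Y) := fun I a α => by
  rw [app_sub, hX, hY, sub_zero]

theorem smul (c : ℂ) (hX : LIndep F X) : LIndep F (c • X) := fun I a α => by
  rw [app_smul, hX, smul_zero]

theorem sum {ι : Type*} {s : Finset ι} {X : ι → LForm n r} (h : ∀ i ∈ s, LIndep F (X i)) :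
    LIndep F (∑ i ∈ s, X i) := fun I a α => by
  rw [app_sum]
  exact Finset.sum_eq_zero fun i hi => h i hi I a α

theorem extd (hX : LIndep F X) : LIndep F (app extd X) := fun I a α =>
  funext fun b => (hX.indep b).extd I a α

theorem hodge (hX : LIndep F X) (η : Fin (n + 2) → ℤˣ) : LIndep F (app (hodge η) X) :=
  fun I a α => funext fun b => by
    rw [app_apply, app_apply, ← (isVert_pd_jet F I a α).hodge_apply, hX.indep, map_zero]
    rfl

theorem bracket (G : GaugeAlgebra r N) (hX : LIndep F X) {k : ℕ} (hX' : LPar k X)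
    (hY : LIndep F Y) : LIndep F (bracket G X Y) := fun I a α => by
  rw [app_bracket G (isGDer_pd _) hX', hX, hY, ← zero_smul ℂ (0 : LForm n r), bracket_smul_left,
    bracket_smul_right]
  simp

theorem Tr (G : GaugeAlgebra r N) (hX : LIndep F X) {k : ℕ} (hX' : LPar k X)
    (hY : LIndep F Y) : Indep F (Tr G X Y) := fun I a α => by
  rw [(isGDer_pd _).Tr G hX', hX, hY, Tr_zero_left, Tr_zero_right, smul_zero, add_zero]

end LIndep

open Classical in
theorem app_pd_fld (F F' : Field n) (I : {I : Finset (Fin (n + 2)) // I.card = F.deg})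
    (a : Fin r) (α) : app (pd (.jet F I a α)) (fld F') =
      if F = F' ∧ α = 0 then Pi.single a (dxI I.1) else 0 := by
  funext b
  rw [app_apply, fld, map_sum]
  simp only [(isVert_pd_jet F I a α).mul_dxI, pd_gen]
  split_ifs with h
  · obtain ⟨rfl, rfl⟩ := h
    by_cases hb : b = a
    · subst hb
      rw [Pi.single_eq_same, Finset.sum_eq_single I]
      · simp
      · intro J _ hJ
        rw [if_neg, zero_mul]
        intro h
        rw [Gen.jet.injEq] at h
        exact hJ (eq_of_heq h.2.1).symm
      · simp
    · rw [Pi.single_eq_of_ne hb]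
      refine Finset.sum_eq_zero fun J _ => ?_
      rw [if_neg, zero_mul]
      intro h
      rw [Gen.jet.injEq] at h
      exact hb h.2.2.1.symm
  · refine Finset.sum_eq_zero fun J _ => ?_
    rw [if_neg, zero_mul]
    intro h'
    rw [Gen.jet.injEq] at h'
    exact h ⟨h'.1, h'.2.2.2⟩

theorem LIndep.fld {F F' : Field n} (h : F ≠ F') : LIndep F (fld F' : LForm n r) :=
  fun I a α => by
    classical
    rw [app_pd_fld, if_neg fun h' => h h'.1]

open Classical in
/-- The dependence of `X` on `F` is the one of `F` itself. -/
def Dep (F : Field n) (X : LForm n r) : Prop :=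
  ∀ I a α, app (pd (.jet F I a α)) X = if α = 0 then Pi.single a (dxI I.1) else 0

theorem Dep.fld (F : Field n) : Dep F (fld F : LForm n r) := fun I a α => by
  rw [app_pd_fld]; simp

theorem Dep.add {F : Field n} {X Y : LForm n r} (hX : Dep F X) (hY : LIndep F Y) :
    Dep F (X + Y) := fun I a α => by rw [app_add, hX, hY, add_zero]

theorem Dep.sub {F : Field n} {X Y : LForm n r} (hX : Dep F X) (hY : LIndep F Y) :
    Dep F (X - Y) := fun I a α => by rw [app_sub, hX, hY, sub_zero]

theorem Dep.sum {F : Field n} {X : ℕ → LForm n r} {m M : ℕ} (hm : m < M) (hX : Dep F (X m))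
    (hY : ∀ p, p ≠ m → LIndep F (X p)) : Dep F (∑ p ∈ Finset.range M, X p) := fun I a α => by
  rw [app_sum, Finset.sum_eq_single m]
  · exact hX I a α
  · intro p _ hp
    exact hY p hp I a α
  · intro h; exact absurd (Finset.mem_range.2 hm) h

open Classical in
theorem Dep.del {F : Field n} {X : LForm n r} (hX : Dep F X) (μ : Fin (n + 2)) (I) (a : Fin r)
    (α) (b : Fin r) : pd (.jet F I a α) (del μ (X b)) =
      if α = Pi.single μ 1 then Pi.single (M := fun _ => Alg n r) a (dxI I.1) b else 0 := by
  have h : ∀ α, pd (.jet F I a α) (X b) =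
      if α = 0 then Pi.single (M := fun _ => Alg n r) a (dxI I.1) b else 0 := by
    intro α
    have := congrFun (hX I a α) b
    rw [app_apply] at this
    rw [this]
    split_ifs <;> rfl
  have h0 : BF.del μ (Pi.single (M := fun _ => Alg n r) a (dxI I.1) b) = 0 := by
    by_cases hb : b = a
    · subst hb; rw [Pi.single_eq_same, (isVert_del μ).dxI]
    · rw [Pi.single_eq_of_ne hb, map_zero]
  have h1 : BF.del μ (pd (.jet F I a α) (X b)) = 0 := by
    rw [h]
    split_ifs
    · exact h0
    · exact map_zero _
  rw [pd_jet_del, h1, zero_add, h]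
  by_cases hα : α = Pi.single μ 1
  · subst hα; simp
  · rw [if_neg hα]
    split_ifs with h2 h3
    · exfalso
      apply hα
      ext ν
      have := congrFun h3 ν
      by_cases hν : ν = μ
      · subst hν; simp at this ⊢; omega
      · simp [hν] at this ⊢; exact this
    · rfl
    · rfl

open Classical in
theorem Dep.extd {F : Field n} {X : LForm n r} (hX : Dep F X) (I) (a : Fin r) (α) (b : Fin r) :
    pd (.jet F I a α) (extd (X b)) = (-1 : ℂ) ^ gpar (.jet F I a α) • ∑ μ, if α = Pi.single μ 1 then
      gen (.dx μ) * Pi.single (M := fun _ => Alg n r) a (dxI I.1) b else 0 := by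
  rw [extd_apply, map_sum, Finset.smul_sum]
  refine Finset.sum_congr rfl fun μ _ => ?_
  rw [(isVert_pd_jet F I a α).leib, (isVert_pd_jet F I a α).dx, zero_mul, zero_add,
    (hasPar_dx μ).sg_eq, mul_one, hX.del, smul_mul_assoc, mul_ite, mul_zero]

theorem deg_le (F : Field n) : F.deg ≤ n + 2 := by
  rcases F with _ | _ | g | _ | _ | s | s | _ | _ | g <;> simp only [Field.deg] <;> omega

theorem delIter_single (μ : Fin (n + 2)) :
    (delIter (Pi.single μ 1) : Module.End ℂ (Alg n r)) = del μ := by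
  have := delIter_add_single (n := n) (r := r) 0 μ
  rwa [zero_add, delIter_zero, mul_one] at this

open Classical in
/-- Euler operator of a density of first order. -/
theorem euler_eq {F : Field n} {I} {a : Fin r} {L U : Alg n r} {V : Fin (n + 2) → Alg n r}
    (h : ∀ α, pd (.jet F I a α) L =
      (if α = 0 then U else 0) + ∑ μ, if α = Pi.single μ 1 then V μ else 0) :
    euler F I a L = U - ∑ μ, del μ (V μ) := by
  have hs : ∀ μ : Fin (n + 2), (Pi.single μ 1 : Fin (n + 2) → ℕ) ≠ 0 := by
    intro μ h
    have := congrFun h μ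
    simp at this
  have hinj : Function.Injective fun μ : Fin (n + 2) => (Pi.single μ 1 : Fin (n + 2) → ℕ) := by
    intro μ ν h
    by_contra hne
    have := congrFun h μ
    simp [hne] at this
  rw [euler, finsum_eq_sum_of_support_subset
    (s := insert 0 (Finset.univ.image fun μ : Fin (n + 2) => (Pi.single μ 1 : Fin (n + 2) → ℕ)))]
  · rw [Finset.sum_insert (by simp),
      Finset.sum_image (fun μ _ ν _ h => hinj h), sub_eq_add_neg, ← Finset.sum_neg_distrib]
    congr 1
    · rw [h, if_pos rfl, Finset.sum_eq_zero fun μ _ => if_neg (hs μ).symm, delIter_zero]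
      simp
    · refine Finset.sum_congr rfl fun μ _ => ?_
      have hsum : (∑ ν : Fin (n + 2),
          if (Pi.single μ 1 : Fin (n + 2) → ℕ) = Pi.single ν 1 then V ν else 0) = V μ := by
        rw [Finset.sum_eq_single μ, if_pos rfl]
        · intro ν _ hν
          exact if_neg fun h => hν (hinj h).symm
        · simp
      rw [h, if_neg (hs μ), zero_add, hsum, delIter_single]
      simp [alg_neg_smul]
  · intro α hα
    rw [Function.mem_support] at hα
    by_contra hc
    apply hα
    simp only [Finset.coe_insert, Finset.coe_image, Finset.coe_univ, Set.image_univ,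
      Set.mem_insert_iff, Set.mem_range, not_or, not_exists] at hc
    rw [h, if_neg hc.1, Finset.sum_eq_zero fun μ _ => if_neg fun h => hc.2 μ h.symm]
    simp

open Classical in
-- If δL = δφ U + X d(δφ) for a first-order density, partial integration turns X d(δφ) into δφ dX,
-- with no sign as X is odd. Contracting the top component of dx^I(…) with I and summing over I
-- recovers the component of complementary degree.
theorem fder_eq {F : Field n} {L : Alg n r} {U X : LForm n r} (hX : LPar 1 X)
    (h : ∀ I a α, pd (.jet F I a α) L = (if α = 0 then proj (n + 2) (dxI I.1 * U a) else 0) +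
      ∑ μ, if α = Pi.single μ 1 then proj (n + 2) (X a * (gen (.dx μ) * dxI I.1)) else 0) :
    fder L F = app (proj (n + 2 - F.deg)) (app extd X + U) := by
  funext a
  rw [fder, app_apply, ← sum_contr_dxI_mul (deg_le F)]
  refine Finset.sum_congr rfl fun I _ => ?_
  rw [euler_eq (h I a)]
  simp only [← (isVert_del _).proj_apply, ← map_sum, ← map_sub]
  congr 2
  have key : ∑ μ, del μ (X a * (gen (.dx μ) * dxI I.1)) = - (dxI I.1 * app extd X a) := by
    rw [(hasPar_dxI I.1).mul_comm (hX.extd a), app_apply, extd_apply, Finset.sum_mul,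
      neg_one_pow_congr (l := 0) (by omega), pow_zero, one_smul, ← Finset.sum_neg_distrib]
    refine Finset.sum_congr rfl fun μ _ => ?_
    have hd : HasPar 1 (del μ (X a)) := (isVert_del μ).hasPar (hX a)
    rw [(isVert_del μ).leib, (isVert_del μ).leib, (isVert_del μ).dx, (isVert_del μ).dxI, mul_zero,
      zero_mul, add_zero, mul_zero, add_zero, (hasPar_dx μ).mul_comm hd, smul_mul_assoc, mul_assoc]
    simp [alg_neg_smul]
  rw [key, Pi.add_apply, mul_add]
  abel

theorem sum_single_mul (a : Fin r) (u : Alg n r) (Z : LForm n r) :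
    ∑ b, Pi.single (M := fun _ => Alg n r) a u b * Z b = u * Z a := by
  rw [Finset.sum_eq_single a]
  · rw [Pi.single_eq_same]
  · intro b _ hb
    rw [Pi.single_eq_of_ne hb, zero_mul]
  · simp

theorem sum_mul_single (a : Fin r) (u : Alg n r) (Z : LForm n r) :
    ∑ b, Z b * Pi.single (M := fun _ => Alg n r) a u b = Z a * u := by
  rw [Finset.sum_eq_single a]
  · rw [Pi.single_eq_same]
  · intro b _ hb
    rw [Pi.single_eq_of_ne hb, mul_zero]
  · simp

theorem LPar.app_pd_jet {k : ℕ} {X : LForm n r} (hX : LPar k X) (x : Gen n r) :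
    LPar (k + gpar x) (BF.app (pd x) X) := hX.app (isGDer_pd x)

open Classical in
-- Φ₁ enters undifferentiated, so no partial integration is needed. Its two occurrences in ½[Φ₁,Φ₁]
-- contribute equally, which gives dΦ₂ + [Φ₁,Φ₂]. The term R stands for the gauge fixing and
-- contributes Z.
theorem fder_of_dep_left (G : GaugeAlgebra r N) {F : Field n} {X Y Z : LForm n r} {R : Alg n r}
    (hX : LPar 1 X) (hdX : Dep F X) (hY : LIndep F Y) (hZ : LDeg (n + 2 - F.deg) Z)
    (hR : ∀ I a α, pd (.jet F I a α) R = if α = 0 then dxI I.1 * Z a else 0) :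
    fder (proj (n + 2) (polyAction G X Y) + R) F =
      app (proj (n + 2 - F.deg)) (app extd Y + bracket G X Y) + Z := by
  have hZ' := hZ.proj_eq
  conv_rhs => rw [← hZ']
  rw [← app_add, ← zero_add (app extd Y + bracket G X Y + Z), ← app_zero extd]
  refine fder_eq (LPar.zero 1) fun I a α => ?_
  have hv := isVert_pd_jet F I a α
  have hR' : pd (.jet F I a α) R = proj (n + 2) (if α = 0 then dxI I.1 * Z a else 0) := by
    rw [hR]
    split_ifs
    · have := (isForm_dxI I.1).mul (hZ a)
      rw [I.2, Nat.add_sub_cancel' (deg_le F)] at this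
      exact this.proj_eq.symm
    · exact (map_zero _).symm
  have hB : app (pd (.jet F I a α)) (bracket G X X) =
      (2 : ℂ) • bracket G (app (pd (.jet F I a α)) X) X := by
    rw [app_bracket G hv.toIsGDer hX, bracket_comm G hX (hX.app_pd_jet (.jet F I a α)), smul_smul,
      ← pow_add, neg_one_pow_congr (l := 0) (by omega), pow_zero]
    module
  have hmain : pd (.jet F I a α) (polyAction G X Y) =
      if α = 0 then dxI I.1 * (app extd Y + bracket G X Y) a else 0 := by
    rw [polyAction, map_add, map_smul, hv.toIsGDer.Tr G hX, hv.toIsGDer.Tr G (hX.bracket G hX),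
      hY.extd, hY, Tr_zero_right, Tr_zero_right, smul_zero, smul_zero, add_zero, add_zero, hB,
      Tr_smul_left, smul_smul, Tr_bracket, ← Tr_smul_right, ← Tr_add_right, Tr_eq, hdX]
    norm_num
    split_ifs
    · exact sum_single_mul _ _ _
    · simp
  rw [map_add, ← hv.proj_apply, hmain, hR', ← map_add]
  split_ifs
  · simp [mul_add, add_assoc]
  · simp

open Classical in
-- Here the varied field sits under d, and partial integration moves the derivative to Φ₁; together
-- with the undifferentiated term this is the curvature of Φ₁.
theorem fder_of_dep_right (G : GaugeAlgebra r N) {F : Field n} {X Y Z : LForm n r} {R : Alg n r}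
    (hX : LPar 1 X) (hiX : LIndep F X) (hY : Dep F Y) (hZ : LDeg (n + 2 - F.deg) Z)
    (hR : ∀ I a α, pd (.jet F I a α) R = if α = 0 then dxI I.1 * Z a else 0) :
    fder (proj (n + 2) (polyAction G X Y) + R) F =
      app (proj (n + 2 - F.deg)) (app extd X + (1 / 2 : ℂ) • bracket G X X) + Z := by
  have hZ' := hZ.proj_eq
  conv_rhs => rw [← hZ']
  rw [← app_add, add_assoc]
  refine fder_eq hX fun I a α => ?_
  have hv := isVert_pd_jet F I a α
  have hR' : pd (.jet F I a α) R = proj (n + 2) (if α = 0 then dxI I.1 * Z a else 0) := by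
    rw [hR]
    split_ifs
    · have := (isForm_dxI I.1).mul (hZ a)
      rw [I.2, Nat.add_sub_cancel' (deg_le F)] at this
      exact this.proj_eq.symm
    · exact (map_zero _).symm
  have h1 : pd (.jet F I a α) (Tr G X (app extd Y)) =
      ∑ μ, if α = Pi.single μ 1 then X a * (gen (.dx μ) * dxI I.1) else 0 := by
    rw [hv.toIsGDer.Tr G hX, hiX, Tr_zero_left, zero_add, Tr_eq]
    simp only [app_apply, hY.extd, mul_smul_comm, ← Finset.smul_sum, smul_smul, mul_one,
      neg_one_pow_add_self, one_smul]
    simp only [Finset.mul_sum]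
    rw [Finset.sum_comm]
    refine Finset.sum_congr rfl fun μ _ => ?_
    split_ifs
    · have := sum_mul_single a (dxI I.1) (fun b => X b * gen (.dx μ))
      simp only [mul_assoc] at this
      exact this
    · simp
  have h2 : pd (.jet F I a α) (Tr G (bracket G X X) Y) =
      if α = 0 then dxI I.1 * bracket G X X a else 0 := by
    rw [hv.toIsGDer.Tr G (hX.bracket G hX), hiX.bracket G hX hiX, Tr_zero_left, zero_add,
      neg_one_pow_congr (l := 0) (by omega), pow_zero, one_smul, Tr_eq, hY]
    split_ifs
    · rw [sum_mul_single, (hX.bracket G hX a).mul_comm (hasPar_dxI I.1),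
        neg_one_pow_congr (l := 0) (by omega), pow_zero, one_smul]
    · simp
  rw [map_add, ← hv.proj_apply, hR', polyAction, map_add, map_smul, h1, h2, ← map_add]
  simp only [apply_ite (proj (n + 2)), map_add, map_zero, map_sum, map_smul]
  split_ifs
  · simp [mul_add, mul_smul_comm]
    abel
  · simp

/-! ## Functional derivatives of the action -/

theorem LIndep.CbarF {F : Field n} (h : ∀ s, F ≠ .Cbar s) (k g : ℕ) :
    LIndep F (CbarF k g : LForm n r) := by
  rw [BF.CbarF]
  split_ifs
  · exact LIndep.fld (h _)
  · exact LIndep.zero _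

theorem LIndep.PiF {F : Field n} (h : ∀ s, F ≠ .Pi s) (k g : ℕ) :
    LIndep F (PiF k g : LForm n r) := by
  rw [BF.PiF]
  split_ifs
  · exact LIndep.fld (h _)
  · exact LIndep.zero _

theorem LIndep.phi1 {F : Field n} (η : Fin (n + 2) → ℤˣ) (hC : ∀ s, F ≠ .Cbar s) (p : ℕ)
    (h0 : p = 0 → F ≠ .c) (h1 : p = 1 → F ≠ .A) (h2 : ∀ g : Fin (n + 1), p = (g : ℕ) + 2 → F ≠ .b g) :
    LIndep F (phi1 η p : LForm n r) := by
  rcases p with _ | _ | p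
  · exact LIndep.fld (h0 rfl)
  · exact LIndep.fld (h1 rfl)
  · rw [BF.phi1]
    split_ifs with h
    · exact (LIndep.fld (h2 ⟨p, h⟩ rfl)).add (((LIndep.CbarF hC _ _).extd.hodge η).smul _)
    · exact LIndep.zero _

theorem LIndep.phi2 {F : Field n} (η : Fin (n + 2) → ℤˣ) (hC : F ≠ .cbar) (p : ℕ)
    (h0 : p = n + 2 → F ≠ .tau) (h1 : p = n + 1 → F ≠ .gamma)
    (h2 : ∀ g : Fin (n + 1), p + g = n → F ≠ .B g) : LIndep F (phi2 η p : LForm n r) := by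
  rw [BF.phi2]
  split_ifs with h h' h''
  · exact LIndep.fld (h2 _ (by simp only; omega))
  · exact (LIndep.fld (h1 h')).sub ((LIndep.fld hC).extd.hodge η)
  · exact LIndep.fld (h0 h'')
  · exact LIndep.zero _

theorem LIndep.Phi1 {F : Field n} (η : Fin (n + 2) → ℤˣ) (hC : ∀ s, F ≠ .Cbar s) (h0 : F ≠ .c)
    (h1 : F ≠ .A) (h2 : ∀ g, F ≠ .b g) : LIndep F (Phi1 η : LForm n r) :=
  LIndep.sum fun p _ => LIndep.phi1 η hC p (fun _ => h0) (fun _ => h1) fun g _ => h2 g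

theorem LIndep.Phi2 {F : Field n} (η : Fin (n + 2) → ℤˣ) (hC : F ≠ .cbar) (h0 : F ≠ .tau)
    (h1 : F ≠ .gamma) (h2 : ∀ g, F ≠ .B g) : LIndep F (Phi2 η : LForm n r) :=
  LIndep.sum fun p _ => LIndep.phi2 η hC p (fun _ => h0) (fun _ => h1) fun g _ => h2 g

theorem dep_Phi1_c (η : Fin (n + 2) → ℤˣ) : Dep .c (Phi1 η : LForm n r) :=
  Dep.sum (by omega : 0 < n + 3) (Dep.fld _) fun p hp =>
    LIndep.phi1 η (by simp) p (fun h => absurd h hp) (by simp) (by simp)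

theorem dep_Phi1_A (η : Fin (n + 2) → ℤˣ) : Dep .A (Phi1 η : LForm n r) :=
  Dep.sum (by omega : 1 < n + 3) (Dep.fld _) fun p hp =>
    LIndep.phi1 η (by simp) p (by simp) (fun h => absurd h hp) (by simp)

theorem phi1_b (η : Fin (n + 2) → ℤˣ) (g : Fin (n + 1)) :
    (phi1 η ((g : ℕ) + 2) : LForm n r) = bHat η g := by
  rw [phi1, dif_pos g.2]

theorem phi2_B (η : Fin (n + 2) → ℤˣ) (g : Fin (n + 1)) :
    (phi2 η (n - (g : ℕ)) : LForm n r) = fld (.B g) := by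
  rw [phi2, if_pos (Nat.sub_le _ _)]
  congr 2
  ext
  simp only
  omega

theorem phi2_gamma (η : Fin (n + 2) → ℤˣ) : (phi2 η (n + 1) : LForm n r) = gammaHat η := by
  rw [phi2, if_neg (by omega), if_pos rfl]

theorem phi2_tau (η : Fin (n + 2) → ℤˣ) : (phi2 η (n + 2) : LForm n r) = fld .tau := by
  rw [phi2, if_neg (by omega), if_neg (by omega), if_pos rfl]

theorem dep_Phi1_b (η : Fin (n + 2) → ℤˣ) (g : Fin (n + 1)) :
    Dep (.b g) (Phi1 η : LForm n r) := by
  refine Dep.sum (by omega : (g : ℕ) + 2 < n + 3) ?_ fun p hp =>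
    LIndep.phi1 η (by simp) p (by simp) (by simp) fun g' h h' => ?_
  · rw [phi1_b]
    exact (Dep.fld _).add (((LIndep.CbarF (by simp) _ _).extd.hodge η).smul _)
  · rw [Field.b.injEq] at h'
    exact hp (h'.symm ▸ h)

theorem dep_Phi2_B (η : Fin (n + 2) → ℤˣ) (g : Fin (n + 1)) :
    Dep (.B g) (Phi2 η : LForm n r) := by
  refine Dep.sum (by omega : n - (g : ℕ) < n + 3) ?_ fun p hp =>
    LIndep.phi2 η (by simp) p (by simp) (by simp) fun g' h h' => ?_
  · rw [phi2_B]
    exact Dep.fld _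
  · rw [Field.B.injEq] at h'
    subst h'
    omega

theorem dep_Phi2_gamma (η : Fin (n + 2) → ℤˣ) : Dep .gamma (Phi2 η : LForm n r) := by
  refine Dep.sum (by omega : n + 1 < n + 3) ?_ fun p hp =>
    LIndep.phi2 η (by simp) p (by simp) (fun h => absurd h hp) (by simp)
  rw [phi2_gamma]
  exact (Dep.fld _).sub ((LIndep.fld (by simp)).extd.hodge η)

theorem dep_Phi2_tau (η : Fin (n + 2) → ℤˣ) : Dep .tau (Phi2 η : LForm n r) := by
  refine Dep.sum (by omega : n + 2 < n + 3) ?_ fun p hp =>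
    LIndep.phi2 η (by simp) p (fun h => absurd h hp) (by simp) (by simp)
  rw [phi2_tau]
  exact Dep.fld _

/-- The variation of the gauge fixing part with respect to the gauge fields. -/
theorem pd_sigmaPi (G : GaugeAlgebra r N) (η : Fin (n + 2) → ℤˣ) (x : ℕ → ℕ → ℂ) {F : Field n}
    (hpi : F ≠ .pi) (hC : ∀ s, F ≠ .Cbar s) (hP : ∀ s, F ≠ .Pi s) (I) (a : Fin r) (α) :
    pd (.jet F I a α) (sigmaPi G η x) =
      - Tr G (app (pd (.jet F I a α)) (fld .A)) (app (hodge η) (app extd (fld .pi)))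
      - ∑ g : Fin n, (-1 : ℂ) ^ (g : ℕ) • Tr G (app (pd (.jet F I a α)) (fld (.B g.castSucc)))
          (app (hodge η) (app extd (PiF 1 g))) := by
  have hv := isVert_pd_jet F I a α
  -- Symmetry of the Hodge pairing moves the varied field to the left, where it can be stripped off
  -- by the left derivative.
  have h1 : Tr G (app extd (fld .pi)) (app (hodge η) (fld .A : LForm n r)) =
      Tr G (fld .A) (app (hodge η) (app extd (fld .pi))) := by
    rw [Tr_hodge_comm G η LPar.pi.extd LPar.A (LDeg.fld .pi).extd (LDeg.fld .A)]
    simp [Field.deg]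
  have h2 : ∀ g : Fin n, Tr G (app extd (PiF 1 g)) (app (hodge η) (fld (.B g.castSucc) : LForm n r)) =
      (-1 : ℂ) ^ (g : ℕ) • Tr G (fld (.B g.castSucc)) (app (hodge η) (app extd (PiF 1 g))) := by
    intro g
    have hd : LDeg (n - (g : ℕ)) (app extd (PiF 1 g) : LForm n r) :=
      (LDeg.PiF 1 g).extd.congr (by omega)
    rw [Tr_hodge_comm G η (LPar.PiF 1 g).extd (LPar.B _) hd (LDeg.fld (.B g.castSucc))]
    congr 1
    apply neg_one_pow_congr
    have : (g : ℕ) ≤ n := g.2.le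
    rcases Nat.mod_two_eq_zero_or_one n with hn | hn
    · have : ((n + 1 + 1) * n) % 2 = 0 := by simp [Nat.mul_mod, hn]
      omega
    · have : ((n + 1 + 1) * n) % 2 = 1 := by simp [Nat.mul_mod, Nat.add_mod, hn]
      omega
  have hz1 : ∀ k g, pd (.jet F I a α) (Tr G (app extd (PiF k g)) (app (hodge η) (CbarF (k - 1) g))) = 0 :=
    fun k g => (LIndep.PiF hP k g).extd.Tr G (LPar.PiF k g).extd ((LIndep.CbarF hC _ _).hodge η) I a α
  have hz2 : ∀ k g, pd (.jet F I a α) (Tr G (app extd (CbarF k g)) (app (hodge η) (PiF (k - 1) g))) = 0 :=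
    fun k g => (LIndep.CbarF hC k g).extd.Tr G (LPar.CbarF k g).extd ((LIndep.PiF hP _ _).hodge η) I a α
  have hz3 : ∀ k g, pd (.jet F I a α) (Tr G (PiF k g) (app (hodge η) (PiF (k + 1) (g - 1)))) = 0 :=
    fun k g => (LIndep.PiF hP k g).Tr G (LPar.PiF k g) ((LIndep.PiF hP _ _).hodge η) I a α
  rw [sigmaPi, map_add, map_add, map_sub, map_neg, h1]
  simp only [map_sum, map_add, map_neg, map_smul, hz1, hz2, hz3, h2, smul_zero, neg_zero, add_zero,
    Finset.sum_const_zero]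
  rw [hv.toIsGDer.Tr G LPar.A, (LIndep.fld hpi).extd.hodge η, Tr_zero_right, smul_zero, add_zero]
  congr 1
  refine Finset.sum_congr rfl fun g _ => ?_
  rw [hv.toIsGDer.Tr G (LPar.B _), (LIndep.PiF hP 1 g).extd.hodge η, Tr_zero_right, smul_zero,
    add_zero]

/-- The curvature of the first ladder. -/
def Curv1 (G : GaugeAlgebra r N) (η : Fin (n + 2) → ℤˣ) : LForm n r :=
  app extd (Phi1 η) + (1 / 2 : ℂ) • bracket G (Phi1 η) (Phi1 η)

/-- The covariant derivative of the second ladder. -/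
def Curv2 (G : GaugeAlgebra r N) (η : Fin (n + 2) → ℤˣ) : LForm n r :=
  app extd (Phi2 η) + bracket G (Phi1 η) (Phi2 η)

theorem LPar.Curv1 (G : GaugeAlgebra r N) (η : Fin (n + 2) → ℤˣ) :
    LPar 2 (Curv1 G η : LForm n r) :=
  (LPar.Phi1 η).extd.add (((LPar.Phi1 η).bracket G (LPar.Phi1 η)).smul _)

theorem LPar.Curv2 (G : GaugeAlgebra r N) (η : Fin (n + 2) → ℤˣ) :
    LPar (n + 1) (Curv2 G η : LForm n r) :=
  (LPar.Phi2 η).extd.add (((LPar.Phi1 η).bracket G (LPar.Phi2 η)).congr (by omega))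

section fder

variable (G : GaugeAlgebra r N) (η : Fin (n + 2) → ℤˣ) (x : ℕ → ℕ → ℂ)

theorem pd_sigmaPi_eq_zero {F : Field n} (hA : F ≠ .A) (hB : ∀ g, F ≠ .B g) (hpi : F ≠ .pi)
    (hC : ∀ s, F ≠ .Cbar s) (hP : ∀ s, F ≠ .Pi s) (I) (a : Fin r) (α) :
    pd (.jet F I a α) (sigmaPi G η x) = 0 := by
  rw [pd_sigmaPi G η x hpi hC hP, LIndep.fld hA, Tr_zero_left, neg_zero, zero_sub, neg_eq_zero]
  refine Finset.sum_eq_zero fun g _ => ?_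
  rw [LIndep.fld (hB _), Tr_zero_left, smul_zero]

theorem fder_c : fder (sigma G η x) .c = app (proj (n + 2)) (Curv2 G η) := by
  rw [sigma, sigmaHat_eq, fder_of_dep_left G (LPar.Phi1 η) (dep_Phi1_c η)
    (LIndep.Phi2 η (by simp) (by simp) (by simp) (by simp)) (LDeg.zero _), add_zero]
  · rfl
  · intro I a α
    rw [pd_sigmaPi_eq_zero G η x (by simp) (by simp) (by simp) (by simp) (by simp)]
    simp

theorem fder_A : fder (sigma G η x) .A =
    app (proj (n + 1)) (Curv2 G η) - app (hodge η) (app extd (fld .pi)) := by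
  rw [sigma, sigmaHat_eq, fder_of_dep_left G (LPar.Phi1 η) (dep_Phi1_A η)
    (LIndep.Phi2 η (by simp) (by simp) (by simp) (by simp)) (LDeg.fld .pi |>.extd.hodge η |>.neg)]
  · rw [sub_eq_add_neg]
    rfl
  · intro I a α
    rw [pd_sigmaPi G η x (by simp) (by simp) (by simp), Finset.sum_eq_zero, sub_zero, app_pd_fld]
    · split_ifs with h1 h2 h2
      · rw [Tr_eq, sum_single_mul, Pi.neg_apply, alg_mul_neg]
      · exact absurd h1.2 h2
      · exact absurd ⟨rfl, h2⟩ h1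
      · rw [Tr_zero_left, neg_zero]
    · intro g _
      rw [LIndep.fld (by simp), Tr_zero_left, smul_zero]

theorem fder_b (g : Fin (n + 1)) :
    fder (sigma G η x) (.b g) = app (proj (n - (g : ℕ))) (Curv2 G η) := by
  have hd : n + 2 - (Field.b g).deg = n - (g : ℕ) := by
    change n + 2 - ((g : ℕ) + 2) = _
    omega
  rw [sigma, sigmaHat_eq, fder_of_dep_left G (LPar.Phi1 η) (dep_Phi1_b η g)
    (LIndep.Phi2 η (by simp) (by simp) (by simp) (by simp)) (LDeg.zero _), add_zero, hd]
  · rfl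
  · intro I a α
    rw [pd_sigmaPi_eq_zero G η x (by simp) (by simp) (by simp) (by simp) (by simp)]
    simp

theorem fder_gamma : fder (sigma G η x) .gamma = app (proj 1) (Curv1 G η) := by
  have hd : n + 2 - (Field.gamma : Field n).deg = 1 := by
    change n + 2 - (n + 1) = _
    omega
  rw [sigma, sigmaHat_eq, fder_of_dep_right G (LPar.Phi1 η)
    (LIndep.Phi1 η (by simp) (by simp) (by simp) (by simp)) (dep_Phi2_gamma η) (LDeg.zero _),
    add_zero, hd]
  · rfl
  · intro I a α
    rw [pd_sigmaPi_eq_zero G η x (by simp) (by simp) (by simp) (by simp) (by simp)]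
    simp

theorem fder_tau : fder (sigma G η x) .tau = app (proj 0) (Curv1 G η) := by
  have hd : n + 2 - (Field.tau : Field n).deg = 0 := by
    change n + 2 - (n + 2) = _
    omega
  rw [sigma, sigmaHat_eq, fder_of_dep_right G (LPar.Phi1 η)
    (LIndep.Phi1 η (by simp) (by simp) (by simp) (by simp)) (dep_Phi2_tau η) (LDeg.zero _),
    add_zero, hd]
  · rfl
  · intro I a α
    rw [pd_sigmaPi_eq_zero G η x (by simp) (by simp) (by simp) (by simp) (by simp)]
    simp

theorem fder_B (g : Fin (n + 1)) : fder (sigma G η x) (.B g) =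
    app (proj ((g : ℕ) + 2)) (Curv1 G η) -
      (-1 : ℂ) ^ (g : ℕ) • app (hodge η) (app extd (PiF 1 g)) := by
  have hd : n + 2 - (Field.B g).deg = (g : ℕ) + 2 := by
    change n + 2 - (n - (g : ℕ)) = _
    omega
  have hZ : LDeg (n + 2 - (Field.B g).deg)
      (-((-1 : ℂ) ^ (g : ℕ) • app (hodge η) (app extd (PiF 1 g))) : LForm n r) := by
    rw [hd]
    refine (LDeg.smul _ ?_).neg
    -- B^n_0 has no multiplier partner: position (1, n) lies outside the pyramid, and its extra term
    -- is zero.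
    by_cases h : (g : ℕ) < n
    · exact ((LDeg.PiF 1 g).extd.hodge η).congr (by omega)
    · rw [PiF, dif_neg (by omega), app_zero, app_zero]
      exact LDeg.zero _
  rw [sigma, sigmaHat_eq, fder_of_dep_right G (LPar.Phi1 η)
    (LIndep.Phi1 η (by simp) (by simp) (by simp) (by simp)) (dep_Phi2_B η g) hZ, hd, sub_eq_add_neg]
  · rfl
  · intro I a α
    rw [pd_sigmaPi G η x (by simp) (by simp) (by simp), LIndep.fld (by simp), Tr_zero_left,
      neg_zero, zero_sub]
    by_cases h : (g : ℕ) < n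
    · rw [Finset.sum_eq_single ⟨g, h⟩]
      · have hg : (⟨(g : ℕ), h⟩ : Fin n).castSucc = g := rfl
        rw [hg, app_pd_fld]
        split_ifs with h1 h2 h2
        · rw [Tr_eq, sum_single_mul, Pi.neg_apply, alg_mul_neg, Pi.smul_apply, mul_smul_comm]
        · exact absurd h1.2 h2
        · exact absurd ⟨rfl, h2⟩ h1
        · rw [Tr_zero_left, smul_zero, neg_zero]
      · intro g' _ hg'
        rw [LIndep.fld, Tr_zero_left, smul_zero]
        rw [ne_eq, Field.B.injEq]
        rintro rfl
        exact hg' rfl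
      · simp
    · have h0 : (PiF 1 (g : ℕ) : LForm n r) = 0 := by rw [PiF, dif_neg (by omega)]
      rw [h0, app_zero, app_zero, smul_zero, neg_zero, Finset.sum_eq_zero]
      · simp
      · intro g' _
        rw [LIndep.fld, Tr_zero_left, smul_zero]
        rw [ne_eq, Field.B.injEq]
        rintro rfl
        exact h g'.2

end fder

/-! ## Action of evolutionary derivations on Lie algebra valued forms -/

theorem app_mul (D D' : Module.End ℂ (Alg n r)) (X : LForm n r) :
    app (D * D') X = app D (app D' X) := rfl

theorem app_add_left (D D' : Module.End ℂ (Alg n r)) (X : LForm n r) :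
    app (D + D') X = app D X + app D' X := rfl

theorem app_zero_left (X : LForm n r) : app 0 X = 0 := rfl

section IsEvol

variable {e : ℕ} {D D' : Module.End ℂ (Alg n r)}

theorem IsEvol.app_extd (h : IsEvol e D) (X : LForm n r) :
    app D (app extd X) = (-1 : ℂ) ^ e • app extd (app D X) := funext fun a => h.extd_apply (X a)

theorem IsEvol.app_gMul (h : IsEvol e D) (η : Fin (n + 2) → ℤˣ) (ξ : Fin (n + 2) → ℂ)
    (X : LForm n r) : app D (app (gMul η ξ) X) = (-1 : ℂ) ^ e • app (gMul η ξ) (app D X) :=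
  funext fun a => h.gMul_apply η ξ (X a)

theorem IsEvol.app_lie (h : IsEvol e D) (ξ : Fin (n + 2) → ℂ) (X : LForm n r) :
    app D (app (lie ξ) X) = app (lie ξ) (app D X) := funext fun a => h.lie_apply ξ (X a)

theorem IsEvol.app_hodge (h : IsEvol e D) (η : Fin (n + 2) → ℤˣ) (X : LForm n r) :
    app D (app (hodge η) X) = app (hodge η) (app D X) :=
  funext fun a => (h.hodge_apply η (X a)).symm

theorem IsEvol.app_proj (h : IsEvol e D) (p : ℕ) (X : LForm n r) :
    app D (app (proj p) X) = app (proj p) (app D X) :=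
  funext fun a => (h.proj_apply p (X a)).symm

theorem IsEvol.app_inner (h : IsEvol e D) (ξ : Fin (n + 2) → ℂ) (X : LForm n r) :
    app D (app (inner ξ) X) = (-1 : ℂ) ^ e • app (inner ξ) (app D X) := by
  funext a
  change D (BF.inner ξ (X a)) = (-1 : ℂ) ^ e • BF.inner ξ (D (X a))
  rw [h.inner_apply, smul_smul, neg_one_pow_add_self, one_smul]

/-- Evolutionary derivations agree if they agree on the ladders, the antighosts and the
multipliers. -/
theorem IsEvol.ext_ladders (η : Fin (n + 2) → ℤˣ) (h : IsEvol e D) (h' : IsEvol e D')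
    (h1 : app D (Phi1 η) = app D' (Phi1 η)) (h2 : app D (Phi2 η) = app D' (Phi2 η))
    (hcbar : app D (fld .cbar) = app D' (fld .cbar)) (hpi : app D (fld .pi) = app D' (fld .pi))
    (hC : ∀ k g, 1 ≤ k → k + g ≤ n → app D (CbarF k g) = app D' (CbarF k g))
    (hP : ∀ k g, 1 ≤ k → k + g ≤ n → app D (PiF k g) = app D' (PiF k g)) : D = D' := by
  have h1' : ∀ p, app D (phi1 η p) = app D' (phi1 η p) := fun p => by
    rw [← proj_Phi1, h.app_proj, h'.app_proj, h1]
  have h2' : ∀ p, app D (phi2 η p) = app D' (phi2 η p) := fun p => by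
    rw [← proj_Phi2, h.app_proj, h'.app_proj, h2]
  refine h.ext h' fun F => ?_
  cases F with
  | A => exact h1' 1
  | c => exact h1' 0
  | B g => rw [← phi2_B η g]; exact h2' _
  | cbar => exact hcbar
  | pi => exact hpi
  | Cbar s =>
    have := hC s.1.1 s.1.2 s.2.1 s.2.2
    rwa [CbarF, dif_pos s.2] at this
  | Pi s =>
    have := hP s.1.1 s.1.2 s.2.1 s.2.2
    rwa [PiF, dif_pos s.2] at this
  | gamma =>
    -- The sources γ and b are recovered from the hatted ladder entries and the antighosts by
    -- undoing the shifts.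
    have : (fld .gamma : LForm n r) =
        phi2 η (n + 1) + app (hodge η) (app extd (fld .cbar)) := by
      rw [phi2_gamma, gammaHat, sub_add_cancel]
    rw [this, app_add, app_add, h2', h.app_hodge, h'.app_hodge, h.app_extd, h'.app_extd, hcbar]
  | tau => rw [← phi2_tau η]; exact h2' _
  | b g =>
    have : (fld (.b g) : LForm n r) = phi1 η ((g : ℕ) + 2) -
        (-1 : ℂ) ^ ((g : ℕ) + 1) • app (hodge η) (app extd (CbarF 1 g)) := by
      rw [phi1_b, bHat, add_sub_cancel_right]
    rw [this, app_sub, app_sub, h1', app_smul, app_smul, h.app_hodge, h'.app_hodge, h.app_extd,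
      h'.app_extd]
    by_cases hg : 1 + (g : ℕ) ≤ n
    · rw [hC 1 g le_rfl hg]
    · rw [CbarF, dif_neg (by omega)]
      simp only [app_zero, smul_zero]

end IsEvol

/-! ## The linearized Slavnov operator -/

section slavnov

variable (G : GaugeAlgebra r N) (η : Fin (n + 2) → ℤˣ) (x : ℕ → ℕ → ℂ)

theorem isEvol_slavnov : IsEvol 1 (slavnov (sigma G η x)) := by
  refine isEvol_ward fun F => ?_
  change LPar (F.par + 1) _
  cases F with
  | A => simp only [fder_gamma]; exact ((LPar.Curv1 G η).proj _).congr rfl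
  | c => simp only [fder_tau]; exact ((LPar.Curv1 G η).proj _).congr rfl
  | B g =>
    simp only [fder_b]
    refine ((LPar.Curv2 G η).proj _).congr ?_
    simp only [Field.par, Field.gh, Field.deg]; omega
  | cbar => exact LPar.pi.congr (by simp [Field.par, Field.gh, Field.deg])
  | pi => exact LPar.zero _
  | Cbar s => exact (LPar.fld _).congr (by have := par_slot s; omega)
  | Pi s => exact LPar.zero _
  | gamma =>
    simp only [fder_A]
    have h : (Field.gamma : Field n).par + 1 = n + 3 := by
      simp only [Field.par, Field.gh, Field.deg]; omega
    rw [h]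
    exact (((LPar.Curv2 G η).proj _).congr (by omega)).sub
      ((LPar.pi.extd.hodge η).congr (by omega))
  | tau =>
    simp only [fder_c]
    refine ((LPar.Curv2 G η).proj _).congr ?_
    simp only [Field.par, Field.gh, Field.deg]; omega
  | b g =>
    simp only [fder_B]
    have h : ((Field.b g).par + 1) % 2 = 0 := by
      simp only [Field.par, Field.gh, Field.deg]; omega
    exact (((LPar.Curv1 G η).proj _).congr (by omega)).sub
      ((((LPar.PiF 1 g).extd.hodge η).congr (by omega)).smul _)

variable {G η x}

theorem slavnov_fld {F : Field n} {X : LForm n r} (hX : LDeg F.deg X)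
    (h : (match (generalizing := false) F with
      | .A => fder (sigma G η x) .gamma
      | .gamma => fder (sigma G η x) .A
      | .c => fder (sigma G η x) .tau
      | .tau => fder (sigma G η x) .c
      | .B g => fder (sigma G η x) (.b g)
      | .b g => fder (sigma G η x) (.B g)
      | .cbar => fld .pi
      | .pi => 0
      | .Cbar s => fld (.Pi s)
      | .Pi _ => 0 : LForm n r) = X) : app (slavnov (sigma G η x)) (fld F) = X := by
  subst h
  exact ward_fld hX (isEvol_slavnov G η x).toIsVert

variable (G η x)

theorem slavnov_CbarF (k g : ℕ) : app (slavnov (sigma G η x)) (CbarF k g) = PiF k g := by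
  rw [CbarF, PiF]
  split_ifs
  · exact slavnov_fld (LDeg.fld (.Pi _)) rfl
  · exact app_zero _

theorem slavnov_PiF (k g : ℕ) : app (slavnov (sigma G η x)) (PiF k g) = 0 := by
  rw [PiF]
  split_ifs
  · exact slavnov_fld (LDeg.zero _) rfl
  · exact app_zero _

theorem slavnov_cbar : app (slavnov (sigma G η x)) (fld .cbar) = fld .pi :=
  slavnov_fld (LDeg.fld .pi) rfl

theorem slavnov_pi : app (slavnov (sigma G η x)) (fld .pi) = 0 :=
  slavnov_fld (LDeg.zero _) rfl

/-- The shift in b̂ is made for this: S anticommutes with d and maps C̄ to Π, so S of the shift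
cancels the term *dΠ in δΣ/δB. On the ladder S no longer sees the gauge fixing. The shift of γ by
*dc̄ plays the same role for the second ladder. -/
theorem slavnov_phi1 {p : ℕ} (hp : p < n + 3) :
    app (slavnov (sigma G η x)) (phi1 η p) = app (proj p) (Curv1 G η) := by
  have hS := isEvol_slavnov G η x
  rcases p with _ | _ | p
  · exact slavnov_fld (LDeg.proj _ _) (fder_tau G η x)
  · exact slavnov_fld (LDeg.proj _ _) (fder_gamma G η x)
  · have hb := phi1_b (r := r) η ⟨p, by omega⟩
    simp only at hb
    have h1 : app (slavnov (sigma G η x)) (fld (.b ⟨p, by omega⟩)) =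
        app (proj (p + 2)) (Curv1 G η) -
          (-1 : ℂ) ^ p • app (hodge η) (app extd (PiF 1 p)) := by
      refine slavnov_fld ((LDeg.proj _ _).sub ?_) (fder_B G η x _)
      refine LDeg.smul _ ?_
      by_cases h : p < n
      · exact ((LDeg.PiF 1 p).extd.hodge η).congr (by change _ = p + 2; omega)
      · rw [PiF, dif_neg (by omega), app_zero, app_zero]
        exact LDeg.zero _
    rw [hb, bHat, app_add, app_smul, h1, hS.app_hodge, hS.app_extd, slavnov_CbarF, app_smul,
      smul_smul, ← pow_add, pow_add, pow_add, pow_one]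
    module

theorem slavnov_phi2 {p : ℕ} (hp : p < n + 3) :
    app (slavnov (sigma G η x)) (phi2 η p) = app (proj p) (Curv2 G η) := by
  have hS := isEvol_slavnov G η x
  by_cases h1 : p ≤ n
  · obtain ⟨g, rfl⟩ : ∃ g : Fin (n + 1), p = n - (g : ℕ) :=
      ⟨⟨n - p, by omega⟩, by simp only; omega⟩
    rw [phi2_B]
    exact slavnov_fld (LDeg.proj _ _) (fder_b G η x g)
  · obtain rfl | rfl : p = n + 1 ∨ p = n + 2 := by omega
    · have h1 : app (slavnov (sigma G η x)) (fld .gamma) =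
          app (proj (n + 1)) (Curv2 G η) - app (hodge η) (app extd (fld .pi)) :=
        slavnov_fld ((LDeg.proj _ _).sub ((LDeg.fld .pi).extd.hodge η)) (fder_A G η x)
      rw [phi2_gamma, gammaHat, app_sub, h1, hS.app_hodge, hS.app_extd, slavnov_cbar, app_smul]
      module
    · rw [phi2_tau]
      exact slavnov_fld (LDeg.proj _ _) (fder_c G η x)

theorem slavnov_Phi1 : app (slavnov (sigma G η x)) (Phi1 η) = Curv1 G η := by
  rw [Phi1, app_sum, ← sum_app_proj (Curv1 G η)]
  exact Finset.sum_congr rfl fun p hp => slavnov_phi1 G η x (Finset.mem_range.1 hp)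

theorem slavnov_Phi2 : app (slavnov (sigma G η x)) (Phi2 η) = Curv2 G η := by
  rw [Phi2, app_sum, ← sum_app_proj (Curv2 G η)]
  exact Finset.sum_congr rfl fun p hp => slavnov_phi2 G η x (Finset.mem_range.1 hp)

end slavnov

/-! ## The Ward operators -/

theorem LPar.susyCbar (η : Fin (n + 2) → ℤˣ) (ξ : Fin (n + 2) → ℂ) (k g : ℕ) :
    LPar (n + 1) (susyCbar η ξ k g : LForm n r) := by
  rw [BF.susyCbar]
  split_ifs
  · exact ((LPar.CbarF _ _).gMul η ξ).smul _
  · exact LPar.zero _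
  · exact ((LPar.CbarF _ _).inner ξ).smul _

theorem LPar.susyPi (η : Fin (n + 2) → ℤˣ) (ξ : Fin (n + 2) → ℂ) (k g : ℕ) :
    LPar n (susyPi η ξ k g : LForm n r) := by
  rw [BF.susyPi]
  refine LPar.add ?_ ((LPar.CbarF _ _).lie ξ)
  split_ifs
  · exact (((LPar.PiF _ _).gMul η ξ).smul _).congr (by omega)
  · exact LPar.zero _
  · exact (((LPar.PiF _ _).inner ξ).smul _).congr (by omega)

theorem LDeg.gMul_succ {F : ℕ → ℕ → LForm n r} (hF : ∀ k g, LDeg (n - g - k) (F k g))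
    (hF' : ∀ k g, n < k + g → F k g = 0) (η : Fin (n + 2) → ℤˣ) (ξ : Fin (n + 2) → ℂ) (k g : ℕ) :
    LDeg (n - g - k) (app (BF.gMul η ξ) (F k (g + 1))) := by
  by_cases h : k + (g + 1) ≤ n
  · exact ((hF k (g + 1)).gMul η ξ).congr (by omega)
  · rw [hF' _ _ (by omega), app_zero]
    exact LDeg.zero _

theorem LDeg.inner_pred {F : ℕ → ℕ → LForm n r} (hF : ∀ k g, LDeg (n - g - k) (F k g))
    (hF' : ∀ k g, n < k + g → F k g = 0) (ξ : Fin (n + 2) → ℂ) (k : ℕ) {g : ℕ} (hg : g ≠ 0) :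
    LDeg (n - g - k) (app (BF.inner ξ) (F k (g - 1))) := by
  by_cases h : k + (g - 1) ≤ n
  · exact ((hF k (g - 1)).inner ξ).congr (by omega)
  · rw [hF' _ _ (by omega), app_zero]
    exact LDeg.zero _

theorem CbarF_eq_zero {k g : ℕ} (h : n < k + g) : (CbarF k g : LForm n r) = 0 := by
  rw [CbarF, dif_neg (by omega)]

theorem PiF_eq_zero {k g : ℕ} (h : n < k + g) : (PiF k g : LForm n r) = 0 := by
  rw [PiF, dif_neg (by omega)]

theorem LDeg.susyCbar (η : Fin (n + 2) → ℤˣ) (ξ : Fin (n + 2) → ℂ) (k g : ℕ) :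
    LDeg (n - g - k) (susyCbar η ξ k g : LForm n r) := by
  rw [BF.susyCbar]
  split_ifs with h1 h2
  · exact (LDeg.gMul_succ LDeg.CbarF (fun _ _ => CbarF_eq_zero) η ξ k g).smul _
  · exact LDeg.zero _
  · exact (LDeg.inner_pred LDeg.CbarF (fun _ _ => CbarF_eq_zero) ξ k h2).smul _

theorem LDeg.susyPi (η : Fin (n + 2) → ℤˣ) (ξ : Fin (n + 2) → ℂ) (k g : ℕ) :
    LDeg (n - g - k) (susyPi η ξ k g : LForm n r) := by
  rw [BF.susyPi]
  refine LDeg.add ?_ ((LDeg.CbarF _ _).lie ξ)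
  split_ifs with h1 h2
  · exact (LDeg.gMul_succ LDeg.PiF (fun _ _ => PiF_eq_zero) η ξ k g).smul _
  · exact LDeg.zero _
  · exact (LDeg.inner_pred LDeg.PiF (fun _ _ => PiF_eq_zero) ξ k h2).smul _

section wardS

variable (η : Fin (n + 2) → ℤˣ) (ξ : Fin (n + 2) → ℂ)

theorem isEvol_wardS : IsEvol 1 (wardS η ξ : Module.End ℂ (Alg n r)) := by
  refine isEvol_ward fun F => ?_
  change LPar (F.par + 1) _
  cases F with
  | A => exact (((LPar.phi1 η 2).inner ξ).neg).congr rfl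
  | c => exact (((LPar.phi1 η 1).inner ξ).neg).congr rfl
  | B g =>
    refine (((LPar.phi2 η _).inner ξ).neg).congr ?_
    simp only [Field.par, Field.gh, Field.deg]; omega
  | cbar => exact LPar.zero _
  | pi => exact (LPar.cbar.lie ξ).congr rfl
  | Cbar s => exact (LPar.susyCbar η ξ _ _).congr (by have := par_slot s; omega)
  | Pi s => exact (LPar.susyPi η ξ _ _).congr (by have := par_slot s; omega)
  | gamma =>
    refine (((LPar.phi2 η _).inner ξ).neg).congr ?_
    simp only [Field.par, Field.gh, Field.deg]; omega
  | tau => exact LPar.zero _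
  | b g =>
    have h : ((Field.b g).par + 1) % 2 = 0 := by
      simp only [Field.par, Field.gh, Field.deg]; omega
    exact ((((LPar.phi1 η _).inner ξ).neg).congr (by omega)).add
      ((((LPar.susyCbar η ξ 1 g).extd.hodge η).congr (by omega)).smul _)

theorem isEvol_wardT : IsEvol 0 (wardT ξ : Module.End ℂ (Alg n r)) :=
  isEvol_ward fun F => (LPar.fld F).lie ξ

theorem wardT_eq : (wardT ξ : Module.End ℂ (Alg n r)) = lie ξ :=
  (isEvol_wardT ξ).ext (isEvol_lie ξ) fun F =>
    ward_fld ((LDeg.fld F).lie ξ) (isEvol_wardT ξ).toIsVert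

variable {η ξ}

theorem wardS_fld {F : Field n} {X : LForm n r} (hX : LDeg F.deg X)
    (h : (match (generalizing := false) F with
      | .c => - app (inner ξ) (phi1 η 1)
      | .A => - app (inner ξ) (phi1 η 2)
      | .B g => - app (inner ξ) (phi2 η (n - (g : ℕ) + 1))
      | .gamma => - app (inner ξ) (phi2 η (n + 2))
      | .tau => 0
      | .b g => - app (inner ξ) (phi1 η ((g : ℕ) + 3))
          + (-1 : ℂ) ^ ((g : ℕ) + 1) • app (hodge η) (app extd (susyCbar η ξ 1 g))
      | .cbar => 0
      | .pi => app (lie ξ) (fld .cbar)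
      | .Cbar s => susyCbar η ξ s.1.1 s.1.2
      | .Pi s => susyPi η ξ s.1.1 s.1.2 : LForm n r) = X) : app (wardS η ξ) (fld F) = X := by
  subst h
  exact ward_fld hX (isEvol_wardS η ξ).toIsVert

variable (η ξ)

theorem susyCbar_eq_zero {k g : ℕ} (h : n < k + g) (hk : g ≠ 0 → Odd k) :
    (susyCbar η ξ k g : LForm n r) = 0 := by
  rw [susyCbar]
  split_ifs with h1 h2
  · rw [CbarF_eq_zero (by omega), app_zero, smul_zero]
  · rfl
  · exact absurd (hk h2) h1

theorem wardS_CbarF {k g : ℕ} (hk : 1 ≤ k) (hg : k + g ≤ n) :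
    app (wardS η ξ) (CbarF (r := r) k g) = susyCbar η ξ k g := by
  rw [CbarF, dif_pos ⟨hk, hg⟩]
  exact wardS_fld (LDeg.susyCbar η ξ k g) rfl

theorem wardS_PiF {k g : ℕ} (hk : 1 ≤ k) (hg : k + g ≤ n) :
    app (wardS η ξ) (PiF (r := r) k g) = susyPi η ξ k g := by
  rw [PiF, dif_pos ⟨hk, hg⟩]
  exact wardS_fld (LDeg.susyPi η ξ k g) rfl

theorem wardS_cbar : app (wardS η ξ) (fld (r := r) .cbar) = 0 := wardS_fld (LDeg.zero _) rfl

theorem wardS_pi : app (wardS η ξ) (fld (r := r) .pi) = app (lie ξ) (fld .cbar) :=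
  wardS_fld ((LDeg.fld .cbar).lie ξ) rfl

/-- W anticommutes with d, so its action on the shift *dC̄ inside b̂ cancels the last term in the
transformation of b. At p = n the position (1, n) is outside the pyramid and both contributions are
zero. -/
theorem wardS_phi1 (p : ℕ) :
    app (wardS η ξ) (phi1 (r := r) η p) = - app (inner ξ) (phi1 η (p + 1)) := by
  have hW := isEvol_wardS (r := r) η ξ
  rcases p with _ | _ | p
  · exact wardS_fld ((LDeg.phi1 η 1).inner ξ).neg rfl
  · exact wardS_fld ((LDeg.phi1 η 2).inner ξ).neg rfl
  · by_cases hp : p < n + 1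
    · have hb := phi1_b (r := r) η ⟨p, by omega⟩
      simp only at hb
      have h1 : app (wardS η ξ) (fld (r := r) (.b ⟨p, hp⟩)) = - app (inner ξ) (phi1 η (p + 3))
          + (-1 : ℂ) ^ (p + 1) • app (hodge η) (app extd (susyCbar η ξ 1 p)) := by
        refine wardS_fld (((LDeg.phi1 η (p + 3)).inner ξ).neg.add (LDeg.smul _ ?_)) rfl
        by_cases h : p < n
        · exact ((LDeg.susyCbar η ξ 1 p).extd.hodge η).congr (by change _ = p + 2; omega)
        · rw [susyCbar_eq_zero η ξ (by omega) (fun _ => odd_one), app_zero, app_zero]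
          exact LDeg.zero _
      have h2 : app (wardS η ξ) (CbarF (r := r) 1 p) = susyCbar η ξ 1 p := by
        by_cases h : 1 + p ≤ n
        · exact wardS_CbarF η ξ le_rfl h
        · rw [susyCbar_eq_zero η ξ (by omega) (fun _ => odd_one), CbarF_eq_zero (by omega),
            app_zero]
      rw [hb, bHat, app_add, app_smul, h1, hW.app_hodge, hW.app_extd, h2, app_smul]
      module
    · rw [(LDeg.phi1 η (p + 2)).eq_zero (by omega), (LDeg.phi1 η (p + 2 + 1)).eq_zero (by omega),
        app_zero, app_zero, neg_zero]

theorem wardS_phi2 (p : ℕ) :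
    app (wardS η ξ) (phi2 (r := r) η p) = - app (inner ξ) (phi2 η (p + 1)) := by
  have hW := isEvol_wardS (r := r) η ξ
  by_cases h1 : p ≤ n
  · obtain ⟨g, rfl⟩ : ∃ g : Fin (n + 1), p = n - (g : ℕ) :=
      ⟨⟨n - p, by omega⟩, by simp only; omega⟩
    rw [phi2_B]
    exact wardS_fld ((LDeg.phi2 η _).inner ξ).neg rfl
  · by_cases h2 : p = n + 1
    · subst h2
      have h1 : app (wardS η ξ) (fld (r := r) .gamma) = - app (inner ξ) (phi2 η (n + 2)) :=
        wardS_fld ((LDeg.phi2 η _).inner ξ).neg rfl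
      rw [phi2_gamma, gammaHat, app_sub, h1, hW.app_hodge, hW.app_extd, wardS_cbar, app_zero,
        smul_zero, app_zero, sub_zero]
    · by_cases h3 : p = n + 2
      · subst h3
        rw [(LDeg.phi2 η (n + 2 + 1)).eq_zero (by omega), phi2_tau, app_zero, neg_zero]
        exact wardS_fld (LDeg.zero _) rfl
      · rw [(LDeg.phi2 η p).eq_zero (by omega), (LDeg.phi2 η (p + 1)).eq_zero (by omega),
          app_zero, app_zero, neg_zero]

/-- The index shift closes because i_ξ annihilates the bottom entry and no entry lies above degree n
+ 2. -/
theorem wardS_Phi1 : app (wardS η ξ) (Phi1 (r := r) η) = - app (inner ξ) (Phi1 η) := by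
  have h0 : app (inner ξ) (phi1 (r := r) η 0) = 0 :=
    funext fun a => (LDeg.phi1 η 0 a).dxFree.inner ξ
  simp only [Phi1, app_sum, wardS_phi1, Finset.sum_neg_distrib]
  rw [Finset.sum_range_succ, Finset.sum_range_succ' (fun p => app (inner ξ) (phi1 η p)), h0,
    (LDeg.phi1 η (n + 2 + 1)).eq_zero (by omega), app_zero]

theorem wardS_Phi2 : app (wardS η ξ) (Phi2 (r := r) η) = - app (inner ξ) (Phi2 η) := by
  have h0 : app (inner ξ) (phi2 (r := r) η 0) = 0 :=
    funext fun a => (LDeg.phi2 η 0 a).dxFree.inner ξ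
  simp only [Phi2, app_sum, wardS_phi2, Finset.sum_neg_distrib]
  rw [Finset.sum_range_succ, Finset.sum_range_succ' (fun p => app (inner ξ) (phi2 η p)), h0,
    (LDeg.phi2 η (n + 2 + 1)).eq_zero (by omega), app_zero]

end wardS

/-! ## The off-shell algebra -/

theorem gMul_gMul (η : Fin (n + 2) → ℤˣ) (ξ ξ' : Fin (n + 2) → ℂ) (u : Alg n r) :
    gMul η ξ (gMul η ξ' u) = - gMul η ξ' (gMul η ξ u) := by
  have h : ∀ ξ : Fin (n + 2) → ℂ, HasPar 1 (gMul η ξ (1 : Alg n r)) := fun ξ =>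
    (HasPar.one.gMul η ξ).congr rfl
  have h1 : ∀ (ξ : Fin (n + 2) → ℂ) (u : Alg n r), gMul η ξ u = gMul η ξ 1 * u := fun ξ u => by
    simp [gMul]
  rw [h1 ξ, h1 ξ', h1 ξ' (gMul η ξ u), h1 ξ u, ← mul_assoc, ← mul_assoc,
    (h ξ).mul_comm (h ξ'), smul_mul_assoc]
  module

theorem app_gMul_gMul (η : Fin (n + 2) → ℤˣ) (ξ ξ' : Fin (n + 2) → ℂ) (X : LForm n r) :
    app (gMul η ξ) (app (gMul η ξ') X) = - app (gMul η ξ') (app (gMul η ξ) X) :=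
  funext fun a => gMul_gMul η ξ ξ' (X a)

theorem app_inner_inner (ξ ξ' : Fin (n + 2) → ℂ) (X : LForm n r) :
    app (inner ξ) (app (inner ξ') X) = - app (inner ξ') (app (inner ξ) X) :=
  funext fun a => inner_inner ξ ξ' (X a)

theorem app_extd_extd (X : LForm n r) : app extd (app extd X) = 0 :=
  funext fun a => extd_extd (X a)

theorem app_lie_eq (ξ : Fin (n + 2) → ℂ) (X : LForm n r) :
    app (lie ξ) X = app (inner ξ) (app extd X) + app extd (app (inner ξ) X) := rfl

/-- The supersymmetry transformation within the lines of a pyramid. -/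
def susyLine (η : Fin (n + 2) → ℤˣ) (ξ : Fin (n + 2) → ℂ) (F : ℕ → ℕ → LForm n r) (k g : ℕ) :
    LForm n r :=
  if Odd k then (-1 : ℂ) ^ (n + (k + 1) / 2) • app (gMul η ξ) (F k (g + 1))
  else if g = 0 then 0
  else (-1 : ℂ) ^ (k / 2 + 1) • app (inner ξ) (F k (g - 1))

theorem susyLine_add (η : Fin (n + 2) → ℤˣ) (ξ : Fin (n + 2) → ℂ) (F F' : ℕ → ℕ → LForm n r)
    (k g : ℕ) : susyLine η ξ (fun k g => F k g + F' k g) k g =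
      susyLine η ξ F k g + susyLine η ξ F' k g := by
  simp only [susyLine]
  split_ifs
  · rw [app_add, smul_add]
  · rw [add_zero]
  · rw [app_add, smul_add]

theorem IsEvol.app_susyLine {e : ℕ} {D : Module.End ℂ (Alg n r)} (h : IsEvol e D)
    (η : Fin (n + 2) → ℤˣ) (ξ : Fin (n + 2) → ℂ) (F : ℕ → ℕ → LForm n r) (k g : ℕ) :
    app D (susyLine η ξ F k g) = (-1 : ℂ) ^ e • susyLine η ξ (fun k g => app D (F k g)) k g := by
  simp only [susyLine]
  split_ifs
  · rw [app_smul, h.app_gMul, smul_comm]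
  · rw [app_zero, smul_zero]
  · rw [app_smul, h.app_inner, smul_comm]

/-- The signs depend only on the line k, so the two orders differ only by the order of the two g(ξ),
respectively of the two i_ξ, which anticommute. -/
theorem susyLine_susyLine (η : Fin (n + 2) → ℤˣ) (ξ ξ' : Fin (n + 2) → ℂ)
    (F : ℕ → ℕ → LForm n r) (k g : ℕ) :
    susyLine η ξ (susyLine η ξ' F) k g = - susyLine η ξ' (susyLine η ξ F) k g := by
  simp only [susyLine]
  split_ifs
  · rw [app_smul, app_smul, app_gMul_gMul, smul_neg, smul_neg]
  · rw [neg_zero]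
  · simp only [app_zero, smul_zero, neg_zero]
  · rw [app_smul, app_smul, app_inner_inner, smul_neg, smul_neg]

/-- On an odd line the position g + 1 may leave the pyramid, so agreement is required there at all
positions; on an even line g - 1 stays inside. -/
theorem susyLine_congr (η : Fin (n + 2) → ℤˣ) (ξ : Fin (n + 2) → ℂ) {F F' : ℕ → ℕ → LForm n r}
    {k g : ℕ} (hg : k + g ≤ n) (h : ∀ g, (k + g ≤ n ∨ Odd k) → F k g = F' k g) :
    susyLine η ξ F k g = susyLine η ξ F' k g := by
  simp only [susyLine]
  split_ifs with hk
  · rw [h _ (Or.inr hk)]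
  · rfl
  · rw [h _ (Or.inl (by omega))]

section wardS

variable (η : Fin (n + 2) → ℤˣ) (ξ ξ' : Fin (n + 2) → ℂ)

/-- On odd lines the rule continues past the edge of the pyramid, where both sides vanish. This is
what `susyLine_congr` needs at the last position. -/
theorem wardS_CbarF' {k g : ℕ} (hk : 1 ≤ k) (hg : k + g ≤ n ∨ Odd k) :
    app (wardS η ξ) (CbarF (r := r) k g) = susyLine η ξ CbarF k g := by
  by_cases h : k + g ≤ n
  · exact wardS_CbarF η ξ hk h
  · rw [CbarF_eq_zero (by omega), app_zero, susyLine, if_pos (hg.resolve_left h),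
      CbarF_eq_zero (by omega), app_zero, smul_zero]

theorem wardS_PiF' {k g : ℕ} (hk : 1 ≤ k) (hg : k + g ≤ n ∨ Odd k) :
    app (wardS η ξ) (PiF (r := r) k g) = susyLine η ξ PiF k g + app (lie ξ) (CbarF k g) := by
  by_cases h : k + g ≤ n
  · exact wardS_PiF η ξ hk h
  · rw [PiF_eq_zero (by omega), app_zero, susyLine, if_pos (hg.resolve_left h),
      PiF_eq_zero (by omega), CbarF_eq_zero (by omega), app_zero, app_zero, smul_zero, add_zero]

theorem wardS_wardS_CbarF {k g : ℕ} (hk : 1 ≤ k) (hg : k + g ≤ n) :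
    app (wardS η ξ) (app (wardS η ξ') (CbarF (r := r) k g)) =
      - susyLine η ξ' (susyLine η ξ CbarF) k g := by
  rw [wardS_CbarF' η ξ' hk (Or.inl hg), (isEvol_wardS η ξ).app_susyLine,
    susyLine_congr η ξ' hg fun g hg => wardS_CbarF' η ξ hk hg]
  module

/-- Each of the two mixed terms with a Lie derivative turns into the negative of the other under ξ ↔
ξ', so that they drop out of the anticommutator. -/
theorem wardS_wardS_PiF {k g : ℕ} (hk : 1 ≤ k) (hg : k + g ≤ n) :
    app (wardS η ξ) (app (wardS η ξ') (PiF (r := r) k g)) =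
      - susyLine η ξ' (susyLine η ξ PiF) k g - susyLine η ξ' (fun k g => app (lie ξ) (CbarF k g)) k g
        + susyLine η ξ (fun k g => app (lie ξ') (CbarF k g)) k g := by
  rw [wardS_PiF' η ξ' hk (Or.inl hg), app_add, (isEvol_wardS η ξ).app_susyLine,
    susyLine_congr η ξ' (F' := fun k g => susyLine η ξ PiF k g + app (lie ξ) (CbarF k g)) hg
      fun g hg => wardS_PiF' η ξ hk hg, susyLine_add,
    (isEvol_wardS η ξ).app_lie, wardS_CbarF' η ξ hk (Or.inl hg), (isEvol_lie ξ').app_susyLine]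
  module

theorem wardS_anticomm : wardS η ξ * wardS η ξ' + wardS η ξ' * wardS η ξ =
    (0 : Module.End ℂ (Alg n r)) := by
  have hW := isEvol_wardS (r := r) η ξ
  have hW' := isEvol_wardS (r := r) η ξ'
  refine (hW.comm_odd hW').ext_ladders η IsEvol.zero ?_ ?_ ?_ ?_ ?_ ?_
  · rw [app_add_left, app_mul, app_mul, wardS_Phi1, wardS_Phi1, app_neg, app_neg, hW.app_inner,
      hW'.app_inner, wardS_Phi1, wardS_Phi1, app_neg, app_neg, app_inner_inner ξ, app_zero_left]
    module
  · rw [app_add_left, app_mul, app_mul, wardS_Phi2, wardS_Phi2, app_neg, app_neg, hW.app_inner,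
      hW'.app_inner, wardS_Phi2, wardS_Phi2, app_neg, app_neg, app_inner_inner ξ, app_zero_left]
    module
  · rw [app_add_left, app_mul, app_mul, wardS_cbar, wardS_cbar, app_zero, app_zero, add_zero,
      app_zero_left]
  · rw [app_add_left, app_mul, app_mul, wardS_pi, wardS_pi, hW.app_lie, hW'.app_lie, wardS_cbar,
      wardS_cbar, app_zero, app_zero, add_zero, app_zero_left]
  · intro k g hk hg
    rw [app_add_left, app_mul, app_mul, wardS_wardS_CbarF η ξ ξ' hk hg,
      wardS_wardS_CbarF η ξ' ξ hk hg, susyLine_susyLine, neg_neg, add_neg_cancel, app_zero_left]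
  · intro k g hk hg
    rw [app_add_left, app_mul, app_mul, wardS_wardS_PiF η ξ ξ' hk hg,
      wardS_wardS_PiF η ξ' ξ hk hg, susyLine_susyLine η ξ ξ', app_zero_left]
    module

end wardS

section slavnov

variable (G : GaugeAlgebra r N) (η : Fin (n + 2) → ℤˣ) (x : ℕ → ℕ → ℂ)

/-- The Bianchi identity: S F₁ = -(dF₁ + [Φ₁, F₁]), which vanishes by d² = 0 and [[Φ₁,Φ₁],Φ₁] = 0.
-/
theorem slavnov_Curv1 : app (slavnov (sigma G η x)) (Curv1 G η) = 0 := by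
  have hS := isEvol_slavnov G η x
  have hX := LPar.Phi1 (r := r) η
  conv_lhs => rw [Curv1, app_add, app_smul, hS.app_extd, app_bracket G hS.toIsGDer hX, slavnov_Phi1]
  rw [bracket_comm G hX (LPar.Curv1 G η)]
  conv_lhs => rw [Curv1, app_add, app_smul, app_extd_extd, app_bracket G isGDer_extd hX,
    bracket_comm G hX hX.extd]
  rw [bracket_add_left, bracket_smul_left, bracket_bracket_self G hX]
  module

/-- S F₂ = [F₁, Φ₂] - (dF₂ + [Φ₁, F₂]), which vanishes since the square of the covariant derivative
is the bracket with the curvature. -/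
theorem slavnov_Curv2 : app (slavnov (sigma G η x)) (Curv2 G η) = 0 := by
  have hS := isEvol_slavnov G η x
  have hX := LPar.Phi1 (r := r) η
  conv_lhs => rw [Curv2, app_add, hS.app_extd, app_bracket G hS.toIsGDer hX, slavnov_Phi1,
    slavnov_Phi2]
  conv_lhs => rw [Curv2, app_add, app_extd_extd, app_bracket G isGDer_extd hX]
  rw [bracket_add_right, bracket_bracket G hX, Curv1, bracket_add_left, bracket_smul_left]
  module

theorem slavnov_sq : slavnov (sigma G η x) * slavnov (sigma G η x) = 0 := by
  have hS := isEvol_slavnov G η x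
  -- The anticommutator 2S² is a derivation, so it can be tested on the ladders; the factor 2 is
  -- removed at the end.
  have h : slavnov (sigma G η x) * slavnov (sigma G η x) +
      slavnov (sigma G η x) * slavnov (sigma G η x) = 0 := by
    refine (hS.comm_odd hS).ext_ladders η IsEvol.zero ?_ ?_ ?_ ?_ ?_ ?_
    · rw [app_add_left, app_mul, slavnov_Phi1, slavnov_Curv1, add_zero, app_zero_left]
    · rw [app_add_left, app_mul, slavnov_Phi2, slavnov_Curv2, add_zero, app_zero_left]
    · rw [app_add_left, app_mul, slavnov_cbar, slavnov_pi, add_zero, app_zero_left]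
    · rw [app_add_left, app_mul, slavnov_pi, app_zero, add_zero, app_zero_left]
    · intro k g _ _
      rw [app_add_left, app_mul, slavnov_CbarF, slavnov_PiF, add_zero, app_zero_left]
    · intro k g _ _
      rw [app_add_left, app_mul, slavnov_PiF, app_zero, add_zero, app_zero_left]
  refine LinearMap.ext fun u => ?_
  have h2 := LinearMap.congr_fun h u
  exact eq_zero_of_eq_neg (eq_neg_of_add_eq_zero_left h2)

/-- On Φ₁ the sum is i_ξ F₁ + W F₁. Since W is -i_ξ on Φ₁ and both are antiderivations, the bracket
terms cancel, and since W anticommutes with d the rest is i_ξ d + d i_ξ. The same holds on Φ₂. On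
the multipliers the term L_ξ C̄ supplies the translation of C̄, and its image under S that of Π. -/
theorem slavnov_wardS (ξ : Fin (n + 2) → ℂ) :
    slavnov (sigma G η x) * wardS η ξ + wardS η ξ * slavnov (sigma G η x) = wardT ξ := by
  have hS := isEvol_slavnov G η x
  have hW := isEvol_wardS (r := r) η ξ
  have hX := LPar.Phi1 (r := r) η
  rw [wardT_eq]
  refine (hS.comm_odd hW).ext_ladders η (isEvol_lie ξ) ?_ ?_ ?_ ?_ ?_ ?_
  · rw [app_add_left, app_mul, app_mul, wardS_Phi1, slavnov_Phi1, app_neg, hS.app_inner,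
      slavnov_Phi1, Curv1, app_add, app_add, app_smul, app_smul, hW.app_extd,
      app_bracket G hW.toIsGDer hX, app_bracket G (isGDer_inner ξ) hX, wardS_Phi1, app_lie_eq,
      app_neg, ← neg_one_smul ℂ (app (inner ξ) (Phi1 η)), bracket_smul_left, bracket_smul_right]
    module
  · rw [app_add_left, app_mul, app_mul, wardS_Phi2, slavnov_Phi2, app_neg, hS.app_inner,
      slavnov_Phi2, Curv2, app_add, app_add, hW.app_extd,
      app_bracket G hW.toIsGDer hX, app_bracket G (isGDer_inner ξ) hX, wardS_Phi1, wardS_Phi2,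
      app_lie_eq, app_neg, ← neg_one_smul ℂ (app (inner ξ) (Phi1 η)),
      ← neg_one_smul ℂ (app (inner ξ) (Phi2 η)), bracket_smul_left, bracket_smul_right]
    module
  · rw [app_add_left, app_mul, app_mul, wardS_cbar, slavnov_cbar, app_zero, wardS_pi, zero_add]
  · rw [app_add_left, app_mul, app_mul, slavnov_pi, app_zero, wardS_pi, hS.app_lie, slavnov_cbar,
      add_zero]
  · intro k g hk hg
    rw [app_add_left, app_mul, app_mul, slavnov_CbarF, wardS_CbarF' η ξ hk (Or.inl hg),
      hS.app_susyLine, wardS_PiF' η ξ hk (Or.inl hg)]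
    simp only [slavnov_CbarF]
    module
  · intro k g hk hg
    rw [app_add_left, app_mul, app_mul, slavnov_PiF, wardS_PiF' η ξ hk (Or.inl hg), app_add,
      hS.app_susyLine, hS.app_lie, slavnov_CbarF, app_zero, add_zero]
    simp only [slavnov_PiF]
    have h0 : susyLine η ξ (fun _ _ => (0 : LForm n r)) k g = 0 := by
      simp only [susyLine, app_zero, smul_zero, ite_self]
    rw [h0, smul_zero, zero_add]

end slavnov

theorem wardS_phi1_top (η : Fin (n + 2) → ℤˣ) (ξ : Fin (n + 2) → ℂ) :
    app (wardS η ξ) (phi1 (r := r) η (n + 2)) = 0 := by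
  rw [wardS_phi1, (LDeg.phi1 η (n + 2 + 1)).eq_zero (by omega), app_zero, neg_zero]

theorem wardS_phi2_top (η : Fin (n + 2) → ℤˣ) (ξ : Fin (n + 2) → ℂ) :
    app (wardS η ξ) (phi2 (r := r) η (n + 2)) = 0 := by
  rw [wardS_phi2, (LDeg.phi2 η (n + 2 + 1)).eq_zero (by omega), app_zero, neg_zero]

/-! ## Hodge duality, inner derivative and exterior multiplication -/

theorem dxI_injective {I : Finset (Fin (n + 2))} {s t : ℂ}
    (h : (s • dxI I : Alg n r) = t • dxI I) : s = t := by
  have h1 := congrArg (contr I) h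
  rw [map_smul, map_smul, contr_dxI_self] at h1
  have h2 : (s - t) • (1 : Alg n r) = 0 := by rw [alg_sub_smul, h1, sub_self]
  exact sub_eq_zero.1 ((smul_eq_zero.1 h2).resolve_right one_ne_zero)

/-- Compare dx^J dx^{Jᶜ} with the reversed product and read off the coefficient of the volume form.
The algebra with r = 0 serves only as a place for this sign computation. -/
theorem eps_compl_swap (J : Finset (Fin (n + 2))) :
    eps J Jᶜ = (-1) ^ (J.card * Jᶜ.card) * eps Jᶜ J := by
  have h := (hasPar_dxI (r := 0) J).mul_comm (hasPar_dxI Jᶜ)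
  rw [dxI_mul_dxI, dxI_mul_dxI, if_pos disjoint_compl_right, if_pos disjoint_compl_left,
    Finset.union_compl, Finset.union_comm, Finset.union_compl, smul_smul] at h
  exact dxI_injective h

theorem eps_mul_eps (K I : Finset (Fin (n + 2))) : eps K I * eps K I = 1 := neg_one_pow_add_self _

/-- Compute dx^{Jᶜ} dx^J with J = K ∪ {μ} by extracting dx^μ from dx^J and absorbing it into
dx^{Jᶜ}, which becomes dx^{Kᶜ}. -/
theorem eps_compl_insert {μ : Fin (n + 2)} {K : Finset (Fin (n + 2))} (h : μ ∉ K) :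
    eps (insert μ K)ᶜ (insert μ K) =
      (-1) ^ (insert μ K)ᶜ.card * ((-1) ^ (K.filter (· < μ)).card *
        ((-1) ^ ((insert μ K)ᶜ.filter (· < μ)).card * eps Kᶜ K)) := by
  set J := insert μ K with hJ
  have hins : insert μ Jᶜ = Kᶜ := by
    rw [hJ, Finset.compl_insert, Finset.insert_erase (Finset.mem_compl.2 h)]
  have h1 : (dxI J : Alg n 0) = (-1 : ℂ) ^ (K.filter (· < μ)).card • (gen (.dx μ) * dxI K) := by
    rw [dx_mul_dxI, if_neg h, smul_smul, neg_one_pow_add_self, one_smul]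
  have h2 : (dxI Jᶜ * dxI J : Alg n 0) = eps Jᶜ J • dxI Finset.univ := by
    rw [dxI_mul_dxI, if_pos disjoint_compl_left, Finset.union_comm, Finset.union_compl]
  have h3 : (dxI Kᶜ * dxI K : Alg n 0) = eps Kᶜ K • dxI Finset.univ := by
    rw [dxI_mul_dxI, if_pos disjoint_compl_left, Finset.union_comm, Finset.union_compl]
  have h4 : μ ∉ Jᶜ := by rw [Finset.mem_compl, not_not]; exact Finset.mem_insert_self _ _
  rw [h1, mul_smul_comm, ← mul_assoc, (hasPar_dxI Jᶜ).mul_comm (hasPar_dx μ), dx_mul_dxI,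
    if_neg h4, hins, smul_mul_assoc, smul_mul_assoc, h3, smul_smul, smul_smul, smul_smul] at h2
  rw [← dxI_injective h2]
  ring

/-- The reversal sign of the Hodge convention changes by (-1)^{|K|}, and moving dx^μ past dx^{Jᶜ},
where J = K ∪ {μ}, costs (-1)^{|Jᶜ|}. As |K| + |Jᶜ| = n + 1, the total sign does not depend on the
degree. The metric factor squares to one. -/
theorem hodgeC_insert (η : Fin (n + 2) → ℤˣ) {μ : Fin (n + 2)} {K : Finset (Fin (n + 2))}
    (h : μ ∉ K) : ((η μ : ℤ) : ℂ) * hodgeC η (insert μ K) *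
        (-1) ^ ((insert μ K)ᶜ.filter (· < μ)).card =
      (-1) ^ (n + 1) * ((-1) ^ (K.filter (· < μ)).card * hodgeC η K) := by
  have hc : K.card + (insert μ K)ᶜ.card = n + 1 := by
    have := card_compl_eq (insert μ K)
    have h2 := card_le (insert μ K)
    rw [Finset.card_insert_of_notMem h] at this h2
    omega
  have hη : ((η μ : ℤ) : ℂ) * ((η μ : ℤ) : ℂ) = 1 := by
    rcases Int.units_eq_one_or (η μ) with h | h <;> simp [h]
  rw [hodgeC, hodgeC, eps_compl_insert h, Finset.card_insert_of_notMem h, Nat.triangle_succ,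
    Finset.prod_insert h, pow_add, ← hc, pow_add]
  set a := (-1 : ℂ) ^ ((insert μ K)ᶜ.filter (· < μ)).card with ha
  have ha2 : a * a = 1 := neg_one_pow_add_self _
  linear_combination (((-1 : ℂ) ^ (K.card * (K.card - 1) / 2) * (-1) ^ K.card *
    (-1) ^ (insert μ K)ᶜ.card * (-1) ^ (K.filter (· < μ)).card * eps Kᶜ K *
    ∏ μ ∈ K, ((η μ : ℤ) : ℂ)) * (((η μ : ℤ) : ℂ) * ((η μ : ℤ) : ℂ))) * ha2 +
    ((-1 : ℂ) ^ (K.card * (K.card - 1) / 2) * (-1) ^ K.card *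
    (-1) ^ (insert μ K)ᶜ.card * (-1) ^ (K.filter (· < μ)).card * eps Kᶜ K *
    ∏ μ ∈ K, ((η μ : ℤ) : ℂ)) * hη

theorem dx_mul_hodge (η : Fin (n + 2) → ℤˣ) (μ : Fin (n + 2)) (w : Alg n r) :
    ((η μ : ℤ) : ℂ) • (gen (.dx μ) * hodge η w) = (-1 : ℂ) ^ (n + 1) • hodge η (pd (.dx μ) w) := by
  have : (((η μ : ℤ) : ℂ) • (LinearMap.mulLeft ℂ (gen (.dx μ)) * hodge η) :
      Module.End ℂ (Alg n r)) = (-1 : ℂ) ^ (n + 1) • (hodge η * pd (.dx μ)) := by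
    refine lin_ext fun u J hu => ?_
    simp only [LinearMap.smul_apply, Module.End.mul_apply, LinearMap.mulLeft_apply]
    rw [hodge_mul_dxI η hu, (isGDer_pd_dx μ).leib, hu.pd_dx, zero_mul, zero_add, mul_smul_comm,
      ← mul_assoc, (hasPar_dx μ).mul_comm_sg, mul_assoc]
    by_cases h : μ ∈ J
    · obtain ⟨K, hK, rfl⟩ : ∃ K, μ ∉ K ∧ J = insert μ K :=
        ⟨J.erase μ, Finset.notMem_erase _ _, (Finset.insert_erase h).symm⟩
      have hins : insert μ (insert μ K)ᶜ = Kᶜ := by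
        rw [Finset.compl_insert, Finset.insert_erase (Finset.mem_compl.2 hK)]
      have hf : (insert μ K).filter (· < μ) = K.filter (· < μ) := by
        rw [Finset.filter_insert, if_neg (lt_irrefl _)]
      rw [dx_mul_dxI, if_neg (by simp), hins, pd_dxI_of_mem h, Finset.erase_insert hK, hf,
        mul_smul_comm, mul_smul_comm, map_smul, hodge_mul_dxI η (hu.sg 1), smul_smul, smul_smul,
        smul_smul, smul_smul, hodgeC_insert η hK, mul_assoc]
    · rw [dx_mul_dxI, if_pos (Finset.mem_compl.2 h), pd_dxI_of_notMem h, mul_zero, map_zero,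
        smul_zero, smul_zero, smul_zero]
  exact LinearMap.congr_fun this w

/-- Hodge duality exchanges i_ξ with multiplication by g(ξ), with a sign independent of the degree.
This is why odd lines transform with g(ξ) and even lines with i_ξ. -/
theorem gMul_hodge (η : Fin (n + 2) → ℤˣ) (ξ : Fin (n + 2) → ℂ) (w : Alg n r) :
    gMul η ξ (hodge η w) = (-1 : ℂ) ^ (n + 1) • hodge η (inner ξ w) := by
  rw [gMul, LinearMap.mulLeft_apply, Finset.sum_mul, inner_apply, map_sum, Finset.smul_sum]
  refine Finset.sum_congr rfl fun μ _ => ?_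
  rw [smul_mul_assoc, mul_comm, ← smul_smul, dx_mul_hodge, map_smul, smul_comm]

theorem hodgeC_mul_compl (η : Fin (n + 2) → ℤˣ) (J : Finset (Fin (n + 2))) :
    hodgeC η J * hodgeC η Jᶜ = (-1) ^ (J.card * (J.card - 1) / 2) *
      (-1) ^ ((n + 2 - J.card) * (n + 2 - J.card - 1) / 2) * (-1) ^ (J.card * (n + 2 - J.card)) *
        ∏ μ, ((η μ : ℤ) : ℂ) := by
  rw [hodgeC, hodgeC, compl_compl, eps_compl_swap, card_compl_eq, ← Finset.prod_mul_prod_compl J]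
  linear_combination ((-1) ^ (J.card * (J.card - 1) / 2) *
      (-1) ^ ((n + 2 - J.card) * (n + 2 - J.card - 1) / 2) * (-1) ^ (J.card * (n + 2 - J.card)) *
        ((∏ μ ∈ J, ((η μ : ℤ) : ℂ)) * ∏ μ ∈ Jᶜ, ((η μ : ℤ) : ℂ))) * eps_mul_eps Jᶜ J

/-- Only the fact that ** is a scalar on p-forms is used later; its value is immaterial. -/
theorem exists_hodge_hodge (η : Fin (n + 2) → ℤˣ) (p : ℕ) :
    ∃ t : ℂ, ∀ w : Alg n r, IsForm p w → hodge η (hodge η w) = t • w := by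
  refine ⟨(-1) ^ (p * (p - 1) / 2) * (-1) ^ ((n + 2 - p) * (n + 2 - p - 1) / 2) *
    (-1) ^ (p * (n + 2 - p)) * ∏ μ, ((η μ : ℤ) : ℂ), fun w hw => ?_⟩
  conv_lhs => rw [← hw.sum_coef, map_sum, map_sum]
  conv_rhs => rw [← hw.sum_coef, Finset.smul_sum]
  refine Finset.sum_congr rfl fun J _ => ?_
  rw [hodge_mul_dxI η (dxFree_coef _ _), map_smul, hodge_mul_dxI η (dxFree_coef _ _), compl_compl,
    smul_smul, hodgeC_mul_compl, J.2]

/-! ## Integration of densities -/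

theorem integral_extd (u : Alg n r) : integral (extd u) = 0 :=
  (Submodule.Quotient.mk_eq_zero _).2 ⟨u, rfl⟩

/-- A top form is closed for degree reasons, so L_ξ u = d i_ξ u. -/
theorem integral_lie (ξ : Fin (n + 2) → ℂ) {u : Alg n r} (hu : IsForm (n + 2) u) :
    integral (lie ξ u) = 0 := by
  rw [lie_apply, hu.extd.eq_zero (by omega), map_zero, zero_add, integral_extd]

/-! ### The Hodge pairing and its adjointness relations -/

section pairing

variable (G : GaugeAlgebra r N) (η : Fin (n + 2) → ℤˣ) (ξ : Fin (n + 2) → ℂ)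

theorem integral_Tr_extd {k : ℕ} {X : LForm n r} (hX : LPar k X) (Y : LForm n r) :
    integral (Tr G (app extd X) Y) = -((-1 : ℂ) ^ k • integral (Tr G X (app extd Y))) := by
  have h := integral_extd (Tr G X Y)
  rw [isGDer_extd.Tr G hX, map_add, map_smul, one_mul] at h
  exact eq_neg_of_add_eq_zero_left h

theorem integral_Tr_lie {p q : ℕ} (hpq : p + q = n + 2) {X Y : LForm n r} (hX : LDeg p X)
    (hY : LDeg q Y) :
    integral (Tr G (app (lie ξ) X) Y) = - integral (Tr G X (app (lie ξ) Y)) := by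
  have h := integral_lie ξ (hpq ▸ IsForm.Tr G hX hY)
  have h2 : lie ξ (Tr G X Y) = Tr G (app (lie ξ) X) Y + Tr G X (app (lie ξ) Y) := by
    have h3 : ∀ u v : Alg n r, lie ξ (u * v) = lie ξ u * v + u * lie ξ v := fun u v => by
      rw [(isVert_lie ξ).leib, sg_zero]
    simp only [Tr_eq, map_sum, h3, Finset.sum_add_distrib, app_apply]
  rw [h2, map_add] at h
  exact eq_neg_of_add_eq_zero_left h

/-- The pairing `∫ Tr X * Y`. -/
def pairing : LForm n r →ₗ[ℂ] LForm n r →ₗ[ℂ] LocalFunctional n r :=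
  LinearMap.mk₂ ℂ (fun X Y => integral (Tr G X (app (hodge η) Y)))
    (fun X X' Y => by rw [Tr_add_left, map_add]) (fun c X Y => by rw [Tr_smul_left, map_smul])
    (fun X Y Y' => by rw [app_add, Tr_add_right, map_add])
    (fun c X Y => by rw [app_smul, Tr_smul_right, map_smul])

theorem pairing_apply (X Y : LForm n r) :
    pairing G η X Y = integral (Tr G X (app (hodge η) Y)) := rfl

variable {i j p : ℕ} {X Y : LForm n r}

theorem pairing_comm (hX : LPar i X) (hY : LPar j Y) (hX' : LDeg p X) (hY' : LDeg p Y) :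
    pairing G η X Y = (-1 : ℂ) ^ (i * j + p) • pairing G η Y X := by
  rw [pairing_apply, Tr_hodge_comm G η hX hY hX' hY', map_smul, pairing_apply]

/-- Adjointness of g(ξ) and i_ξ: g(ξ) is carried past X and then turned into i_ξ by `gMul_hodge`. No
integration by parts enters. -/
theorem pairing_gMul_left (hX : LPar i X) (Y : LForm n r) :
    pairing G η (app (gMul η ξ) X) Y =
      (-1 : ℂ) ^ (i + n + 1) • pairing G η X (app (inner ξ) Y) := by
  have h : Tr G (app (gMul η ξ) X) (app (hodge η) Y) =
      (-1 : ℂ) ^ (i + n + 1) • Tr G X (app (hodge η) (app (inner ξ) Y)) := by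
    rw [Tr_eq, Tr_eq, Finset.smul_sum]
    refine Finset.sum_congr rfl fun a _ => ?_
    have h1 : ∀ u : Alg n r, gMul η ξ u = gMul η ξ 1 * u := fun u => by simp [gMul]
    have h2 : HasPar 1 (gMul η ξ (1 : Alg n r)) := (HasPar.one.gMul η ξ).congr rfl
    rw [app_apply, app_apply, app_apply, app_apply, h1, h2.mul_comm (hX a), smul_mul_assoc,
      mul_assoc, ← h1, gMul_hodge, mul_smul_comm, smul_smul, ← pow_add, one_mul, add_assoc]
  rw [pairing_apply, h, map_smul, pairing_apply]

theorem pairing_gMul_right (hX : LPar i X) (hY : LPar j Y) (hX' : LDeg (p + 1) X)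
    (hY' : LDeg p Y) : pairing G η X (app (gMul η ξ) Y) =
      (-1 : ℂ) ^ (i + n) • pairing G η (app (inner ξ) X) Y := by
  rw [pairing_comm G η hX (hY.gMul η ξ) hX' (hY'.gMul η ξ), pairing_gMul_left G η ξ hY,
    pairing_comm G η hY (hX.inner ξ) hY' (hX'.inner ξ), smul_smul, smul_smul, ← pow_add, ← pow_add]
  congr 1
  apply neg_one_pow_congr
  rcases Nat.mod_two_eq_zero_or_one i with hi | hi <;>
    rcases Nat.mod_two_eq_zero_or_one j with hj | hj <;>
    rcases Nat.mod_two_eq_zero_or_one p with hp | hp <;>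
    rcases Nat.mod_two_eq_zero_or_one n with hn | hn <;>
    simp [Nat.add_mod, Nat.mul_mod, hi, hj, hp, hn]

theorem pairing_lie (hX : LDeg p X) (hY : LDeg p Y) :
    pairing G η (app (lie ξ) X) Y = - pairing G η X (app (lie ξ) Y) := by
  by_cases hp : p ≤ n + 2
  · have h := integral_Tr_lie G ξ (by omega) hX (hY.hodge η)
    rw [pairing_apply, h, (isEvol_lie ξ).app_hodge, pairing_apply]
  · rw [hX.eq_zero (by omega), app_zero, map_zero, LinearMap.zero_apply, LinearMap.zero_apply,
      neg_zero]

theorem pairing_extd_left (hX : LPar i X) (Y : LForm n r) : pairing G η (app extd X) Y =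
    -((-1 : ℂ) ^ i • integral (Tr G X (app extd (app (hodge η) Y)))) :=
  integral_Tr_extd G hX _

theorem IsEvol.pairing {e : ℕ} {D : Module.End ℂ (Alg n r)} (h : IsEvol e D) (hX : LPar i X)
    (Y : LForm n r) : integral (D (Tr G X (app (BF.hodge η) Y))) =
      BF.pairing G η (app D X) Y + (-1 : ℂ) ^ (e * i) • BF.pairing G η X (app D Y) := by
  rw [h.toIsGDer.Tr G hX, h.app_hodge, map_add, map_smul, pairing_apply, pairing_apply]

theorem app_extd_gMul (X : LForm n r) :
    app extd (app (gMul η ξ) X) = - app (gMul η ξ) (app extd X) := by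
  funext a
  have h1 : ∀ u : Alg n r, gMul η ξ u = gMul η ξ 1 * u := fun u => by simp [gMul]
  have h2 : HasPar 1 (gMul η ξ (1 : Alg n r)) := (HasPar.one.gMul η ξ).congr rfl
  have h3 : extd (gMul η ξ (1 : Alg n r)) = 0 := by
    rw [gMul, LinearMap.mulLeft_apply, mul_one, map_sum]
    refine Finset.sum_eq_zero fun μ _ => ?_
    rw [map_smul, BF.extd_apply]
    simp [(isVert_del _).dx]
  change extd (gMul η ξ (X a)) = - gMul η ξ (extd (X a))
  rw [h1, isGDer_extd.leib_of_hasPar h2, h3, zero_mul, zero_add, h1 (extd _)]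
  module

/-- Since ** is a scalar, * i_ξ * dY is a multiple of g(ξ) dY, and dX g(ξ) dY is exact as g(ξ) is
closed. Hence the shifts *dc̄ and *dC̄ inside γ̂ and b̂ do not contribute to the variation of the
gauge-fixing terms. -/
theorem pairing_extd_inner_hodge_extd (hX : LPar i X) (hY : LDeg p Y) :
    pairing G η (app extd X) (app (inner ξ) (app (hodge η) (app extd Y))) = 0 := by
  obtain ⟨t, ht⟩ := exists_hodge_hodge (r := r) η (p + 1)
  have h : app (hodge η) (app (inner ξ) (app (hodge η) (app extd Y))) =
      ((-1 : ℂ) ^ (n + 1) * t) • app (gMul η ξ) (app extd Y) := by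
    funext a
    change hodge η (inner ξ (hodge η (extd (Y a)))) = ((-1 : ℂ) ^ (n + 1) * t) • gMul η ξ (extd (Y a))
    have h1 := gMul_hodge η ξ (hodge η (extd (Y a)))
    rw [ht (extd (Y a)) (hY.extd a), map_smul] at h1
    rw [← smul_smul, h1, smul_smul, neg_one_pow_add_self, one_smul]
  rw [pairing_apply, h, Tr_smul_right, map_smul, integral_Tr_extd G hX, app_extd_gMul,
    app_extd_extd, app_zero, neg_zero, Tr_zero_right, map_zero, smul_zero, neg_zero, smul_zero]

end pairing

/-! ## The Ward identity: the truncated action -/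

/-- i_ξ lowers the degree, and there are no forms of degree n + 3. -/
theorem proj_top_inner (ξ : Fin (n + 2) → ℂ) (u : Alg n r) : proj (n + 2) (inner ξ u) = 0 := by
  rw [← sum_proj u, map_sum, map_sum]
  refine Finset.sum_eq_zero fun p hp => ((isForm_proj p u).inner ξ).proj_of_ne ?_
  rw [Finset.mem_range] at hp
  omega

section

variable (G : GaugeAlgebra r N) (η : Fin (n + 2) → ℤˣ) (ξ : Fin (n + 2) → ℂ)

/-- W and -i_ξ agree on Φ₁ and Φ₂ and obey the same Leibniz rule. They differ on dΦ₂ only: W dΦ₂ = d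
i_ξ Φ₂, whereas -i_ξ dΦ₂ = d i_ξ Φ₂ - L_ξ Φ₂. -/
theorem wardS_polyAction : wardS η ξ (polyAction G (Phi1 η) (Phi2 η)) =
    - inner ξ (polyAction G (Phi1 η) (Phi2 η)) - Tr G (Phi1 η) (app (lie ξ) (Phi2 η)) := by
  have hW := isEvol_wardS (r := r) η ξ
  have hX := LPar.Phi1 (r := r) η
  have hXX := hX.bracket G hX
  simp only [polyAction, map_add, map_smul]
  rw [hW.toIsGDer.Tr G hX, hW.toIsGDer.Tr G hXX, (isGDer_inner ξ).Tr G hX,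
    (isGDer_inner ξ).Tr G hXX, hW.app_extd, wardS_Phi1, wardS_Phi2,
    app_bracket G hW.toIsGDer hX, app_bracket G (isGDer_inner ξ) hX, wardS_Phi1, app_lie_eq,
    app_neg, ← neg_one_smul ℂ (app (inner ξ) (Phi1 η)),
    ← neg_one_smul ℂ (app (inner ξ) (Phi2 η)), bracket_smul_left, bracket_smul_right]
  simp only [Tr_add_left, Tr_add_right, Tr_smul_left, Tr_smul_right, Tr_neg_right]
  module

theorem wardS_sigmaHat : wardS η ξ (sigmaHat G η) =
    - ∑ p ∈ Finset.range (n + 3), Tr G (phi1 η p) (app (lie ξ) (phi2 η (n + 2 - p))) := by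
  rw [sigmaHat_eq, ← (isEvol_wardS η ξ).proj_apply, wardS_polyAction, map_sub, map_neg,
    proj_top_inner, neg_zero, zero_sub, Phi2, app_sum, Phi1,
    proj_Tr_sum G (by omega) (LDeg.phi1 η) fun p => (LDeg.phi2 η p).lie ξ]

/-- The part of the breaking with the sources `b`, `γ`, `τ` coupled to translations. -/
def breakingLie : Alg n r :=
  - (∑ g : Fin (n + 1), Tr G (fld (.b g)) (app (lie ξ) (fld (.B g))))
  + (-1 : ℂ) ^ n • Tr G (fld .gamma) (app (lie ξ) (fld .A))
  + (-1 : ℂ) ^ n • Tr G (fld .tau) (app (lie ξ) (fld .c))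

/-- The hats are undone in Tr φ¹ L_ξ φ². No entry of one ladder shifted by an antighost is
multiplied by a shifted entry of the other, so only two kinds of remainders occur: A with *dc̄, and
B with *dC̄. -/
theorem integral_wardS_sigmaHat : integral (wardS η ξ (sigmaHat G η)) =
    integral (breakingLie G ξ) + pairing G η (fld .A) (app (lie ξ) (app extd (fld .cbar))) +
      ∑ g ∈ Finset.range n, (-1 : ℂ) ^ (n + g) •
        pairing G η (app (lie ξ) (phi2 η (n - g))) (app extd (CbarF 1 g)) := by
  have hc : - integral (Tr G (phi1 η 0) (app (lie ξ) (phi2 (r := r) η (n + 2)))) =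
      (-1 : ℂ) ^ n • integral (Tr G (fld .tau) (app (lie ξ) (fld .c))) := by
    rw [← integral_Tr_lie G ξ (by omega) (LDeg.phi1 η 0) (LDeg.phi2 η (n + 2)), phi2_tau,
      Tr_comm G ((LPar.phi1 η 0).lie ξ) LPar.tau, map_smul, one_mul]
    rfl
  have hA : - integral (Tr G (phi1 η 1) (app (lie ξ) (phi2 (r := r) η (n + 1)))) =
      (-1 : ℂ) ^ n • integral (Tr G (fld .gamma) (app (lie ξ) (fld .A))) +
        pairing G η (fld .A) (app (lie ξ) (app extd (fld .cbar))) := by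
    have h1 : integral (Tr G (fld .A) (app (lie ξ) (fld (n := n) (r := r) .gamma))) =
        - ((-1 : ℂ) ^ n • integral (Tr G (fld .gamma) (app (lie ξ) (fld .A)))) := by
      have h := integral_Tr_lie G ξ (p := 1) (q := n + 1) (by omega) (LDeg.fld (r := r) .A)
        (LDeg.fld .gamma)
      rw [Tr_comm G (LPar.A.lie ξ) LPar.gamma, map_smul, one_mul] at h
      rw [h, neg_neg]
    rw [phi2_gamma, gammaHat, app_sub, Tr_sub_right, map_sub,
      (isEvol_lie ξ).app_hodge, pairing_apply]
    change - (integral (Tr G (fld .A) _) - integral (Tr G (fld .A) _)) = _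
    rw [h1]
    module
  have hb : ∀ g : Fin (n + 1), integral (Tr G (phi1 η ((g : ℕ) + 2))
        (app (lie ξ) (phi2 (r := r) η (n + 2 - ((g : ℕ) + 2))))) =
      integral (Tr G (fld (.b g)) (app (lie ξ) (fld (.B g)))) -
        (-1 : ℂ) ^ (n + (g : ℕ)) •
          pairing G η (app (lie ξ) (phi2 η (n - (g : ℕ)))) (app extd (CbarF 1 (g : ℕ))) := by
    intro g
    rw [Nat.add_sub_add_right, phi1_b, phi2_B, bHat, Tr_add_left, Tr_smul_left, map_add, map_smul,
      Tr_comm G (((LPar.CbarF 1 (g : ℕ)).extd.hodge η).congr (l := 1) (by omega))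
        ((LPar.B g).lie ξ), map_smul, pairing_apply, smul_smul, ← pow_add]
    rw [show (g : ℕ) + 1 + 1 * n = n + (g : ℕ) + 1 by omega, pow_succ]
    module
  -- Degrees p = 0 and p = 1 give the τ and γ couplings, p = g + 2 the b couplings. The last
  -- antighost term, g = n, is outside the pyramid and vanishes.
  rw [wardS_sigmaHat, map_neg, map_sum, Finset.sum_range_succ', Finset.sum_range_succ',
    Finset.sum_range]
  rw [Finset.sum_congr rfl fun g _ => hb g, Finset.sum_sub_distrib,
    Fin.sum_univ_eq_sum_range (fun g => (-1 : ℂ) ^ (n + g) •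
      pairing G η (app (lie ξ) (phi2 η (n - g))) (app extd (CbarF 1 g))) (n + 1),
    Finset.sum_range_succ, CbarF_eq_zero (by omega : n < 1 + n), app_zero, map_zero, smul_zero,
    add_zero, neg_add, neg_add]
  simp only [Nat.zero_add, Nat.sub_zero] at hc hA ⊢
  rw [show n + 2 - 1 = n + 1 from rfl, hc, hA, breakingLie]
  simp only [map_add, map_neg, map_smul, map_sum]
  abel

/-! ## The Ward identity: gauge fixing part -/

theorem integral_wardS_kinetic {i : ℕ} {X : LForm n r} (hX : LPar i X) (Y : LForm n r) :
    integral (wardS η ξ (Tr G (app extd X) (app (hodge η) Y))) =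
      - pairing G η (app extd (app (wardS η ξ) X)) Y -
        (-1 : ℂ) ^ i • pairing G η (app extd X) (app (wardS η ξ) Y) := by
  have hW := isEvol_wardS (r := r) η ξ
  rw [hW.pairing G η hX.extd, hW.app_extd, map_smul, LinearMap.smul_apply, one_mul]
  module

theorem pairing_extd_lie {p : ℕ} {X Y : LForm n r} (hX : LDeg p X) (hY : LDeg (p + 1) Y) :
    pairing G η (app extd (app (lie ξ) X)) Y = - pairing G η (app extd X) (app (lie ξ) Y) := by
  rw [← pairing_lie G η ξ hX.extd hY]
  have h : app (lie ξ) (app extd X) = app extd (app (lie ξ) X) := by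
    rw [app_lie_eq, app_lie_eq, app_add, app_extd_extd, app_extd_extd, app_zero, add_zero, zero_add]
  rw [h]

/-- W π = L_ξ c̄ yields the negative of the c̄ remainder of the truncated action, and W A = -i_ξ b̂
yields the breaking term with b^{-1}_2. -/
theorem integral_wardS_pi :
    integral (wardS η ξ (- Tr G (app extd (fld .pi)) (app (hodge η) (fld .A)))) =
      - pairing G η (fld .A) (app (lie ξ) (app extd (fld .cbar))) +
        integral (Tr G (app extd (app (hodge η) (app (inner ξ) (fld (.b 0))))) (fld .pi)) := by
  have hA : app (wardS η ξ) (fld (r := r) .A) = - app (inner ξ) (bHat η 0) := by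
    rw [← phi1_b]
    exact wardS_phi1 η ξ 1
  have h1 : pairing G η (app extd (fld .pi)) (app (inner ξ) (bHat η 0)) =
      - integral (Tr G (app extd (app (hodge η) (app (inner ξ) (fld (.b 0))))) (fld .pi)) := by
    rw [bHat, app_add, app_smul, map_add, map_smul,
      pairing_extd_inner_hodge_extd G η ξ LPar.pi (LDeg.CbarF 1 _), smul_zero, add_zero,
      pairing_extd_left G η LPar.pi, Tr_comm G LPar.pi ((((LPar.b 0).inner ξ).hodge η).extd),
      map_smul, zero_mul]
    module
  have h2 := pairing_extd_lie G η ξ (LDeg.fld (r := r) .cbar) (LDeg.fld .A)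
  have h3 := pairing_lie G η ξ (LDeg.fld (r := r) .cbar).extd (LDeg.fld .A)
  have h4 := pairing_comm G η (p := 1) (LPar.cbar.extd.lie ξ) (LPar.A (r := r))
    ((LDeg.fld .cbar).extd.lie ξ) (LDeg.fld .A)
  rw [map_neg, map_neg, integral_wardS_kinetic G η ξ LPar.pi, wardS_pi, hA, map_neg, h1, h2, ← h3,
    h4]
  module

/-- By adjointness g(ξ)Π at position g + 1 against B^g cancels i_ξ B^g from the variation of
B^{g+1}. The sum telescopes: its lower end, where i_ξ γ̂ stands, is the breaking term with
Π^0_{n-1}, and its upper end is zero. The L_ξ C̄ part of W Π removes the C̄ remainder. -/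
theorem integral_wardS_B :
    integral (wardS η ξ (- ∑ g : Fin n,
        Tr G (app extd (PiF 1 g)) (app (hodge η) (fld (.B g.castSucc))))) =
      - (∑ g ∈ Finset.range n, (-1 : ℂ) ^ (n + g) •
        pairing G η (app (lie ξ) (phi2 η (n - g))) (app extd (CbarF 1 g))) +
      integral (Tr G (app extd (app (hodge η) (app (inner ξ) (fld .gamma)))) (PiF 1 0)) := by
  let a : ℕ → LocalFunctional n r := fun g =>
    pairing G η (app extd (PiF 1 g)) (app (inner ξ) (phi2 η (n - g + 1)))
  have h1 : ∀ g : Fin n, integral (wardS η ξ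
      (Tr G (app extd (PiF 1 g)) (app (hodge η) (fld (.B g.castSucc))))) =
      (-1 : ℂ) ^ (n + (g : ℕ)) •
        pairing G η (app (lie ξ) (phi2 η (n - (g : ℕ)))) (app extd (CbarF 1 (g : ℕ))) -
        (-1 : ℂ) ^ n • (a g - a ((g : ℕ) + 1)) := by
    intro g
    have hB : (fld (.B g.castSucc) : LForm n r) = phi2 η (n - (g : ℕ)) := (phi2_B η g.castSucc).symm
    have hC : LDeg (n - (g : ℕ) - 1 + 1) (phi2 η (n - (g : ℕ)) : LForm n r) :=
      (LDeg.phi2 η _).congr (by omega)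
    have ha : a ((g : ℕ) + 1) =
        pairing G η (app extd (PiF 1 ((g : ℕ) + 1))) (app (inner ξ) (phi2 η (n - (g : ℕ)))) := by
      simp only [a]
      rw [show n - ((g : ℕ) + 1) + 1 = n - (g : ℕ) by omega]
    have h2 := pairing_extd_lie G η ξ (LDeg.CbarF (r := r) 1 (g : ℕ)) hC
    rw [pairing_comm G η (LPar.CbarF 1 (g : ℕ)).extd ((LPar.phi2 η _).lie ξ)
      (LDeg.CbarF 1 (g : ℕ)).extd (hC.lie ξ)] at h2
    rw [hB, integral_wardS_kinetic G η ξ (LPar.PiF 1 (g : ℕ)), wardS_phi2,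
      wardS_PiF' η ξ le_rfl (Or.inl (by omega)), susyLine, if_pos odd_one, app_add, app_smul,
      app_extd_gMul, map_add, LinearMap.add_apply, h2, map_smul, LinearMap.smul_apply, map_neg,
      LinearMap.neg_apply, pairing_gMul_left G η ξ (LPar.PiF 1 ((g : ℕ) + 1)).extd, map_neg, ha]
    simp only [a]
    rw [neg_one_pow_congr (k := n + 1 + 1 + n + 1) (l := 1) (by omega),
      neg_one_pow_congr (k := (n + 1) * n + (n - (g : ℕ) - 1 + 1)) (l := n + (g : ℕ))]
    · simp only [Nat.reduceAdd, Nat.reduceDiv, pow_succ]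
      module
    · have := Nat.even_mul_succ_self n
      rw [Nat.even_iff, mul_comm] at this
      omega
  have h2 : (a 0 : LocalFunctional n r) = (-1 : ℂ) ^ n •
      integral (Tr G (app extd (app (hodge η) (app (inner ξ) (fld .gamma)))) (PiF 1 0)) := by
    simp only [a]
    rw [Nat.sub_zero, phi2_gamma, gammaHat, app_sub, map_sub,
      pairing_extd_inner_hodge_extd G η ξ (LPar.PiF 1 0) (LDeg.fld .cbar), sub_zero,
      pairing_extd_left G η (LPar.PiF 1 0), Tr_comm G (LPar.PiF 1 0)
        (((((LPar.gamma.inner ξ).hodge η).extd).congr (l := 0) (by omega))), map_smul, mul_zero,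
      pow_zero, one_smul, pow_succ]
    module
  have h3 : a n = 0 := by
    simp only [a]
    rw [PiF_eq_zero (by omega), app_zero, map_zero, LinearMap.zero_apply]
  rw [map_neg, map_neg, map_sum, map_sum, Finset.sum_congr rfl fun g _ => h1 g,
    Finset.sum_sub_distrib, Fin.sum_univ_eq_sum_range (fun g => (-1 : ℂ) ^ (n + g) •
      pairing G η (app (lie ξ) (phi2 η (n - g))) (app extd (CbarF 1 g))) n,
    ← Finset.smul_sum, Fin.sum_univ_eq_sum_range (fun g => a g - a (g + 1)) n,
    Finset.sum_range_sub', h3, sub_zero, h2, smul_smul, neg_one_pow_add_self, one_smul]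
  abel

end

/-! ## The Ward identity: the pyramids -/

/-- A telescoping sum with the convention a(-1) = 0, which is how a missing position g - 1 enters
the transformations. -/
theorem sum_range_sub_shift {M : Type*} [AddCommGroup M] (a : ℕ → M) (m : ℕ) :
    ∑ g ∈ Finset.range (m + 1), (a g - if g = 0 then 0 else a (g - 1)) = a m := by
  rw [Finset.sum_sub_distrib, Finset.sum_range_succ, Finset.sum_range_succ' _ m]
  simp

theorem susyLine_odd (η : Fin (n + 2) → ℤˣ) (ξ : Fin (n + 2) → ℂ) (F : ℕ → ℕ → LForm n r) {k : ℕ}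
    (hk : Odd k) (g : ℕ) : susyLine η ξ F k g =
      (-1 : ℂ) ^ (n + (k + 1) / 2) • app (gMul η ξ) (F k (g + 1)) := if_pos hk

theorem susyLine_even (η : Fin (n + 2) → ℤˣ) (ξ : Fin (n + 2) → ℂ) (F : ℕ → ℕ → LForm n r) {k : ℕ}
    (hk : Even k) (g : ℕ) : susyLine η ξ F k g =
      (-1 : ℂ) ^ (k / 2 + 1) • if g = 0 then 0 else app (inner ξ) (F k (g - 1)) := by
  rw [susyLine, if_neg (Nat.not_odd_iff_even.2 hk)]
  split_ifs
  · rw [smul_zero]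
  · rfl

section

variable (G : GaugeAlgebra r N) (η : Fin (n + 2) → ℤˣ) (ξ : Fin (n + 2) → ℂ)

/-- The terms L_ξ C̄ in the variations of the two multipliers cancel each other, so only the motion
within the lines remains. -/
theorem integral_wardS_pyramid {k g : ℕ} (hk : 2 ≤ k) (hg : k + g ≤ n) :
    integral (wardS η ξ
      (- Tr G (app extd (PiF k g)) (app (hodge η) (CbarF (k - 1) g))
       + (-1 : ℂ) ^ (n + 1) • Tr G (app extd (CbarF k g)) (app (hodge η) (PiF (k - 1) g)))) =
    (pairing G η (app extd (susyLine η ξ PiF k g)) (CbarF (k - 1) g) -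
      (-1 : ℂ) ^ n • pairing G η (app extd (PiF k g)) (susyLine η ξ CbarF (k - 1) g)) +
    ((-1 : ℂ) ^ n • pairing G η (app extd (susyLine η ξ CbarF k g)) (PiF (k - 1) g) +
      pairing G η (app extd (CbarF k g)) (susyLine η ξ PiF (k - 1) g)) := by
  have h := pairing_extd_lie G η ξ (LDeg.CbarF (r := r) k g)
    ((LDeg.CbarF (k - 1) g).congr (by omega))
  rw [map_add, map_add, map_neg, map_neg, map_smul, map_smul,
    integral_wardS_kinetic G η ξ (LPar.PiF k g), integral_wardS_kinetic G η ξ (LPar.CbarF k g),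
    wardS_CbarF' η ξ (by omega) (Or.inl hg), wardS_CbarF' η ξ (by omega) (Or.inl (by omega)),
    wardS_PiF' η ξ (by omega) (Or.inl hg), wardS_PiF' η ξ (by omega) (Or.inl (by omega)),
    app_add, map_add, map_add, LinearMap.add_apply, h, pow_succ]
  have hn := neg_one_pow_add_self n
  generalize (-1 : ℂ) ^ n = s at *
  match_scalars
  · norm_num
  · linear_combination hn
  · ring
  · ring
  · linear_combination hn

/-- Line k moves by g(ξ) and line k - 1 by i_ξ. After adjointness the two contributions are the same
pairings one position apart, with matching signs because (k-1)/2 + 1 = (k+1)/2. Both telescoping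
sums end outside the pyramid. -/
theorem integral_wardS_pyramid_odd {k : ℕ} (hk : 2 ≤ k) (hkn : k ≤ n) (hko : Odd k) :
    integral (wardS η ξ (∑ g ∈ Finset.range (n - k + 1),
      (- Tr G (app extd (PiF k g)) (app (hodge η) (CbarF (k - 1) g))
       + (-1 : ℂ) ^ (n + 1) • Tr G (app extd (CbarF k g)) (app (hodge η) (PiF (k - 1) g))))) = 0 := by
  have hke : Even (k - 1) := hko.tsub_odd odd_one
  let a : ℕ → LocalFunctional n r := fun g =>
    pairing G η (app extd (PiF k (g + 1))) (app (inner ξ) (CbarF (k - 1) g))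
  let b : ℕ → LocalFunctional n r := fun g =>
    pairing G η (app extd (CbarF k (g + 1))) (app (inner ξ) (PiF (k - 1) g))
  have ha : a (n - k) = 0 := by
    simp only [a]
    rw [PiF_eq_zero (by omega), app_zero, map_zero, LinearMap.zero_apply]
  have hb : b (n - k) = 0 := by
    simp only [b]
    rw [CbarF_eq_zero (by omega), app_zero, map_zero, LinearMap.zero_apply]
  have h : ∀ g ∈ Finset.range (n - k + 1), integral (wardS η ξ
      (- Tr G (app extd (PiF k g)) (app (hodge η) (CbarF (k - 1) g))
       + (-1 : ℂ) ^ (n + 1) • Tr G (app extd (CbarF k g)) (app (hodge η) (PiF (k - 1) g)))) =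
      (-1 : ℂ) ^ (n + (k + 1) / 2) • (a g - if g = 0 then 0 else a (g - 1)) -
        (-1 : ℂ) ^ ((k + 1) / 2) • (b g - if g = 0 then 0 else b (g - 1)) := by
    intro g hg
    rw [Finset.mem_range] at hg
    have ha' : (if g = 0 then 0 else a (g - 1)) =
        pairing G η (app extd (PiF k g))
          (if g = 0 then 0 else app (inner ξ) (CbarF (k - 1) (g - 1))) := by
      split_ifs with h
      · rw [map_zero]
      · simp only [a]
        rw [Nat.sub_add_cancel (by omega)]
    have hb' : (if g = 0 then 0 else b (g - 1)) =
        pairing G η (app extd (CbarF k g))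
          (if g = 0 then 0 else app (inner ξ) (PiF (k - 1) (g - 1))) := by
      split_ifs with h
      · rw [map_zero]
      · simp only [b]
        rw [Nat.sub_add_cancel (by omega)]
    rw [integral_wardS_pyramid G η ξ hk (by omega), susyLine_odd η ξ _ hko, susyLine_odd η ξ _ hko,
      susyLine_even η ξ _ hke, susyLine_even η ξ _ hke, app_smul, app_smul, app_extd_gMul,
      app_extd_gMul, map_smul, map_smul, map_smul, map_smul, LinearMap.smul_apply,
      LinearMap.smul_apply, map_neg, map_neg, LinearMap.neg_apply, LinearMap.neg_apply,
      pairing_gMul_left G η ξ (LPar.PiF k (g + 1)).extd,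
      pairing_gMul_left G η ξ (LPar.CbarF k (g + 1)).extd, ← ha', ← hb',
      neg_one_pow_congr (k := n + 1 + 1 + n + 1) (l := 1) (by omega),
      neg_one_pow_congr (k := n + 1 + n + 1) (l := 0) (by omega),
      show (k - 1) / 2 + 1 = (k + 1) / 2 by omega]
    have hn := neg_one_pow_add_self n
    simp only [a, b, pow_add]
    match_scalars
    · ring
    · ring
    · linear_combination (-(-1 : ℂ) ^ ((k + 1) / 2)) * hn
    · ring
  rw [map_sum, map_sum, Finset.sum_congr rfl h, Finset.sum_sub_distrib, ← Finset.smul_sum,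
    ← Finset.smul_sum, sum_range_sub_shift, sum_range_sub_shift, ha, hb, smul_zero, smul_zero,
    sub_zero]

/-- Shifting the index in the first sum pairs d i_ξ F with i_ξ dF at the same position; the
additional term drops out because F m is a 0-form. -/
theorem sum_pairing_inner_extd {F : ℕ → LForm n r} {m : ℕ} (hF : LDeg 0 (F m))
    (H : ℕ → LForm n r) : ∑ g ∈ Finset.range (m + 1),
      (pairing G η (app extd (if g = 0 then 0 else app (inner ξ) (F (g - 1)))) (H g) +
        pairing G η (app (inner ξ) (app extd (F g))) (H (g + 1))) =
      ∑ g ∈ Finset.range (m + 1), pairing G η (app (lie ξ) (F g)) (H (g + 1)) := by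
  have h0 : app (inner ξ) (F m) = 0 := funext fun a => (hF a).dxFree.inner ξ
  simp only [app_lie_eq, map_add, LinearMap.add_apply, Finset.sum_add_distrib]
  rw [add_comm]
  congr 1
  rw [Finset.sum_range_succ', Finset.sum_range_succ _ m, h0]
  simp [app_zero]

/-- Now i_ξ acts on the differentiated line k, and the adjoint of g(ξ) on line k - 1 lands there as
well. The two contributions do not cancel but add up to d i_ξ + i_ξ d = L_ξ, so a remainder is left.
-/
theorem integral_wardS_pyramid_even {k : ℕ} (hk : 2 ≤ k) (hkn : k ≤ n) (hke : Even k) :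
    integral (wardS η ξ (∑ g ∈ Finset.range (n - k + 1),
      (- Tr G (app extd (PiF k g)) (app (hodge η) (CbarF (k - 1) g))
       + (-1 : ℂ) ^ (n + 1) • Tr G (app extd (CbarF k g)) (app (hodge η) (PiF (k - 1) g))))) =
    ∑ g ∈ Finset.range (n - k + 1), (-1 : ℂ) ^ (k / 2 + 1) •
      (pairing G η (app (lie ξ) (PiF k g)) (CbarF (k - 1) (g + 1)) +
        (-1 : ℂ) ^ n • pairing G η (app (lie ξ) (CbarF k g)) (PiF (k - 1) (g + 1))) := by
  have hko : Odd (k - 1) := Nat.Even.sub_odd (by omega) hke odd_one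
  have h : ∀ g ∈ Finset.range (n - k + 1), integral (wardS η ξ
      (- Tr G (app extd (PiF k g)) (app (hodge η) (CbarF (k - 1) g))
       + (-1 : ℂ) ^ (n + 1) • Tr G (app extd (CbarF k g)) (app (hodge η) (PiF (k - 1) g)))) =
      (-1 : ℂ) ^ (k / 2 + 1) •
        (pairing G η (app extd (if g = 0 then 0 else app (inner ξ) (PiF k (g - 1))))
          (CbarF (k - 1) g) +
        pairing G η (app (inner ξ) (app extd (PiF k g))) (CbarF (k - 1) (g + 1))) +
      ((-1 : ℂ) ^ (k / 2 + 1) * (-1 : ℂ) ^ n) •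
        (pairing G η (app extd (if g = 0 then 0 else app (inner ξ) (CbarF k (g - 1))))
          (PiF (k - 1) g) +
        pairing G η (app (inner ξ) (app extd (CbarF k g))) (PiF (k - 1) (g + 1))) := by
    intro g hg
    rw [Finset.mem_range] at hg
    have h1 : pairing G η (app extd (PiF k g)) (app (gMul η ξ) (CbarF (k - 1) (g + 1))) =
        pairing G η (app (inner ξ) (app extd (PiF k g))) (CbarF (k - 1) (g + 1)) := by
      rw [pairing_gMul_right G η ξ (p := n - g - k) (LPar.PiF k g).extd (LPar.CbarF _ _)
        (LDeg.PiF k g).extd ((LDeg.CbarF _ _).congr (by omega)),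
        neg_one_pow_congr (l := 0) (by omega), pow_zero, one_smul]
    have h2 : pairing G η (app extd (CbarF k g)) (app (gMul η ξ) (PiF (k - 1) (g + 1))) =
        - pairing G η (app (inner ξ) (app extd (CbarF k g))) (PiF (k - 1) (g + 1)) := by
      rw [pairing_gMul_right G η ξ (p := n - g - k) (LPar.CbarF k g).extd (LPar.PiF _ _)
        (LDeg.CbarF k g).extd ((LDeg.PiF _ _).congr (by omega)),
        neg_one_pow_congr (l := 1) (by omega), pow_one, neg_one_smul]
    rw [integral_wardS_pyramid G η ξ hk (by omega), susyLine_odd η ξ _ hko, susyLine_odd η ξ _ hko,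
      susyLine_even η ξ _ hke, susyLine_even η ξ _ hke, app_smul, app_smul, map_smul, map_smul,
      map_smul, map_smul, LinearMap.smul_apply, LinearMap.smul_apply, h1, h2, smul_smul,
      Nat.sub_add_cancel (by omega), ← pow_add,
      neg_one_pow_congr (k := n + (n + k / 2)) (l := k / 2) (by omega), pow_add, pow_succ]
    module
  have hP := sum_pairing_inner_extd G η ξ (F := PiF (r := r) k) (m := n - k)
    ((LDeg.PiF k (n - k)).congr (by omega)) (CbarF (k - 1))
  have hC := sum_pairing_inner_extd G η ξ (F := CbarF (r := r) k) (m := n - k)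
    ((LDeg.CbarF k (n - k)).congr (by omega)) (PiF (k - 1))
  rw [map_sum, map_sum, Finset.sum_congr rfl h, Finset.sum_add_distrib, ← Finset.smul_sum,
    ← Finset.smul_sum, hP, hC]
  simp only [smul_add, smul_smul, Finset.sum_add_distrib, ← Finset.smul_sum]

/-- This is where the gauge parameters are fixed. Their alternation in g makes the terms Π i_ξ Π
telescope to zero, and their overall sign makes the terms with L_ξ C̄ the negative of the remainder
of line k + 1 in `integral_wardS_pyramid_even`. -/
theorem integral_wardS_gaugeParameters {k : ℕ} (hk : 1 ≤ k) (hkn : k + 1 ≤ n) (hko : Odd k) :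
    integral (wardS η ξ (∑ g ∈ Finset.Icc 1 (n - k),
      xSusy n k g • Tr G (PiF k g) (app (hodge η) (PiF (k + 1) (g - 1))))) =
    - ∑ g ∈ Finset.range (n - (k + 1) + 1), (-1 : ℂ) ^ ((k + 1) / 2 + 1) •
      (pairing G η (app (lie ξ) (PiF (k + 1) g)) (CbarF k (g + 1)) +
        (-1 : ℂ) ^ n • pairing G η (app (lie ξ) (CbarF (k + 1) g)) (PiF k (g + 1))) := by
  have hW := isEvol_wardS (r := r) η ξ
  have hke : Even (k + 1) := hko.add_one
  let a : ℕ → LocalFunctional n r := fun g =>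
    ((-1 : ℂ) ^ (g + 1)) • pairing G η (PiF k (g + 2)) (app (inner ξ) (PiF (k + 1) g))
  have ha : a (n - (k + 1)) = 0 := by
    simp only [a]
    rw [PiF_eq_zero (by omega), map_zero, LinearMap.zero_apply, smul_zero]
  have h : ∀ g ∈ Finset.range (n - (k + 1) + 1), integral (wardS η ξ
      (xSusy n k (g + 1) • Tr G (PiF k (g + 1)) (app (hodge η) (PiF (k + 1) g)))) =
      (a g - if g = 0 then 0 else a (g - 1)) - (-1 : ℂ) ^ ((k + 1) / 2 + 1) •
      (pairing G η (app (lie ξ) (PiF (k + 1) g)) (CbarF k (g + 1)) +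
        (-1 : ℂ) ^ n • pairing G η (app (lie ξ) (CbarF (k + 1) g)) (PiF k (g + 1))) := by
    intro g hg
    rw [Finset.mem_range] at hg
    have ha' : (if g = 0 then 0 else a (g - 1)) = (-1 : ℂ) ^ g •
        pairing G η (PiF k (g + 1))
          (if g = 0 then 0 else app (inner ξ) (PiF (k + 1) (g - 1))) := by
      split_ifs with h
      · rw [map_zero, smul_zero]
      · simp only [a]
        rw [Nat.sub_add_cancel (by omega), show g - 1 + 2 = g + 1 by omega]
    have hP : LDeg (n - g - (k + 1)) (PiF k (g + 1) : LForm n r) :=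
      (LDeg.PiF k (g + 1)).congr (by omega)
    have hC : LDeg (n - g - (k + 1)) (CbarF k (g + 1) : LForm n r) :=
      (LDeg.CbarF k (g + 1)).congr (by omega)
    have hnn : (n * (n + 1)) % 2 = 0 := Nat.even_iff.1 (Nat.even_mul_succ_self n)
    have hnn' : ((n + 1) * n) % 2 = 0 := by rwa [mul_comm]
    have h1 : pairing G η (app (lie ξ) (CbarF k (g + 1))) (PiF (k + 1) g) =
        - ((-1 : ℂ) ^ (n + g) • pairing G η (app (lie ξ) (PiF (k + 1) g)) (CbarF k (g + 1))) := by
      rw [pairing_lie G η ξ hC (LDeg.PiF (k + 1) g),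
        pairing_comm G η (LPar.CbarF _ _) ((LPar.PiF _ _).lie ξ) hC ((LDeg.PiF _ _).lie ξ)]
      rw [neg_one_pow_congr]
      obtain ⟨l, hl⟩ := hke
      omega
    have h2 : pairing G η (PiF k (g + 1)) (app (lie ξ) (CbarF (k + 1) g)) =
        (-1 : ℂ) ^ (n + g) • pairing G η (app (lie ξ) (CbarF (k + 1) g)) (PiF k (g + 1)) := by
      rw [pairing_comm G η (LPar.PiF _ _) ((LPar.CbarF _ _).lie ξ) hP ((LDeg.CbarF _ _).lie ξ)]
      rw [neg_one_pow_congr]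
      obtain ⟨l, hl⟩ := hke
      omega
    rw [map_smul, map_smul, hW.pairing G η (LPar.PiF k (g + 1)), wardS_PiF' η ξ hk (Or.inr hko),
      wardS_PiF' η ξ (by omega) (Or.inl (by omega)), susyLine_odd η ξ _ hko,
      susyLine_even η ξ _ hke, map_add, map_add, LinearMap.add_apply, map_smul, map_smul,
      LinearMap.smul_apply, pairing_gMul_left G η ξ (LPar.PiF k (g + 1 + 1)), h1, h2, ha', one_mul,
      xSusy, neg_one_pow_congr (k := n + 1 + n + 1) (l := 0) (by omega)]
    simp only [a]
    have hn := neg_one_pow_add_self n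
    have hg := neg_one_pow_add_self g
    have hq := neg_one_pow_add_self ((k + 1) / 2)
    simp only [pow_add, pow_one, pow_zero]
    generalize (-1 : ℂ) ^ n = s at *
    generalize (-1 : ℂ) ^ g = t at *
    generalize (-1 : ℂ) ^ ((k + 1) / 2) = u at *
    match_scalars
    · linear_combination (-t * s * s) * hq - t * hn
    · linear_combination u * t * t * hn + u * hg
    · linear_combination (-t * s * s) * hq - t * hn
    · linear_combination u * s * s * s * hg + u * s * hn
  have hI : Finset.Icc 1 (n - k) = (Finset.range (n - (k + 1) + 1)).image (· + 1) := by
    rw [Finset.range_eq_Ico, Finset.image_add_right_Ico]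
    ext x
    simp only [Finset.mem_Icc, Finset.mem_Ico]
    omega
  rw [hI, Finset.sum_image fun _ _ _ _ h => add_left_injective 1 h, map_sum, map_sum]
  simp only [Nat.add_sub_cancel]
  rw [Finset.sum_congr rfl h, Finset.sum_sub_distrib, sum_range_sub_shift, ha, zero_sub]

/-- Each even line k leaves exactly what the gauge-parameter term of line k - 1 removes; odd lines
leave nothing. -/
theorem integral_wardS_pyramids : integral (wardS η ξ
    ((∑ k ∈ Finset.Icc 2 n, ∑ g ∈ Finset.range (n - k + 1),
      (- Tr G (app extd (PiF k g)) (app (hodge η) (CbarF (k - 1) g))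
       + (-1 : ℂ) ^ (n + 1) • Tr G (app extd (CbarF k g)) (app (hodge η) (PiF (k - 1) g))))
    + ∑ k ∈ (Finset.Icc 1 n).filter Odd, ∑ g ∈ Finset.Icc 1 (n - k),
      xSusy n k g • Tr G (PiF k g) (app (hodge η) (PiF (k + 1) (g - 1))))) = 0 := by
  let U : ℕ → LocalFunctional n r := fun k => integral (wardS η ξ (∑ g ∈ Finset.Icc 1 (n - k),
    xSusy n k g • Tr G (PiF k g) (app (hodge η) (PiF (k + 1) (g - 1)))))
  have h1 : ∀ k ∈ Finset.Icc 2 n, integral (wardS η ξ (∑ g ∈ Finset.range (n - k + 1),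
      (- Tr G (app extd (PiF k g)) (app (hodge η) (CbarF (k - 1) g))
       + (-1 : ℂ) ^ (n + 1) • Tr G (app extd (CbarF k g)) (app (hodge η) (PiF (k - 1) g))))) =
      - if Odd (k - 1) then U (k - 1) else 0 := by
    intro k hk
    rw [Finset.mem_Icc] at hk
    rcases Nat.even_or_odd k with hke | hko
    · have hko : Odd (k - 1) := Nat.Even.sub_odd (by omega) hke odd_one
      rw [if_pos hko, integral_wardS_pyramid_even G η ξ hk.1 hk.2 hke]
      simp only [U]
      rw [integral_wardS_gaugeParameters G η ξ (by omega) (by omega) hko, neg_neg,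
        Nat.sub_add_cancel (by omega)]
    · rw [if_neg (Nat.not_odd_iff_even.2 (hko.tsub_odd odd_one)), neg_zero,
        integral_wardS_pyramid_odd G η ξ hk.1 hk.2 hko]
  -- The last line k = n has no partner line k + 1, and correspondingly its sum over g is empty.
  have hU : U n = 0 := by
    simp only [U]
    rw [Nat.sub_self, Finset.Icc_eq_empty (by omega), Finset.sum_empty, map_zero, map_zero]
  rw [map_add, map_add, map_sum, map_sum, map_sum, map_sum, Finset.sum_congr rfl h1,
    Finset.sum_filter, Finset.sum_neg_distrib]
  change - _ + ∑ k ∈ Finset.Icc 1 n, (if Odd k then U k else 0) = 0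
  rcases n with _ | m
  · simp
  · have hI : Finset.Icc 2 (m + 1) = (Finset.Icc 1 m).image (· + 1) := by
      rw [Finset.image_add_right_Icc]
    rw [hI, Finset.sum_image fun _ _ _ _ h => add_left_injective 1 h,
      ← Finset.insert_Icc_right_eq_Icc_add_one (by omega), Finset.sum_insert (by simp), hU]
    simp

/-! ## The Ward identity -/

theorem integral_wardS_sigma :
    integral (wardS η ξ (sigma G η (xSusy n))) = integral (breaking G η ξ) := by
  have h : sigma G η (xSusy n) = sigmaHat G η +
      - Tr G (app extd (fld .pi)) (app (hodge η) (fld .A)) +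
      -(∑ g : Fin n, Tr G (app extd (PiF 1 g)) (app (hodge η) (fld (.B g.castSucc)))) +
      ((∑ k ∈ Finset.Icc 2 n, ∑ g ∈ Finset.range (n - k + 1),
      (- Tr G (app extd (PiF k g)) (app (hodge η) (CbarF (k - 1) g))
       + (-1 : ℂ) ^ (n + 1) • Tr G (app extd (CbarF k g)) (app (hodge η) (PiF (k - 1) g))))
    + ∑ k ∈ (Finset.Icc 1 n).filter Odd, ∑ g ∈ Finset.Icc 1 (n - k),
      xSusy n k g • Tr G (PiF k g) (app (hodge η) (PiF (k + 1) (g - 1)))) := by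
    rw [sigma, sigmaPi]
    abel
  rw [h, map_add, map_add, map_add, map_add, map_add, map_add, integral_wardS_pyramids,
    integral_wardS_sigmaHat, integral_wardS_pi, integral_wardS_B]
  have hb : breaking G η ξ = breakingLie G ξ +
      Tr G (app extd (app (hodge η) (app (inner ξ) (fld (.b 0))))) (fld .pi) +
      Tr G (app extd (app (hodge η) (app (inner ξ) (fld .gamma)))) (PiF 1 0) := rfl
  rw [hb, map_add, map_add]
  abel

end

/-! ## Linearity of the breaking in the quantum fields -/

open Classical in
theorem quantumCount_jet (F : Field n) (I) (a : Fin r) (α) :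
    quantumCount (gen (.jet F I a α)) = if F.IsSource then 0 else gen (.jet F I a α) := by
  rw [quantumCount, vf_gen]

/-- Counting quantum fields is an even derivation that commutes with ∂_μ, hence it passes through d,
i_ξ, L_ξ and Hodge duality. Linearity of the breaking then only requires that each trace couple a
source to a quantum field. -/
theorem isEvol_quantumCount : IsEvol 0 (quantumCount : Module.End ℂ (Alg n r)) := by
  classical
  have hv : IsVert 0 (quantumCount : Module.End ℂ (Alg n r)) :=
  { toIsGDer := by
      refine isGDer_vf fun x => ?_
      cases x with
      | jet F I a α =>
        simp only
        split_ifs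
        · exact HasPar.zero _
        · exact hasPar_gen _
      | dx ν => exact HasPar.zero _
    dx := fun μ => by rw [quantumCount, vf_gen]
    jet := fun F I a α => by
      rw [quantumCount_jet]
      split_ifs
      · exact map_zero _
      · exact dxFree_jet _ _ _ _ }
  refine ⟨hv, fun μ u => ?_⟩
  have : (del μ * quantumCount - quantumCount * del μ : Module.End ℂ (Alg n r)) = 0 := by
    refine ((isVert_del μ).comm_even hv).ext IsVert.zero fun F I a α => ?_
    simp only [LinearMap.sub_apply, Module.End.mul_apply, del_jet, quantumCount_jet,
      LinearMap.zero_apply]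
    split_ifs
    · rw [map_zero, sub_zero]
    · rw [del_jet, sub_self]
  exact (sub_eq_zero.1 (LinearMap.congr_fun this u)).symm

theorem quantumCount_source {F : Field n} (h : F.IsSource) :
    app quantumCount (fld (r := r) F) = 0 := by
  funext a
  rw [app_apply, fld, map_sum]
  refine Finset.sum_eq_zero fun I _ => ?_
  rw [isEvol_quantumCount.mul_dxI, quantumCount_jet, if_pos h, zero_mul]

theorem quantumCount_quantum {F : Field n} (h : ¬ F.IsSource) :
    app quantumCount (fld (r := r) F) = fld F := by
  funext a
  rw [app_apply, fld, map_sum]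
  refine Finset.sum_congr rfl fun I _ => ?_
  rw [isEvol_quantumCount.mul_dxI, quantumCount_jet, if_neg h]

theorem quantumCount_PiF (k g : ℕ) :
    app quantumCount (PiF (n := n) (r := r) k g) = PiF k g := by
  rw [PiF]
  split_ifs
  · exact quantumCount_quantum id
  · exact app_zero _

section

variable (G : GaugeAlgebra r N)

theorem quantumCount_Tr {X Y : LForm n r} (h : app quantumCount X = 0 ∧ app quantumCount Y = Y ∨
    app quantumCount X = X ∧ app quantumCount Y = 0) :
    quantumCount (Tr G X Y) = Tr G X Y := by
  have h1 : quantumCount (Tr G X Y) = Tr G (app quantumCount X) Y + Tr G X (app quantumCount Y) := by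
    simp only [Tr_eq, map_sum, isEvol_quantumCount.leib, sg_zero, Finset.sum_add_distrib, app_apply]
  rw [h1]
  rcases h with ⟨h, h'⟩ | ⟨h, h'⟩
  · rw [h, h', Tr_zero_left, zero_add]
  · rw [h, h', Tr_zero_right, add_zero]

theorem quantumCount_breaking (η : Fin (n + 2) → ℤˣ) (ξ : Fin (n + 2) → ℂ) :
    quantumCount (breaking G η ξ) = breaking G η ξ := by
  have hQ := isEvol_quantumCount (n := n) (r := r)
  have hlie : ∀ {F F' : Field n}, F.IsSource → ¬ F'.IsSource →
      quantumCount (Tr G (fld F) (app (lie ξ) (fld F'))) =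
        Tr G (fld F) (app (lie ξ) (fld (r := r) F')) := fun hF hF' =>
    quantumCount_Tr G (Or.inl ⟨quantumCount_source hF, by
      rw [hQ.app_lie, quantumCount_quantum hF']⟩)
  have hhodge : ∀ {F : Field n} {Y : LForm n r}, F.IsSource → app quantumCount Y = Y →
      quantumCount (Tr G (app extd (app (hodge η) (app (inner ξ) (fld F)))) Y) =
        Tr G (app extd (app (hodge η) (app (inner ξ) (fld F)))) Y := fun hF hY =>
    quantumCount_Tr G (Or.inl ⟨by
      rw [hQ.app_extd, hQ.app_hodge, hQ.app_inner, quantumCount_source hF]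
      simp only [app_zero, smul_zero], hY⟩)
  simp only [breaking, map_add, map_neg, map_smul, map_sum]
  rw [Finset.sum_congr rfl fun g _ => hlie (F := .b g) (F' := .B g) trivial id,
    hlie (F := .gamma) (F' := .A) trivial id, hlie (F := .tau) (F' := .c) trivial id,
    hhodge (F := .b 0) trivial (quantumCount_quantum id),
    hhodge (F := .gamma) trivial (quantumCount_PiF 1 0)]

end

end BF

end

theorem mainTheorem3 (n r N : ℕ) (G : BF.GaugeAlgebra r N) (η : Fin (n + 2) → ℤˣ) :
    -- the operator `W^S_(ξ)` implements the supersymmetry transformations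
    (∀ ξ : Fin (n + 2) → ℂ,
      (∀ p ≤ n + 1,
        BF.app (BF.wardS η ξ) (BF.phi1 (r := r) η p) = - BF.app (BF.inner ξ) (BF.phi1 η (p + 1)) ∧
        BF.app (BF.wardS η ξ) (BF.phi2 (r := r) η p) = - BF.app (BF.inner ξ) (BF.phi2 η (p + 1))) ∧
      BF.app (BF.wardS η ξ) (BF.phi1 (r := r) η (n + 2)) = 0 ∧ BF.app (BF.wardS η ξ) (BF.phi2 (r := r) η (n + 2)) = 0 ∧
      BF.app (BF.wardS η ξ) (BF.fld (r := r) .cbar) = 0 ∧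
      BF.app (BF.wardS η ξ) (BF.fld (r := r) .pi) = BF.app (BF.lie ξ) (BF.fld .cbar) ∧
      ∀ k g : ℕ, 1 ≤ k → k + g ≤ n →
        BF.app (BF.wardS η ξ) (BF.CbarF (r := r) k g) = BF.susyCbar η ξ k g ∧
        BF.app (BF.wardS η ξ) (BF.PiF (r := r) k g) = BF.susyPi η ξ k g) ∧
    -- the off-shell algebra, for arbitrary gauge parameters
    (∀ (x : ℕ → ℕ → ℂ) (ξ ξ' : Fin (n + 2) → ℂ),
      BF.slavnov (BF.sigma G η x) * BF.wardS η ξ + BF.wardS η ξ * BF.slavnov (BF.sigma G η x)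
        = BF.wardT ξ ∧
      BF.slavnov (BF.sigma G η x) * BF.slavnov (BF.sigma G η x) = 0 ∧
      BF.wardS η ξ * BF.wardS η ξ' + BF.wardS η ξ' * BF.wardS η ξ
        = (0 : Module.End ℂ (BF.Alg n r))) ∧
    -- the Ward identity of supersymmetry and the linearity of its breaking
    (∀ ξ : Fin (n + 2) → ℂ,
      BF.integral (BF.wardS η ξ (BF.sigma G η (BF.xSusy n)))
        = BF.integral (BF.breaking G η ξ) ∧
      BF.quantumCount (BF.breaking G η ξ) = BF.breaking G η ξ) := by
  refine ⟨fun ξ => ⟨fun p _ => ⟨BF.wardS_phi1 η ξ p, BF.wardS_phi2 η ξ p⟩, BF.wardS_phi1_top η ξ,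
    BF.wardS_phi2_top η ξ, BF.wardS_cbar η ξ, BF.wardS_pi η ξ, fun k g hk hg =>
      ⟨BF.wardS_CbarF η ξ hk hg, BF.wardS_PiF η ξ hk hg⟩⟩,
    fun x ξ ξ' => ⟨BF.slavnov_wardS G η x ξ, BF.slavnov_sq G η x, BF.wardS_anticomm η ξ ξ'⟩,
    fun ξ => ⟨BF.integral_wardS_sigma G η ξ, BF.quantumCount_breaking G η ξ⟩⟩
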